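/- Let $G$ be a finite acyclic directed graph with distinct sources $S_1,\dots,S_l$ and distinct sinks $R_1,\dots,R_l$, and let $c_i$ be the min-cut between $S_i$ and $R_i$, i.e. the least number of edges leaving a vertex set that contains $S_i$ but not $R_i$. A set of Menger's paths from $S_i$ to $R_i$ is a set consisting of the maximum number of pairwise edge-disjoint directed paths from $S_i$ to $R_i$. Given a set $\alpha_i$ of Menger's paths from $S_i$ to $R_i$ for each $i$, we say that a merging occurs at an edge $e$ if $e$ lies on a path $p\in\alpha_i$ and on a path $q\in\alpha_j$ with $i\neq j$, and the edge immediately before $e$ on $p$ and the edge immediately before $e$ on $q$ both exist and are distinct. The number of mergings $|G|_{\mathcal M}(\alpha_1,\dots,\alpha_l)$ is the number of edges at which a merging occurs (all mergings at the same edge are counted once). Let $M(G)$ be the minimum of $|G|_{\mathcal M}(\alpha_1,\dots,\alpha_l)$ over all choices of sets of Menger's paths $\alpha_1,\dots,\alpha_l$, and let $\mathcal M(c_1,\dots,c_l)$ be the supremum of $M(G)$ over all such $G$ with min-cuts $c_1,\dots,c_l$ (parallel edges are allowed; subdividing edges shows that this does not affect the supremum). Theorem. For every integer $k\ge 1$,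 $$\mathcal M(\underbrace{1,\dots,1}_{k},2)=\begin{cases}3k-1 & \text{if } k\le 6,\\[2pt] \left\lfloor \dfrac{k^2}{4}\right\rfloor+k+2 & \text{if } k>6.\end{cases}$$ -/

import Mathlib

/-- A directed graph on the vertex type `V` with edge type `E`; the edge `e` runs from `src e` to
`tgt e`.  Parallel edges are allowed. -/
structure DirGraph (V E : Type) where
  src : E → V
  tgt : E → V

namespace DirGraph

/-- `p` is a path from `s` to `t`: a nonempty list of concatenated edges that starts at `s` and
ends at `t`. -/
def IsPath {V E : Type} (G : DirGraph V E) (s t : V) (p : List E) : Prop :=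
  p.IsChain (fun e f => G.tgt e = G.src f) ∧
    p.head?.map G.src = some s ∧ p.getLast?.map G.tgt = some t

/-- There is no directed cycle. -/
def Acyclic {V E : Type} (G : DirGraph V E) : Prop :=
  ∀ (v : V) (p : List E), ¬ G.IsPath v v p

/-- The min-cut between `s` and `t`: the least number of edges that leave a vertex set containing
`s` but not `t`. -/
noncomputable def minCut {V E : Type} (G : DirGraph V E) (s t : V) : ℕ∞ :=
  ⨅ (X : Set V) (_ : s ∈ X) (_ : t ∉ X), {e : E | G.src e ∈ X ∧ G.tgt e ∉ X}.encard

/-- A set of pairwise edge-disjoint paths from `s` to `t`. -/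
def IsEdgeDisjointPaths {V E : Type} (G : DirGraph V E) (s t : V) (P : Finset (List E)) : Prop :=
  (∀ p ∈ P, G.IsPath s t p) ∧ ∀ p ∈ P, ∀ q ∈ P, p ≠ q → List.Disjoint p q

/-- A set of Menger's paths from `s` to `t`: a set consisting of the maximum number of pairwise
edge-disjoint paths from `s` to `t`. -/
def IsMengerPaths {V E : Type} (G : DirGraph V E) (s t : V) (P : Finset (List E)) : Prop :=
  G.IsEdgeDisjointPaths s t P ∧
    ∀ Q : Finset (List E), G.IsEdgeDisjointPaths s t Q → Q.card ≤ P.card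

end DirGraph

/-- Paths from different groups `α i` merge at the edge `e`: two paths from two different groups
contain `e`, and the edges immediately ahead of `e` on these two paths (both exist and) are
distinct.  (`[f, e] <:+: p` says that `f` and `e` are consecutive on `p`.) -/
def IsMergingEdge {ι E : Type} (α : ι → Finset (List E)) (e : E) : Prop :=
  ∃ i j : ι, i ≠ j ∧ ∃ p ∈ α i, ∃ q ∈ α j, ∃ f g : E,
    f ≠ g ∧ [f, e] <:+: p ∧ [g, e] <:+: q

/-- The number of mergings among paths from different groups, counted without multiplicity: all
mergings at the same edge count as one. -/
noncomputable def numMergings {ι E : Type} (α : ι → Finset (List E)) : ℕ∞ :=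
  {e : E | IsMergingEdge α e}.encard

/-- A finite acyclic directed graph with distinct sources `S i` and distinct sinks `R i` such that
the min-cut between `S i` and `R i` is `c i`. -/
structure Network {ι : Type} (c : ι → ℕ) where
  V : Type
  E : Type
  finite_V : Finite V
  finite_E : Finite E
  graph : DirGraph V E
  acyclic : graph.Acyclic
  S : ι → V
  R : ι → V
  S_injective : Function.Injective S
  R_injective : Function.Injective R
  minCut_eq : ∀ i, graph.minCut (S i) (R i) = (c i : ℕ∞)

/-- `M(G)`: the minimum of the number of mergings over all choices of a set `α i` of Menger's paths
from `S i` to `R i` for every `i`. -/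
noncomputable def Network.minMergings {ι : Type} {c : ι → ℕ} (G : Network c) : ℕ∞ :=
  ⨅ (α : ι → Finset (List G.E)) (_ : ∀ i, G.graph.IsMengerPaths (G.S i) (G.R i) (α i)),
    numMergings α

/-- `𝓜(c₁, …, c_l)`: the supremum of `M(G)` over all networks with distinct sources, distinct sinks
and min-cuts `c₁, …, c_l`. -/
noncomputable def mergingNumber {ι : Type} (c : ι → ℕ) : ℕ∞ :=
  ⨆ G : Network c, G.minMergings

/-!
The first `k` commodities are called players; the two paths of the last commodity are called lines.

**Upper bound.** By Menger's theorem, which is needed for two paths only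
(`exists_two_disjoint_conn`), there are a path for every player and two disjoint lines. Among the
relations between consecutive edges that admit such paths, take a minimal one (`Routing`). Then
every remaining transition is indispensable, either to some player or to the pair of lines
(`Routing.crit_or`). Hence an edge that is entered by two distinct transitions carries a label: it
is a meeting of two players or a landing of a player on a line, and every label occurs only once.
So it remains to bound the number of meetings plus the number of landings.

Indispensability turns into order relations along the paths, which are collected in the structure
`FlowSystem`. The main tool is that a landing on a line comes with a cut vertex: an edge on the
other line that is met by every path of the last commodity that avoids the transition of the line at
the landing. It follows that

* the graph of meetings has no triangles (`FlowSystem.no_triangle`);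
* the players that land on one fixed line do not form 4-cycles (`FlowSystem.no_four_cycle`);
* among the players that land on both lines the meetings form disjoint paths
  (`FlowSystem.full_in_unique`, `FlowSystem.full_out_unique`);
* a player that lands on one line and a player that lands on the other one do not both meet the same
  four players that land on both lines (`FlowSystem.no_two_four`).

For graphs with these properties, `MergeGraph.total_le` bounds the number of edges plus the number
of landings by induction: in a minimal counterexample the deletion of a vertex, and the deletion of
the two ends of an edge, show that degrees and degree sums along edges are large, which contradicts
one of the properties above.

**Lower bound.** A `Timetable` prescribes which two lines or players share an edge at which time. It
carries a certificate that no player can leave its own line and that the two paths of the last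
commodity cannot leave theirs either, so the Menger's paths are unique, and every prescribed
encounter is an unavoidable merging (`Timetable.card_le_mergingNumber`). In `chainTimetable` every
player meets both lines and the next player, which makes `3 * k - 1` mergings. In `gridTimetable`
most players are divided into two halves, every player of the one half meets every player of the
other one, and this leads to about `k ^ 2 / 4` mergings.
-/

/-! ### A graph theoretic extremal problem -/

/-- The merging number `𝓜(1, …, 1, 2)` for `n` ones; it is `0` for `n = 0`. -/
def extremalValue (n : ℕ) : ℕ := if n ≤ 6 then 3 * n - 1 else n ^ 2 / 4 + n + 2

/-- The graph of meetings between players, together with the sets `X ℓ` of players that land on the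
line `ℓ`, and the restrictions on these data: there are no triangles, the players that land on both
lines induce disjoint paths (`full_three` and `full_leaf`), the players in `X ℓ` do not form
4-cycles, and a vertex of `X ℓ` and one of `X !ℓ` do not have four common neighbours that land on
both lines. -/
structure MergeGraph (I : Type) where
  Adj : I → I → Prop
  X : Bool → Set I
  symm : ∀ a b, Adj a b → Adj b a
  irrefl : ∀ a, ¬ Adj a a
  triangle : ∀ a b c, Adj a b → Adj b c → ¬ Adj a c
  full_three : ∀ c a₁ a₂ a₃, (∀ ℓ, c ∈ X ℓ) → (∀ ℓ, a₁ ∈ X ℓ) → (∀ ℓ, a₂ ∈ X ℓ) →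
    (∀ ℓ, a₃ ∈ X ℓ) → Adj c a₁ → Adj c a₂ → Adj c a₃ → a₁ ≠ a₂ → a₁ ≠ a₃ → a₂ ≠ a₃ → False
  full_leaf : ∀ W : Finset I, W.Nonempty → (∀ c ∈ W, ∀ ℓ, c ∈ X ℓ) →
    ∃ c ∈ W, ∀ a ∈ W, ∀ b ∈ W, Adj c a → Adj c b → a = b
  four_cycle : ∀ ℓ, ∀ a ∈ X ℓ, ∀ b ∈ X ℓ, ∀ c ∈ X ℓ, ∀ d ∈ X ℓ, Adj a b → Adj b c → Adj c d →
    Adj d a → a ≠ c → b ≠ d → False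
  two_four : ∀ ℓ, ∀ u ∈ X ℓ, ∀ v ∈ X (!ℓ), ∀ W : Finset I, W.card = 4 → (∀ c ∈ W, ∀ ℓ, c ∈ X ℓ) →
    (∀ c ∈ W, Adj u c) → (∀ c ∈ W, Adj v c) → False

namespace MergeGraph

open Classical Finset

variable {I : Type} (M : MergeGraph I)

/-- The number of lines on which `u` lands. -/
noncomputable def wt (u : I) : ℕ := (if u ∈ M.X true then 1 else 0) + if u ∈ M.X false then 1 else 0

/-- The neighbours of `u` in `W`. -/
noncomputable def nbr (W : Finset I) (u : I) : Finset I := W.filter (M.Adj u)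

/-- Twice the number of meetings and landings of the players in `W`. -/
noncomputable def total (W : Finset I) : ℕ := ∑ u ∈ W, ((M.nbr W u).card + 2 * M.wt u)

variable {M} {W : Finset I} {u v : I}

lemma nbr_subset : M.nbr W u ⊆ W := filter_subset _ _

lemma mem_nbr : v ∈ M.nbr W u ↔ v ∈ W ∧ M.Adj u v := mem_filter

lemma wt_le : M.wt u ≤ 2 := by
  unfold wt
  split_ifs <;> simp

lemma full_of_wt (h : 2 ≤ M.wt u) : ∀ ℓ, u ∈ M.X ℓ := by
  unfold wt at h
  split_ifs at h with h1 h2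
  · intro ℓ
    cases ℓ
    · exact h2
    · exact h1
  all_goals omega

lemma exists_of_wt (h : 1 ≤ M.wt u) : ∃ ℓ, u ∈ M.X ℓ := by
  unfold wt at h
  split_ifs at h with h1 h2 h2
  · exact ⟨_, h1⟩
  · exact ⟨_, h1⟩
  · exact ⟨_, h2⟩
  · omega

lemma nbr_erase (hu : u ∈ W) : (M.nbr (W.erase u) v).card + (if M.Adj v u then 1 else 0) =
    (M.nbr W v).card := by
  have h : M.nbr (W.erase u) v = (M.nbr W v).erase u := by
    ext x
    simp only [mem_nbr, mem_erase]
    tauto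
  rw [h]
  split_ifs with hA
  · exact card_erase_add_one (mem_nbr.2 ⟨hu, hA⟩)
  · rw [erase_eq_of_notMem fun hm => hA (mem_nbr.1 hm).2, add_zero]

/-- Deletion of a player. -/
lemma total_erase (hu : u ∈ W) :
    M.total (W.erase u) + 2 * (M.nbr W u).card + 2 * M.wt u = M.total W := by
  have h1 : M.total W = ∑ v ∈ W.erase u, ((M.nbr W v).card + 2 * M.wt v) +
      ((M.nbr W u).card + 2 * M.wt u) := (sum_erase_add _ _ hu).symm
  have h2 : ∑ v ∈ W.erase u, ((M.nbr W v).card + 2 * M.wt v) =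
      M.total (W.erase u) + ∑ v ∈ W.erase u, if M.Adj v u then 1 else 0 := by
    rw [total, ← sum_add_distrib]
    refine sum_congr rfl fun v _ => ?_
    rw [← nbr_erase (M := M) (v := v) hu]
    ring
  have h3 : ∑ v ∈ W.erase u, (if M.Adj v u then 1 else 0) = (M.nbr W u).card := by
    rw [← card_filter]
    congr 1
    ext x
    simp only [mem_filter, mem_erase, mem_nbr]
    constructor
    · rintro ⟨⟨-, h⟩, h'⟩
      exact ⟨h, M.symm _ _ h'⟩
    · rintro ⟨h, h'⟩
      exact ⟨⟨fun e => M.irrefl u (e ▸ h'), h⟩, M.symm _ _ h'⟩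
  omega

lemma even_total (W : Finset I) : Even (M.total W) := by
  induction W using Finset.strongInduction with
  | H W ih =>
    rcases W.eq_empty_or_nonempty with rfl | ⟨u, hu⟩
    · simp [total]
    · obtain ⟨m, hm⟩ := ih _ (erase_ssubset hu)
      exact ⟨m + (M.nbr W u).card + M.wt u, by rw [← total_erase hu, hm]; ring⟩

lemma disjoint_nbr (h : M.Adj u v) : Disjoint (M.nbr W u) (M.nbr W v) := by
  rw [Finset.disjoint_left]
  intro x hx hx'
  exact M.triangle u v x h (mem_nbr.1 hx').2 (mem_nbr.1 hx).2

lemma card_nbr_add (h : M.Adj u v) : (M.nbr W u).card + (M.nbr W v).card ≤ W.card := by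
  rw [← card_union_of_disjoint (disjoint_nbr h)]
  exact card_le_card (union_subset (filter_subset _ _) (filter_subset _ _))

/-- A player that lands on both lines meets at most two of its kind. -/
lemma full_nbr_card (hu : M.wt u = 2) {N : Finset I} (hN : ∀ v ∈ N, M.Adj u v ∧ M.wt v = 2) :
    N.card ≤ 2 := by
  by_contra hcon
  obtain ⟨a, b, c, ha, hb, hc, hab, hac, hbc⟩ := two_lt_card_iff.1 (not_le.1 hcon)
  exact M.full_three u a b c (full_of_wt hu.ge) (full_of_wt (hN a ha).2.ge)
    (full_of_wt (hN b hb).2.ge) (full_of_wt (hN c hc).2.ge) (hN a ha).1 (hN b hb).1 (hN c hc).1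
    hab hac hbc

/-- Two players that land on both lines do not have two common neighbours that land on the same
line. -/
lemma no_cycle {c c' a b : I} (hc : M.wt c = 2) (hc' : M.wt c' = 2) (hne : c ≠ c') (hab : a ≠ b)
    {ℓ : Bool} (ha : a ∈ M.X ℓ) (hb : b ∈ M.X ℓ) (h1 : M.Adj c a) (h2 : M.Adj c b)
    (h3 : M.Adj c' a) (h4 : M.Adj c' b) : False :=
  M.four_cycle ℓ c (full_of_wt hc.ge ℓ) a ha c' (full_of_wt hc'.ge ℓ) b hb h1 (M.symm _ _ h3) h4
    (M.symm _ _ h2) hne hab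

/-- Two players that land on both lines have at most two common neighbours that land somewhere. -/
lemma no_three_common {c c' : I} (hc : M.wt c = 2) (hc' : M.wt c' = 2) (hne : c ≠ c')
    {N : Finset I} (hN : ∀ a ∈ N, M.Adj c a ∧ M.Adj c' a ∧ 1 ≤ M.wt a) : N.card ≤ 2 := by
  by_contra hcon
  have hmaps : ∀ a ∈ N, ∃ ℓ, a ∈ M.X ℓ := fun a ha => exists_of_wt (hN a ha).2.2
  choose! f hf using hmaps
  obtain ⟨a, ha, b, hb, hab, hfab⟩ := exists_ne_map_eq_of_card_lt_of_maps_to (s := N)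
    (t := (univ : Finset Bool)) (f := f) (by simpa using hcon) (fun _ _ => mem_univ _)
  exact no_cycle hc hc' hne hab (hf a ha) (hfab ▸ hf b hb) (hN a ha).1 (hN b hb).1 (hN a ha).2.1
    (hN b hb).2.1

/-- Some player does not land on both lines, if every player has two neighbours. -/
lemma exists_wt_lt (hW : W.Nonempty) (hd : ∀ u ∈ W, 2 ≤ (M.nbr W u).card) :
    ∃ s ∈ W, M.wt s < 2 := by
  by_contra hcon
  push Not at hcon
  obtain ⟨c, hc, huniq⟩ := M.full_leaf W hW fun c hc => full_of_wt (hcon c hc)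
  have : (M.nbr W c).card ≤ 1 := card_le_one.2 fun a ha b hb =>
    huniq a (mem_nbr.1 ha).1 b (mem_nbr.1 hb).1 (mem_nbr.1 ha).2 (mem_nbr.1 hb).2
  have := hd c hc
  omega

/-- The increments of the extremal value, on which the induction in `total_le` rests. -/
lemma extremalValue_diff {n : ℕ} (h : 8 ≤ n) :
    extremalValue (n - 1) + n / 2 + 1 = extremalValue n ∧
      extremalValue (n - 2) + n + 1 ≤ extremalValue n := by
  obtain ⟨m, rfl | rfl⟩ := Nat.even_or_odd' n
  · obtain ⟨m, rfl⟩ : ∃ j, m = j + 4 := ⟨m - 4, by omega⟩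
    have e1 : (2 * (m + 4)) ^ 2 / 4 = (m + 4) ^ 2 := by
      rw [show (2 * (m + 4)) ^ 2 = (m + 4) ^ 2 * 4 by ring]; simp
    have e2 : (2 * (m + 4) - 1) ^ 2 / 4 = (m + 4) * (m + 3) := by
      rw [show 2 * (m + 4) - 1 = 2 * m + 7 by omega,
        show (2 * m + 7) ^ 2 = 1 + (m + 4) * (m + 3) * 4 by ring, Nat.add_mul_div_right _ _ (by simp)]
      simp
    have e3 : (2 * (m + 4) - 2) ^ 2 / 4 = (m + 3) ^ 2 := by
      rw [show 2 * (m + 4) - 2 = 2 * (m + 3) by omega,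
        show (2 * (m + 3)) ^ 2 = (m + 3) ^ 2 * 4 by ring]; simp
    unfold extremalValue
    rw [if_neg (by omega), if_neg (by omega), e1, e2, e3]
    constructor
    · have : 2 * (m + 4) / 2 = m + 4 := by omega
      rw [this]
      have : (m + 4) ^ 2 = (m + 4) * (m + 3) + (m + 4) := by ring
      omega
    · have : (m + 4) ^ 2 = (m + 3) ^ 2 + 2 * m + 7 := by ring
      split_ifs with hs
      · obtain rfl : m = 0 := by omega
        simp
      · omega
  · obtain ⟨m, rfl⟩ : ∃ j, m = j + 4 := ⟨m - 4, by omega⟩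
    have e1 : (2 * (m + 4) + 1) ^ 2 / 4 = (m + 5) * (m + 4) := by
      rw [show (2 * (m + 4) + 1) ^ 2 = 1 + (m + 5) * (m + 4) * 4 by ring,
        Nat.add_mul_div_right _ _ (by simp)]
      simp
    have e2 : (2 * (m + 4) + 1 - 1) ^ 2 / 4 = (m + 4) ^ 2 := by
      rw [show 2 * (m + 4) + 1 - 1 = 2 * (m + 4) by omega,
        show (2 * (m + 4)) ^ 2 = (m + 4) ^ 2 * 4 by ring]; simp
    have e3 : (2 * (m + 4) + 1 - 2) ^ 2 / 4 = (m + 4) * (m + 3) := by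
      rw [show 2 * (m + 4) + 1 - 2 = 2 * m + 7 by omega,
        show (2 * m + 7) ^ 2 = 1 + (m + 4) * (m + 3) * 4 by ring, Nat.add_mul_div_right _ _ (by simp)]
      simp
    unfold extremalValue
    rw [if_neg (by omega), if_neg (by omega), if_neg (by omega), e1, e2, e3]
    constructor
    · have : (2 * (m + 4) + 1) / 2 = m + 4 := by omega
      rw [this]
      have : (m + 5) * (m + 4) = (m + 4) ^ 2 + (m + 4) := by ring
      omega
    · have : (m + 5) * (m + 4) = (m + 4) * (m + 3) + 2 * (m + 4) := by ring
      omega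

/-- A set of at least seven players in which all degrees and the degree sums of edges are large. -/
lemma false_of_seven (hW : W.Nonempty) (hd : ∀ u ∈ W, 3 ≤ (M.nbr W u).card)
    (hw : ∀ u ∈ W, 1 ≤ M.wt u)
    (he : ∀ u ∈ W, ∀ v ∈ W, M.Adj u v → 3 ≤ M.wt u + M.wt v)
    (hn : ∀ u ∈ W, ∀ v ∈ W, M.Adj u v → M.wt u = 1 →
      W.card ≤ (M.nbr W u).card + (M.nbr W v).card) : False := by
  obtain ⟨s, hs, hs'⟩ := exists_wt_lt hW fun u hu => (hd u hu).trans' (by norm_num)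
  have hs1 : M.wt s = 1 := by have := hw s hs; omega
  obtain ⟨a, b, ha, hb, hab⟩ := one_lt_card_iff.1 (lt_of_lt_of_le (by norm_num) (hd s hs))
  have key : ∀ c ∈ M.nbr W s, M.wt c = 2 ∧ M.nbr W c = W \ M.nbr W s := by
    intro c hc
    obtain ⟨hcW, hsc⟩ := mem_nbr.1 hc
    refine ⟨le_antisymm wt_le (by have := he s hs c hcW hsc; omega), ?_⟩
    refine eq_of_subset_of_card_le ?_ ?_
    · intro x hx
      exact mem_sdiff.2 ⟨(mem_nbr.1 hx).1, fun hx' => disjoint_left.1 (disjoint_nbr hsc) hx' hx⟩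
    · rw [card_sdiff_of_subset nbr_subset]
      have := hn s hs c hcW hsc hs1
      omega
  have h3 : (M.nbr W a).card ≤ 2 := by
    refine no_three_common (key a ha).1 (key b hb).1 hab fun x hx => ?_
    have hx' : x ∈ M.nbr W b := by rw [(key b hb).2, ← (key a ha).2]; exact hx
    exact ⟨(mem_nbr.1 hx).2, (mem_nbr.1 hx').2, hw x (mem_nbr.1 hx).1⟩
  have := hd a (mem_nbr.1 ha).1
  omega

/-- The bound for the six-element sets, where the extremal graphs are not unique. -/
lemma false_of_six (hn : W.card = 6) (hV : ∀ u ∈ W, 4 ≤ (M.nbr W u).card + M.wt u)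
    (hT : 36 ≤ M.total W) : False := by
  have htri : ∀ u v, M.Adj u v → (M.nbr W u).card + (M.nbr W v).card ≤ 6 := fun u v h =>
    (card_nbr_add h).trans hn.le
  have hd2 : ∀ u ∈ W, 2 ≤ (M.nbr W u).card := fun u hu => by
    have := hV u hu
    have : M.wt u ≤ 2 := wt_le
    omega
  -- no player has four neighbours
  have hd3 : ∀ v ∈ W, (M.nbr W v).card ≤ 3 := by
    intro v hv
    by_contra hcon
    have hnb : ∀ c ∈ M.nbr W v, (M.nbr W c).card = 2 ∧ M.wt c = 2 := by
      intro c hc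
      obtain ⟨hcW, hvc⟩ := mem_nbr.1 hc
      have h1 := htri v c hvc
      have h2 := hV c hcW
      have h3 : M.wt c ≤ 2 := wt_le
      constructor <;> omega
    have hcard : (M.nbr W v).card = 4 := by
      obtain ⟨c, hc⟩ : (M.nbr W v).Nonempty := card_pos.1 (by omega)
      have h1 := htri v c (mem_nbr.1 hc).2
      have h2 := (hnb c hc).1
      omega
    have hvn : v ∉ M.nbr W v := fun h => M.irrefl v (mem_nbr.1 h).2
    have hvf : M.wt v ≠ 2 := fun hf => by
      have := full_nbr_card hf (N := M.nbr W v) fun c hc => ⟨(mem_nbr.1 hc).2, (hnb c hc).2⟩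
      omega
    have hsub : insert v (M.nbr W v) ⊆ W := insert_subset hv (filter_subset _ _)
    have hrest : (W \ insert v (M.nbr W v)).card = 1 := by
      rw [card_sdiff_of_subset hsub, card_insert_of_notMem hvn]
      omega
    obtain ⟨u, hu⟩ := card_eq_one.1 hrest
    have huW : u ∈ W \ insert v (M.nbr W v) := hu ▸ mem_singleton_self u
    obtain ⟨huW, hu'⟩ := mem_sdiff.1 huW
    rw [mem_insert, not_or] at hu'
    have hall : ∀ c ∈ M.nbr W v, M.Adj u c := by
      intro c hc
      obtain ⟨x, hx, hxv⟩ := exists_mem_ne (s := M.nbr W c) (by have := (hnb c hc).1; omega) v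
      obtain ⟨hxW, hcx⟩ := mem_nbr.1 hx
      have : x ∈ W \ insert v (M.nbr W v) := by
        refine mem_sdiff.2 ⟨hxW, fun h => ?_⟩
        rcases mem_insert.1 h with h | h
        · exact hxv h
        · exact M.triangle v c x (mem_nbr.1 hc).2 hcx (mem_nbr.1 h).2
      rw [hu, mem_singleton] at this
      exact this ▸ M.symm _ _ hcx
    have huf : M.wt u ≠ 2 := fun hf => by
      have := full_nbr_card hf (N := M.nbr W v) fun c hc => ⟨hall c hc, (hnb c hc).2⟩
      omega
    have hdu : (M.nbr W u).card ≤ 4 := by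
      rw [← hcard]
      refine card_le_card fun x hx => ?_
      obtain ⟨hxW, hux⟩ := mem_nbr.1 hx
      by_contra hxn
      by_cases hxv : x = v
      · exact hu'.2 (mem_nbr.2 ⟨huW, hxv ▸ M.symm _ _ hux⟩)
      · have : x ∈ W \ insert v (M.nbr W v) := by
          refine mem_sdiff.2 ⟨hxW, fun h => ?_⟩
          rcases mem_insert.1 h with h | h
          · exact hxv h
          · exact hxn h
        rw [hu, mem_singleton] at this
        exact M.irrefl u (this ▸ hux)
    have htot : M.total W = ((M.nbr W u).card + 2 * M.wt u) + (((M.nbr W v).card + 2 * M.wt v) +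
        ∑ c ∈ M.nbr W v, ((M.nbr W c).card + 2 * M.wt c)) := by
      rw [total, ← sum_sdiff hsub, hu, sum_singleton, sum_insert hvn]
    have hsum : ∑ c ∈ M.nbr W v, ((M.nbr W c).card + 2 * M.wt c) = 24 := by
      rw [sum_congr rfl fun c hc => by rw [(hnb c hc).1, (hnb c hc).2], sum_const, hcard]
      rfl
    have hwu : M.wt u ≤ 2 := wt_le
    have hwv : M.wt v ≤ 2 := wt_le
    have hu1 : M.wt u = 1 := by omega
    have hv1 : M.wt v = 1 := by omega
    obtain ⟨ℓ, hℓ⟩ := exists_of_wt hu1.ge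
    obtain ⟨ℓ', hℓ'⟩ := exists_of_wt hv1.ge
    have hadj : ∀ c ∈ M.nbr W v, M.Adj v c := fun c hc => (mem_nbr.1 hc).2
    by_cases hll : ℓ' = ℓ
    · subst hll
      obtain ⟨a, b, ha, hb, hab⟩ := one_lt_card_iff.1 (show 1 < (M.nbr W v).card by omega)
      exact no_cycle (hnb a ha).2 (hnb b hb).2 hab hu'.1 hℓ hℓ' (M.symm _ _ (hall a ha))
        (M.symm _ _ (hadj a ha)) (M.symm _ _ (hall b hb)) (M.symm _ _ (hadj b hb))
    · obtain rfl : ℓ' = !ℓ := by revert hll; cases ℓ <;> cases ℓ' <;> simp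
      exact M.two_four ℓ u hℓ v hℓ' _ hcard (fun c hc => full_of_wt (hnb c hc).2.ge) hall hadj
  have hw1 : ∀ u ∈ W, 1 ≤ M.wt u := fun u hu => by
    have := hV u hu
    have := hd3 u hu
    omega
  -- the players that land on one line only have three neighbours
  obtain ⟨s, hs, hs'⟩ := exists_wt_lt (card_pos.1 (by omega)) hd2
  have hs1 : M.wt s = 1 := by have := hw1 s hs; omega
  have hsd : (M.nbr W s).card = 3 := by
    have := hV s hs
    have := hd3 s hs
    omega
  obtain ⟨x, y, z, hxy, hxz, hyz, hN⟩ := card_eq_three.1 hsd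
  have hsn : s ∉ M.nbr W s := fun h => M.irrefl s (mem_nbr.1 h).2
  have hrest : ((W \ M.nbr W s).erase s).card = 2 := by
    rw [card_erase_of_mem (mem_sdiff.2 ⟨hs, hsn⟩), card_sdiff_of_subset nbr_subset]
    omega
  obtain ⟨t, r, htr, hR⟩ := card_eq_two.1 hrest
  have hmx : x ∈ W ∧ M.Adj s x := mem_nbr.1 (hN ▸ by simp)
  have hmy : y ∈ W ∧ M.Adj s y := mem_nbr.1 (hN ▸ by simp)
  have hmz : z ∈ W ∧ M.Adj s z := mem_nbr.1 (hN ▸ by simp)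
  have hmt : t ∈ (W \ M.nbr W s).erase s := hR ▸ by simp
  have hmr : r ∈ (W \ M.nbr W s).erase s := hR ▸ by simp
  simp only [mem_erase, mem_sdiff, mem_nbr, not_and] at hmt hmr
  have hst : ¬ M.Adj s t := hmt.2.2 hmt.2.1
  have hsr : ¬ M.Adj s r := hmr.2.2 hmr.2.1
  have hWeq : W = {s, t, r, x, y, z} := by
    have h1 : W = insert s ((W \ M.nbr W s).erase s) ∪ M.nbr W s := by
      rw [insert_erase (mem_sdiff.2 ⟨hs, hsn⟩), sdiff_union_of_subset nbr_subset]
    rw [h1, hR, hN]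
    ext
    simp only [mem_union, mem_insert, mem_singleton]
    tauto
  have nxy : ¬ M.Adj x y := fun h => M.triangle s x y hmx.2 h hmy.2
  have nxz : ¬ M.Adj x z := fun h => M.triangle s x z hmx.2 h hmz.2
  have nyz : ¬ M.Adj y z := fun h => M.triangle s y z hmy.2 h hmz.2
  have flip : ∀ {a b}, ¬ M.Adj a b → ¬ M.Adj b a := fun h h' => h (M.symm _ _ h')
  set a : I → I → ℕ := fun u v => if M.Adj u v then 1 else 0 with ha
  have asymm : ∀ u v, a u v = a v u := fun u v => by
    simp only [ha]
    congr 1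
    exact propext ⟨M.symm _ _, M.symm _ _⟩
  have ale : ∀ u v, a u v ≤ 1 := fun u v => by simp only [ha]; split_ifs <;> simp
  have a0 : ∀ {u v}, ¬ M.Adj u v → a u v = 0 := fun h => if_neg h
  have a1 : ∀ {u v}, M.Adj u v → a u v = 1 := fun h => if_pos h
  have aof : ∀ {u v}, a u v = 1 → M.Adj u v := fun {u v} h => by
    by_contra h'
    rw [a0 h'] at h
    exact zero_ne_one h
  have nst : s ≠ t := fun e => hmt.1 e.symm
  have nsr : s ≠ r := fun e => hmr.1 e.symm
  have ne_of : ∀ {u v}, M.Adj s u → ¬ M.Adj s v → v ≠ u := fun h h' e => h' (e ▸ h)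
  have ntx := ne_of hmx.2 hst
  have nty := ne_of hmy.2 hst
  have ntz := ne_of hmz.2 hst
  have nrx := ne_of hmx.2 hsr
  have nry := ne_of hmy.2 hsr
  have nrz := ne_of hmz.2 hsr
  have nsx := ne_of hmx.2 (M.irrefl s)
  have nsy := ne_of hmy.2 (M.irrefl s)
  have nsz := ne_of hmz.2 (M.irrefl s)
  have hsum : ∀ F : I → ℕ, ∑ v ∈ W, F v = F s + (F t + (F r + (F x + (F y + F z)))) := by
    intro F
    rw [hWeq, sum_insert (by simp [nst, nsr, nsx, nsy, nsz]),
      sum_insert (by simp [htr, ntx, nty, ntz]), sum_insert (by simp [nrx, nry, nrz]),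
      sum_insert (by simp [hxy, hxz]), sum_insert (by simp [hyz]), sum_singleton]
  have hdeg : ∀ u, (M.nbr W u).card = a u s + (a u t + (a u r + (a u x + (a u y + a u z)))) := by
    intro u
    rw [← hsum, nbr, card_filter]
  rw [total, hsum] at hT
  have wx := hw1 x hmx.1
  have wy := hw1 y hmy.1
  have wz := hw1 z hmz.1
  have wr := hw1 r hmr.2.1
  have wt := hw1 t hmt.2.1
  have wx' : M.wt x ≤ 2 := wt_le
  have wy' : M.wt y ≤ 2 := wt_le
  have wz' : M.wt z ≤ 2 := wt_le
  have wr' : M.wt r ≤ 2 := wt_le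
  have wt' : M.wt t ≤ 2 := wt_le
  have vx := hV x hmx.1
  have vy := hV y hmy.1
  have vz := hV z hmz.1
  have vr := hV r hmr.2.1
  have vt := hV t hmt.2.1
  have dx := hdeg x
  have dy := hdeg y
  have dz := hdeg z
  have dr := hdeg r
  have dt := hdeg t
  rw [a1 (M.symm _ _ hmx.2), a0 nxy, a0 nxz, a0 (M.irrefl x), asymm x t, asymm x r] at dx
  rw [a1 (M.symm _ _ hmy.2), a0 (flip nxy), a0 nyz, a0 (M.irrefl y), asymm y t, asymm y r] at dy
  rw [a1 (M.symm _ _ hmz.2), a0 (flip nxz), a0 (flip nyz), a0 (M.irrefl z), asymm z t,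
    asymm z r] at dz
  rw [a0 (flip hsr), a0 (M.irrefl r), asymm r t] at dr
  rw [a0 (flip hst), a0 (M.irrefl t)] at dt
  have b1 := ale t x
  have b2 := ale t y
  have b3 := ale t z
  have b4 := ale r x
  have b5 := ale r y
  have b6 := ale r z
  by_cases hAtr : M.Adj t r
  · rw [a1 hAtr] at dt dr
    have c1 : ∀ u, a t u + a r u ≤ 1 := by
      intro u
      by_contra hcon
      have h1 := ale t u
      have h2 := ale r u
      exact M.triangle t r u hAtr (aof (by omega)) (aof (by omega))
    have cx := c1 x
    have cy := c1 y
    have cz := c1 z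
    have f1 : M.wt t = 2 := by omega
    have f2 : M.wt r = 2 := by omega
    have f3 : ∀ u ∈ W, u ≠ s → M.wt u = 2 := by
      intro u hu hus
      rw [hWeq] at hu
      simp only [mem_insert, mem_singleton] at hu
      rcases hu with rfl | rfl | rfl | rfl | rfl | rfl
      · exact absurd rfl hus
      all_goals omega
    have g : ∀ u, ¬ M.Adj s u → M.wt u = 2 → (M.nbr W u).card ≤ 2 := by
      intro u hsu hu
      refine full_nbr_card hu fun v hv => ⟨(mem_nbr.1 hv).2, f3 v (mem_nbr.1 hv).1 ?_⟩
      rintro rfl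
      exact hsu (M.symm _ _ (mem_nbr.1 hv).2)
    have g1 := g t hst f1
    have g2 := g r hsr f2
    omega
  · rw [a0 hAtr] at dt dr
    -- a player outside `N(s)` that lands on both lines meets at most one such player in `N(s)`
    have g : ∀ u, u ≠ s → M.wt u = 2 → ∀ v w, v ≠ w → M.Adj s v → M.Adj s w →
        ¬ (a u v = 1 ∧ a u w = 1 ∧ M.wt v = 2 ∧ M.wt w = 2) := by
      rintro u hus hu v w hvw hsv hsw ⟨huv, huw, hv, hw⟩
      obtain ⟨ℓ, hℓ⟩ := exists_of_wt hs1.ge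
      exact no_cycle hv hw hvw (ne_comm.1 hus) hℓ (full_of_wt hu.ge ℓ) (M.symm _ _ hsv)
        (M.symm _ _ (aof huv)) (M.symm _ _ hsw) (M.symm _ _ (aof huw))
    have gt := g t hmt.1
    have gr := g r hmr.1
    -- two players with three common neighbours, of which one is full
    have g3 : M.wt t = 2 → M.wt r = 2 → ∀ v w, v ≠ w →
        ¬ (M.wt v = 2 ∧ 1 ≤ M.wt w ∧ a t v = 1 ∧ a t w = 1 ∧ a r v = 1 ∧ a r w = 1) := by
      rintro ht hr v w hvw ⟨hv, hw, e1, e2, e3, e4⟩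
      obtain ⟨ℓ, hℓ⟩ := exists_of_wt hw
      exact no_cycle ht hr htr hvw (full_of_wt hv.ge ℓ) hℓ (aof e1) (aof e2) (aof e3) (aof e4)
    rcases (show M.wt t = 2 ∨ M.wt t = 1 by omega) with ht | ht <;>
      rcases (show M.wt r = 2 ∨ M.wt r = 1 by omega) with hr | hr
    · have gt1 := gt ht x y hxy hmx.2 hmy.2
      have gt2 := gt ht x z hxz hmx.2 hmz.2
      have gt3 := gt ht y z hyz hmy.2 hmz.2
      have gr1 := gr hr x y hxy hmx.2 hmy.2
      have gr2 := gr hr x z hxz hmx.2 hmz.2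
      have gr3 := gr hr y z hyz hmy.2 hmz.2
      have k1 := g3 ht hr x y hxy
      have k2 := g3 ht hr y x hxy.symm
      have k3 := g3 ht hr z x hxz.symm
      omega
    · have gt1 := gt ht x y hxy hmx.2 hmy.2
      have gt2 := gt ht x z hxz hmx.2 hmz.2
      have gt3 := gt ht y z hyz hmy.2 hmz.2
      omega
    · have gr1 := gr hr x y hxy hmx.2 hmy.2
      have gr2 := gr hr x z hxz hmx.2 hmz.2
      have gr3 := gr hr y z hyz hmy.2 hmz.2
      omega
    · have hx2 : M.wt x = 2 := by omega
      have hy2 : M.wt y = 2 := by omega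
      have := no_three_common hx2 hy2 hxy (N := {s, t, r}) ?_
      · rw [card_eq_three.2 ⟨s, t, r, nst, nsr, htr, rfl⟩] at this
        omega
      · intro u hu
        simp only [mem_insert, mem_singleton] at hu
        rcases hu with rfl | rfl | rfl
        · exact ⟨M.symm _ _ hmx.2, M.symm _ _ hmy.2, hs1.ge⟩
        · exact ⟨M.symm _ _ (aof (by omega)), M.symm _ _ (aof (by omega)), ht.ge⟩
        · exact ⟨M.symm _ _ (aof (by omega)), M.symm _ _ (aof (by omega)), hr.ge⟩

/-- The number of meetings and landings of a set of players is at most the extremal value. A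
minimal counterexample has large degrees, and large degree sums along edges. -/
theorem total_le (M : MergeGraph I) (W : Finset I) : M.total W ≤ 2 * extremalValue W.card := by
  induction hn : W.card using Nat.strong_induction_on generalizing W with
  | _ n ih =>
  by_contra hcon
  rw [not_le] at hcon
  have hpar : 2 * extremalValue n + 2 ≤ M.total W := by
    obtain ⟨m, hm⟩ := M.even_total W
    omega
  have hpos : W.Nonempty := by
    rw [nonempty_iff_ne_empty]
    rintro rfl
    simp [total] at hcon
  have hn0 : 0 < n := hn ▸ card_pos.2 hpos
  have hlt : ∀ u, (M.nbr W u).card ≤ n := fun u => hn ▸ card_le_card (filter_subset _ _)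
  have hV : ∀ u ∈ W, extremalValue n + 1 ≤
      extremalValue (n - 1) + (M.nbr W u).card + M.wt u := by
    intro u hu
    have h1 := ih (n - 1) (by omega) (W.erase u) (by rw [card_erase_of_mem hu, hn])
    have h2 := total_erase (M := M) hu
    omega
  have hE : ∀ u ∈ W, ∀ v ∈ W, M.Adj u v → extremalValue n + 2 ≤
      extremalValue (n - 2) + (M.nbr W u).card + (M.nbr W v).card + M.wt u + M.wt v := by
    intro u hu v hv huv
    have hv' : v ∈ W.erase u := mem_erase.2 ⟨fun e => M.irrefl u (e ▸ huv), hv⟩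
    have h1 := ih (n - 2) (by omega) ((W.erase u).erase v)
      (by rw [card_erase_of_mem hv', card_erase_of_mem hu, hn]; omega)
    have h2 := total_erase (M := M) hu
    have h3 := total_erase (M := M) hv'
    have h4 := nbr_erase (M := M) (v := v) hu
    rw [if_pos (M.symm _ _ huv)] at h4
    omega
  have htri : ∀ u v, M.Adj u v → (M.nbr W u).card + (M.nbr W v).card ≤ n := fun u v h =>
    (card_nbr_add h).trans hn.le
  have hw : ∀ u, M.wt u ≤ 2 := fun u => wt_le
  have hlt' : ∀ u ∈ W, (M.nbr W u).card < n := fun u hu => by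
    rw [← hn]
    exact card_lt_card (filter_ssubset.2 ⟨u, hu, M.irrefl u⟩)
  have hex : ∀ u, 0 < (M.nbr W u).card → ∃ v ∈ W, M.Adj u v := fun u hu => by
    obtain ⟨v, hv⟩ := card_pos.1 hu
    exact ⟨v, (mem_nbr.1 hv).1, (mem_nbr.1 hv).2⟩
  rcases Nat.lt_or_ge n 7 with h7 | h7
  · have hg : ∀ m, m ≤ 6 → extremalValue m = 3 * m - 1 := fun m hm => if_pos hm
    rw [hg n (by omega), hg (n - 1) (by omega)] at hV
    rw [hg n (by omega), hg (n - 2) (by omega)] at hE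
    rw [hg n (by omega)] at hpar
    obtain ⟨u₀, hu₀⟩ := hpos
    have e1 := hV u₀ hu₀
    have e2 := hlt' u₀ hu₀
    have e3 := hw u₀
    have hd2 : ∀ u ∈ W, 2 ≤ (M.nbr W u).card := fun u hu => by
      have := hV u hu
      have := hlt' u hu
      have := hw u
      omega
    obtain ⟨v₀, hv₀, hadj₀⟩ := hex u₀ (by have := hd2 u₀ hu₀; omega)
    have e4 := htri u₀ v₀ hadj₀
    have e5 := hd2 u₀ hu₀
    have e6 := hd2 v₀ hv₀
    obtain ⟨s, hs, hs'⟩ := exists_wt_lt ⟨u₀, hu₀⟩ hd2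
    obtain ⟨v, hv, hsv⟩ := hex s (by have := hd2 s hs; omega)
    have e7 := htri s v hsv
    have e8 := hE s hs v hv hsv
    have e9 := hw v
    have e10 := hd2 v hv
    have e11 := hd2 s hs
    obtain rfl | rfl : n = 5 ∨ n = 6 := by omega
    · -- five players
      have hval : ∀ u ∈ W, (M.nbr W u).card + 2 * M.wt u ≤ 6 ∧
          (M.wt u < 2 → (M.nbr W u).card + 2 * M.wt u ≤ 5) := by
        intro u hu
        obtain ⟨v, hv, huv⟩ := hex u (by have := hd2 u hu; omega)
        have k1 := htri u v huv
        have k2 := hE u hu v hv huv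
        have k3 := hw v
        have k4 := hd2 v hv
        have k5 := hw u
        refine ⟨?_, fun h => by omega⟩
        rcases Nat.lt_or_ge (M.wt u) 2 with h | h
        · omega
        have hu2 : M.wt u = 2 := by omega
        by_cases hsing : ∃ v ∈ W, M.Adj u v ∧ M.wt v < 2
        · obtain ⟨x, hx, hux, hx'⟩ := hsing
          have k1 := htri u x hux
          have k2 := hV x hx
          omega
        · push Not at hsing
          have := full_nbr_card hu2 (N := M.nbr W u) fun x hx =>
            ⟨(mem_nbr.1 hx).2, le_antisymm wt_le (hsing x (mem_nbr.1 hx).1 (mem_nbr.1 hx).2)⟩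
          omega
      have h1 : M.total W < ∑ u ∈ W, 6 := by
        refine sum_lt_sum (fun u hu => (hval u hu).1) ⟨s, hs, ?_⟩
        have := (hval s hs).2 hs'
        omega
      rw [sum_const, hn] at h1
      simp only [smul_eq_mul] at h1
      omega
    · refine false_of_six hn (fun u hu => ?_) (by omega)
      have := hV u hu
      omega
  · rcases h7.eq_or_lt with rfl | h8
    · have hg7 : extremalValue 7 = 21 := rfl
      have hg6 : extremalValue 6 = 17 := rfl
      have hg5 : extremalValue 5 = 14 := rfl
      simp only [Nat.reduceSub, hg7, hg6, hg5] at hV hE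
      have hd : ∀ u ∈ W, 3 ≤ (M.nbr W u).card := fun u hu => by
        have := hV u hu
        have := hw u
        omega
      refine false_of_seven hpos hd (fun u hu => ?_) (fun u hu v hv huv => ?_)
        fun u hu v hv huv hu1 => ?_
      · obtain ⟨v, hv, huv⟩ := hex u (by have := hd u hu; omega)
        have := htri u v huv
        have := hd v hv
        have := hV u hu
        omega
      · have := htri u v huv
        have := hV u hu
        have := hV v hv
        have := hw u
        have := hw v
        omega
      · have := hd v hv
        have := hV u hu
        omega
    · obtain ⟨d1, d2⟩ := extremalValue_diff (show 8 ≤ n from h8)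
      have hd : ∀ u ∈ W, 3 ≤ (M.nbr W u).card := fun u hu => by
        have := hV u hu
        have := hw u
        omega
      have he : ∀ u ∈ W, ∀ v ∈ W, M.Adj u v → 3 ≤ M.wt u + M.wt v := fun u hu v hv huv => by
        have := htri u v huv
        have := hE u hu v hv huv
        omega
      refine false_of_seven hpos hd (fun u hu => ?_) he fun u hu v hv huv hu1 => ?_
      · obtain ⟨v, hv, huv⟩ := hex u (by have := hd u hu; omega)
        have := he u hu v hv huv
        have := hw v
        omega
      · have := hE u hu v hv huv
        have := hw v
        omega

end MergeGraph

/-! ### Interplay of strands, meetings and landings -/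

/-- What remains of a minimal routing: the order of the edges on the routes of the players in `I`
and on the two lines, and the positions of meetings and landings. Edges of the network are the
elements of `E`, and `x ≤ y` says that `y` can be reached from `x`. -/
structure FlowSystem (I E : Type) [PartialOrder E] where
  /-- The edges on the route of a player or on a line. -/
  strand : I ⊕ Bool → Set E
  /-- Some route of the player, not only the chosen one, may get to the edge. -/
  Reaches : I → E → Prop
  /-- The two players have a meeting. -/
  Adj : I → I → Prop
  /-- The place of the meeting, if there is one. -/
  meet : I → I → E
  /-- The player has a landing on the line. -/
  Lands : I → Bool → Prop
  /-- The place of the landing, if there is one. -/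
  land : I → Bool → E
  /-- An edge on the other line that is met by all routes of the last commodity that do not use the
  transition by which the line enters the landing. -/
  cut : I → Bool → E
  total : ∀ s, ∀ x ∈ strand s, ∀ y ∈ strand s, x ≤ y ∨ y ≤ x
  line_disj : ∀ ℓ, ∀ x ∈ strand (.inr ℓ), x ∉ strand (.inr !ℓ)
  reaches_of_mem : ∀ i, ∀ x ∈ strand (.inl i), Reaches i x
  reaches_mono : ∀ i x y, Reaches i x → x ≤ y → Reaches i y
  adj_ne : ∀ i j, Adj i j → i ≠ j
  adj_symm : ∀ i j, Adj i j → Adj j i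
  meet_comm : ∀ i j, meet i j = meet j i
  meet_mem : ∀ i j, Adj i j → meet i j ∈ strand (.inl i)
  meet_inj : ∀ i j l, Adj i j → Adj i l → j ≠ l → meet i j ≠ meet i l
  /-- A strand through a meeting is, ahead of it, closed to one of the two players. -/
  meet_star : ∀ i j, Adj i j → ∀ s, meet i j ∈ strand s → ∀ y ∈ strand s, ∀ y' ∈ strand s,
    y < meet i j → y' < meet i j → Reaches i y → Reaches j y' → False
  /-- Another strand is no detour round a meeting. -/
  meet_pass : ∀ i j, Adj i j → ∀ s, ∀ y ∈ strand (.inl i), y ∈ strand s →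
    ∀ w ∈ strand (.inl i), w ∈ strand s → y < meet i j → meet i j < w → meet i j ∈ strand s
  land_mem : ∀ i ℓ, Lands i ℓ → land i ℓ ∈ strand (.inl i)
  land_mem_line : ∀ i ℓ, Lands i ℓ → land i ℓ ∈ strand (.inr ℓ)
  land_inj : ∀ i j ℓ, Lands i ℓ → Lands j ℓ → i ≠ j → land i ℓ ≠ land j ℓ
  land_ne_meet : ∀ i ℓ j l, Lands i ℓ → Adj j l → land i ℓ ≠ meet j l
  cut_mem : ∀ i ℓ, Lands i ℓ → cut i ℓ ∈ strand (.inr !ℓ)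
  /-- Ahead of the landing, the line is closed to the player. -/
  land_not : ∀ i ℓ, Lands i ℓ → ∀ y ∈ strand (.inr ℓ), y < land i ℓ → ¬ Reaches i y
  /-- Another strand is no detour round a landing. -/
  land_pass : ∀ i ℓ, Lands i ℓ → ∀ s, ∀ y ∈ strand (.inl i), y ∈ strand s →
    ∀ w ∈ strand (.inl i), w ∈ strand s → y < land i ℓ → land i ℓ < w → land i ℓ ∈ strand s
  /-- A walk along a line, two routes of players, and a line contains the landing or the cut. -/
  cut_walk : ∀ i ℓ, Lands i ℓ → ∀ m m' r r' u v w,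
    u ∈ strand (.inr m) → u ∈ strand (.inl r) → v ∈ strand (.inl r) → v ∈ strand (.inl r') →
    w ∈ strand (.inl r') → w ∈ strand (.inr m') → u ≤ v → v ≤ w →
    ∃ x, (x = land i ℓ ∨ x = cut i ℓ) ∧
      ((x ∈ strand (.inr m) ∧ x ≤ u) ∨ (x ∈ strand (.inl r) ∧ u ≤ x ∧ x ≤ v) ∨
        (x ∈ strand (.inl r') ∧ v ≤ x ∧ x ≤ w) ∨ (x ∈ strand (.inr m') ∧ w ≤ x))
  /-- A walk along a line, the route of a player, and the route of `i` up to its landing contains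
  the cut, because it can be continued along the line `ℓ`. -/
  cut_approach : ∀ i ℓ, Lands i ℓ → ∀ m r u v,
    u ∈ strand (.inr m) → u ∈ strand (.inl r) → v ∈ strand (.inl r) → v ∈ strand (.inl i) →
    u ≤ v → v < land i ℓ →
    (cut i ℓ ∈ strand (.inr m) ∧ cut i ℓ ≤ u) ∨
      (cut i ℓ ∈ strand (.inl r) ∧ u ≤ cut i ℓ ∧ cut i ℓ ≤ v) ∨
      (cut i ℓ ∈ strand (.inl i) ∧ v ≤ cut i ℓ ∧ cut i ℓ < land i ℓ)

namespace FlowSystem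

variable {I E : Type} [PartialOrder E] (S : FlowSystem I E)

lemma line_disj' (S : FlowSystem I E) {ℓ : Bool} {x : E} (h : x ∈ S.strand (.inr !ℓ)) :
    x ∉ S.strand (.inr ℓ) := fun h' => S.line_disj ℓ x h' h

lemma meet_mem' (S : FlowSystem I E) {i j : I} (h : S.Adj i j) :
    S.meet i j ∈ S.strand (.inl j) := S.meet_comm i j ▸ S.meet_mem j i (S.adj_symm i j h)

/-- Before `i` and `j` meet, `i` cannot get at the path of `j`. -/
lemma meet_not {i j : I} (h : S.Adj i j) {y : E} (hy : y ∈ S.strand (.inl j))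
    (hlt : y < S.meet i j) (hr : S.Reaches i y) : False :=
  S.meet_star i j h (.inl j) (S.meet_mem' h) y hy y hy hlt hlt hr (S.reaches_of_mem j y hy)

lemma meet_not' {i j : I} (h : S.Adj i j) {y : E} (hy : y ∈ S.strand (.inl i))
    (hlt : y < S.meet i j) (hr : S.Reaches j y) : False :=
  S.meet_star i j h (.inl i) (S.meet_mem i j h) y hy y hy hlt hlt (S.reaches_of_mem i y hy) hr

/-- If `i` and `l` both meet `j`, then one of the two meetings is closed to the other player: the
earlier one of them lies on the route of `j` ahead of the later one. -/
lemma share {i j l : I} (hij : S.Adj i j) (hlj : S.Adj l j) (hil : i ≠ l)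
    (h1 : S.Reaches l (S.meet i j)) (h2 : S.Reaches i (S.meet l j)) : False := by
  have hne : S.meet i j ≠ S.meet l j := by
    rw [S.meet_comm i j, S.meet_comm l j]
    exact S.meet_inj j i l (S.adj_symm _ _ hij) (S.adj_symm _ _ hlj) hil
  rcases S.total (.inl j) _ (S.meet_mem' hij) _ (S.meet_mem' hlj) with h | h
  · exact S.meet_not hlj (S.meet_mem' hij) (lt_of_le_of_ne h hne) h1
  · exact S.meet_not hij (S.meet_mem' hlj) (lt_of_le_of_ne h hne.symm) h2

lemma share_land {i l : I} {ℓ : Bool} (hi : S.Lands i ℓ) (hl : S.Lands l ℓ) (hil : i ≠ l)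
    (h1 : S.Reaches l (S.land i ℓ)) (h2 : S.Reaches i (S.land l ℓ)) : False := by
  have hne := S.land_inj i l ℓ hi hl hil
  rcases S.total (.inr ℓ) _ (S.land_mem_line i ℓ hi) _ (S.land_mem_line l ℓ hl) with h | h
  · exact S.land_not l ℓ hl _ (S.land_mem_line i ℓ hi) (lt_of_le_of_ne h hne) h1
  · exact S.land_not i ℓ hi _ (S.land_mem_line l ℓ hl) (lt_of_le_of_ne h hne.symm) h2

lemma reaches_meet {i j : I} (h : S.Adj i j) : S.Reaches i (S.meet i j) :=
  S.reaches_of_mem _ _ (S.meet_mem i j h)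

lemma reaches_meet' {i j : I} (h : S.Adj i j) : S.Reaches j (S.meet i j) :=
  S.reaches_of_mem _ _ (S.meet_mem' h)

lemma reaches_land {i : I} {ℓ : Bool} (h : S.Lands i ℓ) : S.Reaches i (S.land i ℓ) :=
  S.reaches_of_mem _ _ (S.land_mem i ℓ h)

/-- No three players meet pairwise. -/
lemma no_triangle {a b c : I} (hab : S.Adj a b) (hbc : S.Adj b c) (hac : S.Adj a c) : False := by
  have hba := S.adj_symm _ _ hab
  have hcb := S.adj_symm _ _ hbc
  have hca := S.adj_symm _ _ hac
  -- each pair of meetings on a common path is comparable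
  have key : ∀ x y z : I, S.Adj x y → S.Adj x z → S.Adj y z →
      S.meet x y < S.meet x z → S.meet x z < S.meet y z → False := by
    intro x y z hxy hxz hyz h1 h2
    refine S.meet_not hyz (S.meet_mem' hxz) h2 ?_
    exact S.reaches_mono _ _ _ (S.reaches_meet' hxy) h1.le
  have tot : ∀ x y z : I, S.Adj x y → S.Adj x z → y ≠ z →
      S.meet x y < S.meet x z ∨ S.meet x z < S.meet x y := by
    intro x y z hxy hxz hyz
    have hne := S.meet_inj x y z hxy hxz hyz
    rcases S.total (.inl x) _ (S.meet_mem _ _ hxy) _ (S.meet_mem _ _ hxz) with h | h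
    · exact Or.inl (lt_of_le_of_ne h hne)
    · exact Or.inr (lt_of_le_of_ne h hne.symm)
  have t1 := tot a b c hab hac (S.adj_ne _ _ hbc)
  have t2 := tot b a c hba hbc (S.adj_ne _ _ hac)
  have t3 := tot c a b hca hcb (S.adj_ne _ _ hab)
  have k1 := key a b c hab hac hbc
  have k2 := key a c b hac hab hcb
  have k3 := key b a c hba hbc hac
  have k4 := key b c a hbc hba hca
  have k5 := key c a b hca hcb hab
  have k6 := key c b a hcb hca hba
  rw [S.meet_comm b a, S.meet_comm c a, S.meet_comm c b] at *
  rcases t1 with t1 | t1 <;> rcases t2 with t2 | t2 <;> rcases t3 with t3 | t3 <;>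
    first
    | exact k1 t1 t3
    | exact k2 t1 t2
    | exact k3 t2 t3
    | exact k4 t2 t1
    | exact k5 t3 t2
    | exact k6 t3 t1

/-- The arrow `i → j` along the line `ℓ`: the players `i` and `j` land on `ℓ`, and they meet after
`i` has landed and before `j` does so. -/
structure Arrow (ℓ : Bool) (i j : I) : Prop where
  src : S.Lands i ℓ
  tgt : S.Lands j ℓ
  adj : S.Adj i j
  lt_meet : S.land i ℓ < S.meet i j
  meet_lt : S.meet i j < S.land j ℓ

variable {S}

lemma Arrow.lt {ℓ : Bool} {i j : I} (h : S.Arrow ℓ i j) : S.land i ℓ < S.land j ℓ :=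
  h.lt_meet.trans h.meet_lt

/-- The meeting of two players that land on `ℓ` comes after one of the landings and before the other
one. -/
lemma orient {i j : I} {ℓ : Bool} (hi : S.Lands i ℓ) (hj : S.Lands j ℓ) (h : S.Adj i j) :
    S.Arrow ℓ i j ∨ S.Arrow ℓ j i := by
  have hij := S.adj_ne _ _ h
  have ni : S.land i ℓ ≠ S.meet i j := S.land_ne_meet _ _ _ _ hi h
  have nj : S.land j ℓ ≠ S.meet i j := S.land_ne_meet _ _ _ _ hj h
  have ti := S.total _ _ (S.land_mem i ℓ hi) _ (S.meet_mem i j h)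
  have tj := S.total _ _ (S.land_mem j ℓ hj) _ (S.meet_mem' h)
  rcases ti with ti | ti <;> rcases tj with tj | tj
  · exfalso
    rcases S.total _ _ (S.land_mem_line i ℓ hi) _ (S.land_mem_line j ℓ hj) with t | t
    · exact S.meet_not h (S.land_mem j ℓ hj) (lt_of_le_of_ne tj nj)
        (S.reaches_mono _ _ _ (S.reaches_land hi) t)
    · exact S.meet_not' h (S.land_mem i ℓ hi) (lt_of_le_of_ne ti ni)
        (S.reaches_mono _ _ _ (S.reaches_land hj) t)
  · exact Or.inl ⟨hi, hj, h, lt_of_le_of_ne ti ni, lt_of_le_of_ne tj nj.symm⟩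
  · refine Or.inr ⟨hj, hi, S.adj_symm _ _ h, ?_, ?_⟩ <;> rw [S.meet_comm j i]
    · exact lt_of_le_of_ne tj nj
    · exact lt_of_le_of_ne ti ni.symm
  · exfalso
    exact S.share_land hi hj hij (S.reaches_mono _ _ _ (S.reaches_meet' h) ti)
      (S.reaches_mono _ _ _ (S.reaches_meet h) tj)

lemma cut_not_line {j : I} {ℓ : Bool} (h : S.Lands j ℓ) : S.cut j ℓ ∉ S.strand (.inr ℓ) :=
  S.line_disj' (S.cut_mem j ℓ h)

lemma ne_of_lines {ℓ : Bool} {x y : E} (hx : x ∈ S.strand (.inr ℓ))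
    (hy : y ∉ S.strand (.inr ℓ)) : x ≠ y := fun h => hy (h ▸ hx)

/-- The walk to the landing of `j` by way of `ℓ`, `i` and `j` contains the cut vertex of `j`, which
is not on `ℓ`. -/
lemma Arrow.cut_cases {ℓ : Bool} {i j : I} (h : S.Arrow ℓ i j) :
    (S.cut j ℓ ∈ S.strand (.inl i) ∧ S.land i ℓ < S.cut j ℓ ∧ S.cut j ℓ ≤ S.meet i j) ∨
      (S.cut j ℓ ∈ S.strand (.inl j) ∧ S.meet i j ≤ S.cut j ℓ ∧ S.cut j ℓ < S.land j ℓ) := by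
  have hz := cut_not_line h.tgt
  rcases S.cut_approach j ℓ h.tgt ℓ i _ _ (S.land_mem_line i ℓ h.src) (S.land_mem i ℓ h.src)
    (S.meet_mem _ _ h.adj) (S.meet_mem' h.adj) h.lt_meet.le h.meet_lt with hc | hc | hc
  · exact absurd hc.1 hz
  · exact Or.inl ⟨hc.1, lt_of_le_of_ne hc.2.1 (ne_of_lines (S.land_mem_line i ℓ h.src) hz), hc.2.2⟩
  · exact Or.inr hc

/-- The players that meet `j` before it lands on `ℓ` do so in the order in which they land. -/
lemma Arrow.order {ℓ : Bool} {i j l : I} (hi : S.Arrow ℓ i j) (hl : S.Arrow ℓ l j)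
    (hlt : S.land i ℓ < S.land l ℓ) : S.meet i j < S.meet l j := by
  have hil : i ≠ l := by rintro rfl; exact lt_irrefl _ hlt
  rcases S.total _ _ (S.meet_mem' hi.adj) _ (S.meet_mem' hl.adj) with h | h
  · refine lt_of_le_of_ne h ?_
    rw [S.meet_comm i j, S.meet_comm l j]
    exact S.meet_inj j i l (S.adj_symm _ _ hi.adj) (S.adj_symm _ _ hl.adj) hil
  · refine (S.share hi.adj hl.adj hil ?_ ?_).elim
    · exact S.reaches_mono _ _ _ (S.reaches_meet hl.adj) h
    · exact S.reaches_mono _ _ _ (S.reaches_land hi.src) (hlt.trans hl.lt_meet).le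

/-- If two arrows along `ℓ` end at `j`, then the cut vertex of `j` lies on its own path, after both
meetings. -/
lemma Arrow.cut_mem_tgt {ℓ : Bool} {i j l : I} (hi : S.Arrow ℓ i j) (hl : S.Arrow ℓ l j)
    (hil : i ≠ l) : S.cut j ℓ ∈ S.strand (.inl j) ∧ S.meet i j ≤ S.cut j ℓ ∧
      S.meet l j ≤ S.cut j ℓ ∧ S.cut j ℓ < S.land j ℓ := by
  have aux : ∀ a b : I, S.Arrow ℓ a j → S.Arrow ℓ b j → a ≠ b →
      (S.cut j ℓ ∈ S.strand (.inl a) ∧ S.land a ℓ < S.cut j ℓ ∧ S.cut j ℓ ≤ S.meet a j) →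
      (S.cut j ℓ ∈ S.strand (.inl j) ∧ S.meet b j ≤ S.cut j ℓ ∧ S.cut j ℓ < S.land j ℓ) →
      S.meet a j ≤ S.cut j ℓ := by
    intro a b ha hb hab h1 h2
    by_contra hcon
    exact S.meet_not ha.adj h2.1 (lt_of_le_of_ne h1.2.2 fun h => hcon h.ge)
      (S.reaches_of_mem _ _ h1.1)
  rcases hi.cut_cases with h1 | h1 <;> rcases hl.cut_cases with h2 | h2
  · exact (S.share hi.adj hl.adj hil (S.reaches_mono _ _ _ (S.reaches_of_mem _ _ h2.1) h1.2.2)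
      (S.reaches_mono _ _ _ (S.reaches_of_mem _ _ h1.1) h2.2.2)).elim
  · exact ⟨h2.1, aux i l hi hl hil h1 h2, h2.2.1, h2.2.2⟩
  · exact ⟨h1.1, h1.2.1, aux l i hl hi hil.symm h2 h1, h1.2.2⟩
  · exact ⟨h1.1, h1.2.1, h2.2.1, h1.2.2⟩

/-- A walk along `ℓ` up to the landing of `i`, then along `i` and `j`, and on along `ℓ`, avoids the
landing of `l`, and so it passes the cut vertex of `l`. -/
lemma Arrow.cut_earlier {ℓ : Bool} {i j l : I} (hi : S.Arrow ℓ i j) (hl : S.Arrow ℓ l j)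
    (hlt : S.land i ℓ < S.land l ℓ) :
    (S.cut l ℓ ∈ S.strand (.inl i) ∧ S.land i ℓ < S.cut l ℓ ∧ S.cut l ℓ ≤ S.meet i j) ∨
      (S.cut l ℓ ∈ S.strand (.inl j) ∧ S.meet i j ≤ S.cut l ℓ ∧ S.cut l ℓ ≤ S.land j ℓ) := by
  have hm := hi.order hl hlt
  have hz := cut_not_line hl.src
  obtain ⟨x, hx, hx'⟩ := S.cut_walk l ℓ hl.src ℓ ℓ i j _ _ _ (S.land_mem_line i ℓ hi.src)
    (S.land_mem i ℓ hi.src) (S.meet_mem _ _ hi.adj) (S.meet_mem' hi.adj) (S.land_mem j ℓ hi.tgt)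
    (S.land_mem_line j ℓ hi.tgt) hi.lt_meet.le hi.meet_lt.le
  rcases hx with rfl | rfl
  · exfalso
    rcases hx' with h | h | h | h
    · exact absurd hlt (not_lt_of_ge h.2)
    · exact S.meet_not hl.adj (S.meet_mem' hi.adj) hm
        (S.reaches_mono _ _ _ (S.reaches_land hl.src) h.2.2)
    · exact S.meet_not hl.adj h.1 hl.lt_meet (S.reaches_land hl.src)
    · exact absurd hl.lt (not_lt_of_ge h.2)
  · rcases hx' with h | h | h | h
    · exact absurd h.1 hz
    · exact Or.inl ⟨h.1, lt_of_le_of_ne h.2.1 (ne_of_lines (S.land_mem_line i ℓ hi.src) hz),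
        h.2.2⟩
    · exact Or.inr h
    · exact absurd h.1 hz

/-- Two players that meet and land on `ℓ` do not come together again. -/
lemma Arrow.no_reunion {ℓ : Bool} {i m : I} (h : S.Arrow ℓ i m) {w : E}
    (hi : w ∈ S.strand (.inl i)) (hm : w ∈ S.strand (.inl m)) (hw : S.land m ℓ < w) : False := by
  have h1 : S.land m ℓ ∈ S.strand (.inl i) :=
    S.land_pass m ℓ h.tgt (.inl i) _ (S.meet_mem' h.adj) (S.meet_mem _ _ h.adj) w hm hi
      h.meet_lt hw
  have h2 : S.meet i m ∈ S.strand (.inr ℓ) :=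
    S.meet_pass i m h.adj (.inr ℓ) _ (S.land_mem i ℓ h.src) (S.land_mem_line i ℓ h.src) _ h1
      (S.land_mem_line m ℓ h.tgt) h.lt_meet h.meet_lt
  exact S.land_not m ℓ h.tgt _ h2 h.meet_lt (S.reaches_meet' h.adj)

/-- If `i → j`, `l → j` with `i` landing first, and `m → l`, then `i` and `m` share the cut vertex
of `l`. -/
lemma Arrow.shared_cut {ℓ : Bool} {i j l m : I} (hi : S.Arrow ℓ i j) (hl : S.Arrow ℓ l j)
    (hlt : S.land i ℓ < S.land l ℓ) (hm : S.Arrow ℓ m l) :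
    S.cut l ℓ ∈ S.strand (.inl i) ∧ S.land i ℓ < S.cut l ℓ ∧
      S.cut l ℓ ∈ S.strand (.inl m) ∧ S.land m ℓ < S.cut l ℓ := by
  have ho := hi.order hl hlt
  rcases hm.cut_cases with h1 | h1 <;> rcases hi.cut_earlier hl hlt with h2 | h2
  · exact ⟨h2.1, h2.2.1, h1.1, h1.2.1⟩
  · -- `j` would get via the cut vertex and `m` at the path of `l` before meeting `l`
    refine (S.meet_not' hl.adj (S.meet_mem' hm.adj) (hm.meet_lt.trans hl.lt_meet) ?_).elim
    exact S.reaches_mono _ _ _ (S.reaches_of_mem _ _ h2.1) h1.2.2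
  · exact (S.meet_not hl.adj (S.meet_mem' hi.adj) ho
      (S.reaches_mono _ _ _ (S.reaches_of_mem _ _ h1.1) h2.2.2)).elim
  · exact (S.meet_not hl.adj h2.1 (h1.2.2.trans hl.lt_meet) (S.reaches_of_mem _ _ h1.1)).elim

/-- There are no four arrows along `ℓ` from two players to two others: the cut vertex of the one
that lands first would be on both routes that lead to the other one. -/
lemma Arrow.no_two_two {ℓ : Bool} {a b c d : I} (hab : S.Arrow ℓ a b) (hcb : S.Arrow ℓ c b)
    (had : S.Arrow ℓ a d) (hcd : S.Arrow ℓ c d) (hac : S.land a ℓ < S.land c ℓ)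
    (hbd : S.land b ℓ < S.land d ℓ) : False := by
  have hne : a ≠ c := by rintro rfl; exact lt_irrefl _ hac
  obtain ⟨hzb, hz1, hz2, hz3⟩ := hab.cut_mem_tgt hcb hne
  have hz := cut_not_line hab.tgt
  have main : ∀ e : I, S.Arrow ℓ e b → S.Arrow ℓ e d →
      S.cut b ℓ ∈ S.strand (.inl e) ∧ S.cut b ℓ ≤ S.meet e d := by
    intro e heb hed
    obtain ⟨x, hx, hx'⟩ := S.cut_walk b ℓ hab.tgt ℓ ℓ e d _ _ _ (S.land_mem_line e ℓ hed.src)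
      (S.land_mem e ℓ hed.src) (S.meet_mem _ _ hed.adj) (S.meet_mem' hed.adj)
      (S.land_mem d ℓ hed.tgt) (S.land_mem_line d ℓ hed.tgt) hed.lt_meet.le hed.meet_lt.le
    rcases hx with rfl | rfl
    · exfalso
      rcases hx' with h | h | h | h
      · exact absurd heb.lt (not_lt_of_ge h.2)
      · have h2 : S.meet e b ∈ S.strand (.inr ℓ) :=
          S.meet_pass e b heb.adj (.inr ℓ) _ (S.land_mem e ℓ heb.src) (S.land_mem_line e ℓ heb.src)
            _ h.1 (S.land_mem_line b ℓ heb.tgt) heb.lt_meet heb.meet_lt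
        exact S.land_not b ℓ heb.tgt _ h2 heb.meet_lt (S.reaches_meet' heb.adj)
      · exact S.land_not d ℓ hed.tgt _ (S.land_mem_line b ℓ heb.tgt) hbd
          (S.reaches_of_mem _ _ h.1)
      · exact absurd hbd (not_lt_of_ge h.2)
    · rcases hx' with h | h | h | h
      · exact absurd h.1 hz
      · exact ⟨h.1, h.2.2⟩
      · exact (S.land_not d ℓ hed.tgt _ (S.land_mem_line b ℓ heb.tgt) hbd
          (S.reaches_mono _ _ _ (S.reaches_of_mem _ _ h.1) hz3.le)).elim
      · exact absurd h.1 hz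
  obtain ⟨h1, h2⟩ := main a hab had
  obtain ⟨h3, h4⟩ := main c hcb hcd
  exact S.share had.adj hcd.adj hne (S.reaches_mono _ _ _ (S.reaches_of_mem _ _ h3) h2)
    (S.reaches_mono _ _ _ (S.reaches_of_mem _ _ h1) h4)

lemma land_lt_or {ℓ : Bool} {i j : I} (hi : S.Lands i ℓ) (hj : S.Lands j ℓ) (h : i ≠ j) :
    S.land i ℓ < S.land j ℓ ∨ S.land j ℓ < S.land i ℓ := by
  have hne := S.land_inj i j ℓ hi hj h
  rcases S.total _ _ (S.land_mem_line i ℓ hi) _ (S.land_mem_line j ℓ hj) with t | t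
  · exact Or.inl (lt_of_le_of_ne t hne)
  · exact Or.inr (lt_of_le_of_ne t hne.symm)

/-- No 4-cycle `i, j, l, m` whose latest member is `j`. -/
lemma no_four_cycle_max {ℓ : Bool} {i j l m : I} (hi : S.Lands i ℓ) (hj : S.Lands j ℓ)
    (hl : S.Lands l ℓ) (hm : S.Lands m ℓ) (hij : S.Adj i j) (hlj : S.Adj l j) (hmi : S.Adj m i)
    (hml : S.Adj m l) (hne : i ≠ l) (h1 : S.land i ℓ < S.land j ℓ)
    (h2 : S.land l ℓ < S.land j ℓ) (h3 : S.land m ℓ < S.land j ℓ) : False := by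
  have fwd : ∀ {a b : I}, S.Lands a ℓ → S.Lands b ℓ → S.Adj a b → S.land a ℓ < S.land b ℓ →
      S.Arrow ℓ a b := by
    intro a b ha hb hab hlt
    rcases orient ha hb hab with h | h
    · exact h
    · exact absurd h.lt hlt.asymm
  have aij := fwd hi hj hij h1
  have alj := fwd hl hj hlj h2
  -- by symmetry, `i` lands before `l`
  wlog hil : S.land i ℓ < S.land l ℓ generalizing i l
  · exact this hl hi hlj hij hml hmi hne.symm h2 h1 alj aij
      ((land_lt_or hi hl hne).resolve_left hil)
  rcases orient hm hl hml with h | h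
  · obtain ⟨z1, z2, z3, z4⟩ := aij.shared_cut alj hil h
    rcases orient hm hi hmi with h' | h'
    · exact h'.no_reunion z3 z1 z2
    · exact h'.no_reunion z1 z3 z4
  · have him : S.land i ℓ < S.land m ℓ := hil.trans h.lt
    exact (fwd hi hm (S.adj_symm _ _ hmi) him).no_two_two h aij alj hil h3

/-- The players that land on `ℓ` do not form 4-cycles. -/
lemma no_four_cycle {ℓ : Bool} {a b c d : I} (ha : S.Lands a ℓ) (hb : S.Lands b ℓ)
    (hc : S.Lands c ℓ) (hd : S.Lands d ℓ) (hab : S.Adj a b) (hbc : S.Adj b c) (hcd : S.Adj c d)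
    (hda : S.Adj d a) (hac : a ≠ c) (hbd : b ≠ d) : False := by
  have hba := S.adj_symm _ _ hab
  have hcb := S.adj_symm _ _ hbc
  have hdc := S.adj_symm _ _ hcd
  have had := S.adj_symm _ _ hda
  have t1 := land_lt_or ha hb (S.adj_ne _ _ hab)
  have t2 := land_lt_or hb hc (S.adj_ne _ _ hbc)
  have t3 := land_lt_or hc hd (S.adj_ne _ _ hcd)
  have t4 := land_lt_or hd ha (S.adj_ne _ _ hda)
  have t5 := land_lt_or ha hc hac
  have t6 := land_lt_or hb hd hbd
  have ka : S.land b ℓ < S.land a ℓ → S.land c ℓ < S.land a ℓ → S.land d ℓ < S.land a ℓ → False :=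
    fun h1 h2 h3 => no_four_cycle_max hb ha hd hc hba hda hcb hcd hbd h1 h3 h2
  have kb : S.land a ℓ < S.land b ℓ → S.land c ℓ < S.land b ℓ → S.land d ℓ < S.land b ℓ → False :=
    fun h1 h2 h3 => no_four_cycle_max ha hb hc hd hab hcb hda hdc hac h1 h2 h3
  have kc : S.land a ℓ < S.land c ℓ → S.land b ℓ < S.land c ℓ → S.land d ℓ < S.land c ℓ → False :=
    fun h1 h2 h3 => no_four_cycle_max hb hc hd ha hbc hdc hab had hbd h2 h3 h1
  have kd : S.land a ℓ < S.land d ℓ → S.land b ℓ < S.land d ℓ → S.land c ℓ < S.land d ℓ → False :=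
    fun h1 h2 h3 => no_four_cycle_max ha hd hc hb had hcd hba hbc hac h1 h3 h2
  have tr : ∀ {x y z : E}, x < y → y < z → x < z := fun h h' => h.trans h'
  grind

lemma not_line_of_mem {ℓ : Bool} {x : E} (h : x ∈ S.strand (.inr ℓ)) :
    x ∉ S.strand (.inr !ℓ) := S.line_disj ℓ x h

lemma cut_mem_not {i : I} {ℓ : Bool} (h : S.Lands i (!ℓ)) :
    S.cut i (!ℓ) ∈ S.strand (.inr ℓ) := by
  have := S.cut_mem i _ h
  rwa [Bool.not_not] at this

variable (S) in
/-- The player `i` lands on both lines. -/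
def Full (i : I) : Prop := ∀ ℓ, S.Lands i ℓ

variable (S) in
/-- The player `i` lands on `ℓ` after it has landed on the other line. -/
def Late (ℓ : Bool) (i : I) : Prop := S.land i (!ℓ) < S.land i ℓ

lemma Full.late {c : I} (h : S.Full c) (ℓ : Bool) : S.Late ℓ c ∨ S.Late (!ℓ) c := by
  unfold Late
  rw [Bool.not_not]
  have hne := ne_of_lines (S.land_mem_line c ℓ (h ℓ)) (S.line_disj' (S.land_mem_line c _ (h (!ℓ))))
  rcases S.total _ _ (S.land_mem c _ (h (!ℓ))) _ (S.land_mem c ℓ (h ℓ)) with t | t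
  · exact Or.inl (lt_of_le_of_ne t hne.symm)
  · exact Or.inr (lt_of_le_of_ne t hne)

/-- Two players that land on both lines and meet do so after all landings of the one and before all
landings of the other. -/
lemma Arrow.of_full {ℓ : Bool} {c d : I} (h : S.Arrow ℓ c d) (hc : S.Full c) (hd : S.Full d) :
    S.Arrow (!ℓ) c d := by
  rcases orient (hc !ℓ) (hd !ℓ) h.adj with h' | h'
  · exact h'
  exfalso
  have h1 := h'.lt_meet
  have h2 := h'.meet_lt
  rw [S.meet_comm d c] at h1 h2
  rcases h.cut_cases with ⟨z1, z2, z3⟩ | ⟨z1, z2, z3⟩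
  · exact S.land_not c _ (hc _) _ (S.cut_mem d ℓ h.tgt) (z3.trans_lt h2) (S.reaches_of_mem _ _ z1)
  · have hB : S.meet c d ∈ S.strand (.inr !ℓ) := by
      rcases z2.eq_or_lt with e | e
      · exact e ▸ S.cut_mem d ℓ h.tgt
      · have := S.meet_pass d c (S.adj_symm _ _ h.adj) (.inr !ℓ) _ (S.land_mem d _ (hd _))
          (S.land_mem_line d _ (hd _)) _ z1 (S.cut_mem d ℓ h.tgt)
        rw [S.meet_comm d c] at this
        exact this h1 e
    exact S.land_not c _ (hc _) _ hB h2 (S.reaches_meet h.adj)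

/-- Two players that land on both lines and meet land on them in the same order. -/
lemma Arrow.late_of_full {ℓ : Bool} {c d : I} (h : S.Arrow ℓ c d) (hc : S.Full c) (hd : S.Full d)
    (hlate : S.Late ℓ c) : S.Late ℓ d := by
  rcases hd.late ℓ with h' | h'
  · exact h'
  exfalso
  unfold Late at h' hlate
  rw [Bool.not_not] at h'
  rcases h.cut_cases with ⟨z1, z2, z3⟩ | ⟨z1, z2, z3⟩
  · exact not_line_of_mem (S.land_mem_line c ℓ (hc ℓ))
      (S.land_pass c ℓ (hc ℓ) (.inr !ℓ) _ (S.land_mem c _ (hc _)) (S.land_mem_line c _ (hc _)) _ z1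
        (S.cut_mem d ℓ (hd ℓ)) hlate z2)
  · exact S.land_not d _ (hd _) _ (S.cut_mem d ℓ (hd ℓ)) (z3.trans h') (S.reaches_of_mem _ _ z1)

/-- Among the players that land on both lines, at most one arrow leads to a given player. -/
lemma full_in_unique {ℓ : Bool} {c d e : I} (hc : S.Full c) (hd : S.Full d) (he : S.Full e)
    (hdc : S.Arrow ℓ d c) (hec : S.Arrow ℓ e c) (hne : d ≠ e) : False := by
  have key : ∀ m, S.Arrow m d c → S.Arrow m e c → S.Late (!m) c → False := by
    intro m h1 h2 h3
    obtain ⟨z1, -, -, z2⟩ := h1.cut_mem_tgt h2 hne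
    unfold Late at h3
    rw [Bool.not_not] at h3
    exact S.land_not c _ (hc _) _ (S.cut_mem c m (hc m)) (z2.trans h3) (S.reaches_of_mem _ _ z1)
  rcases hc.late ℓ with h | h
  · refine key (!ℓ) (hdc.of_full hd hc) (hec.of_full he hc) ?_
    rwa [Bool.not_not]
  · exact key ℓ hdc hec h

/-- Among the players that land on both lines, at most one arrow starts from a given player. -/
lemma full_out_unique {ℓ : Bool} {c d e : I} (hc : S.Full c) (hd : S.Full d) (he : S.Full e)
    (hcd : S.Arrow ℓ c d) (hce : S.Arrow ℓ c e) (hne : d ≠ e) : False := by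
  -- it suffices to consider the line on which `c` lands first
  wlog hl : S.Late (!ℓ) c generalizing ℓ
  · refine this (ℓ := !ℓ) (hcd.of_full hc hd) (hce.of_full hc he) ?_
    rw [Bool.not_not]
    exact (hc.late ℓ).resolve_right hl
  wlog hde : S.land d ℓ < S.land e ℓ generalizing d e
  · exact this he hd hne.symm hce hcd ((land_lt_or (hd ℓ) (he ℓ) hne).resolve_left hde)
  have hcd' := hcd.of_full hc hd
  have hce' := hce.of_full hc he
  have ld := hcd'.late_of_full hc hd hl
  have le := hce'.late_of_full hc he hl
  unfold Late at ld le hl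
  rw [Bool.not_not] at ld le hl
  have hz := S.cut_mem e ℓ (he ℓ)
  have hzP : S.cut e ℓ ∈ S.strand (.inl c) := by
    rcases hce.cut_cases with ⟨z1, z2, z3⟩ | ⟨z1, z2, z3⟩
    · exact z1
    · exact (S.land_not e _ (he _) _ hz (z3.trans le) (S.reaches_of_mem _ _ z1)).elim
  have hw : S.land d (!ℓ) ≤ S.cut e ℓ := by
    obtain ⟨x, hx, hx'⟩ := S.cut_walk e ℓ (he ℓ) ℓ (!ℓ) d d _ _ _ (S.land_mem_line d ℓ (hd ℓ))
      (S.land_mem d ℓ (hd ℓ)) (S.land_mem d ℓ (hd ℓ)) (S.land_mem d ℓ (hd ℓ))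
      (S.land_mem d _ (hd !ℓ)) (S.land_mem_line d _ (hd !ℓ)) le_rfl ld.le
    rcases hx with rfl | rfl
    · exfalso
      rcases hx' with h | h | h | h
      · exact absurd hde (not_lt_of_ge h.2)
      · exact absurd hde (not_lt_of_ge h.2.2)
      · exact S.share_land (hd !ℓ) (he !ℓ) hne
          (S.reaches_mono _ _ _ (S.reaches_land (he ℓ)) h.2.2)
          (S.reaches_mono _ _ _ (S.reaches_of_mem _ _ h.1) le.le)
      · exact not_line_of_mem (S.land_mem_line e ℓ (he ℓ)) h.1
    · have hlt : S.cut e ℓ ∈ S.strand (.inl d) → ¬ S.cut e ℓ < S.land d (!ℓ) := fun h1 h2 =>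
        S.land_not d _ (hd _) _ hz h2 (S.reaches_of_mem _ _ h1)
      rcases hx' with h | h | h | h
      · exact absurd hz (not_line_of_mem h.1)
      · exact (hlt h.1 (h.2.2.trans_lt ld)).elim
      · rcases h.2.2.eq_or_lt with e1 | e1
        · exact e1.ge
        · exact (hlt h.1 e1).elim
      · exact h.2
  have hB : S.meet c d ∈ S.strand (.inr !ℓ) :=
    S.meet_pass c d hcd.adj (.inr !ℓ) _ (S.land_mem c _ (hc _)) (S.land_mem_line c _ (hc _)) _ hzP hz
      hcd'.lt_meet (hcd'.meet_lt.trans_le hw)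
  exact S.land_not d _ (hd _) _ hB hcd'.meet_lt (S.reaches_meet' hcd.adj)

/-- If `u → c` along `ℓ`, and `c` lands on the other line before it meets `u`, then they meet on the
other line. -/
lemma Arrow.meet_mem_line {ℓ : Bool} {u c : I} (h : S.Arrow ℓ u c) (hc : S.Full c)
    (hlt : S.land c (!ℓ) < S.meet u c) : S.meet u c ∈ S.strand (.inr !ℓ) := by
  have hz := S.cut_mem c ℓ h.tgt
  rcases h.cut_cases with ⟨z1, z2, z3⟩ | ⟨z1, z2, z3⟩
  · rcases z3.eq_or_lt with e | e
    · exact e ▸ hz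
    exfalso
    rcases S.total _ _ hz _ (S.land_mem_line c _ (hc !ℓ)) with t | t
    · exact S.meet_not h.adj (S.land_mem c _ (hc !ℓ)) hlt
        (S.reaches_mono _ _ _ (S.reaches_of_mem _ _ z1) t)
    · exact S.meet_not' h.adj z1 e (S.reaches_mono _ _ _ (S.reaches_land (hc !ℓ)) t)
  · rcases z2.eq_or_lt with e | e
    · exact e ▸ hz
    · have := S.meet_pass c u (S.adj_symm _ _ h.adj) (.inr !ℓ) _ (S.land_mem c _ (hc !ℓ))
        (S.land_mem_line c _ (hc !ℓ)) _ z1 hz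
      rw [S.meet_comm c u] at this
      exact this hlt e

lemma Arrow.meet_ne {ℓ : Bool} {u c d : I} (h : S.Arrow ℓ u c) (h' : S.Arrow ℓ u d)
    (hne : c ≠ d) : S.meet u c < S.meet u d ∨ S.meet u d < S.meet u c := by
  have := S.meet_inj u c d h.adj h'.adj hne
  rcases S.total _ _ (S.meet_mem _ _ h.adj) _ (S.meet_mem _ _ h'.adj) with t | t
  · exact Or.inl (lt_of_le_of_ne t this)
  · exact Or.inr (lt_of_le_of_ne t this.symm)

lemma late_out_aux {ℓ : Bool} {u c d : I} (hc : S.Full c) (hd : S.Full d)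
    (huc : S.Arrow ℓ u c) (hud : S.Arrow ℓ u d) (lc : S.Late ℓ c) (hne : c ≠ d)
    (h1 : S.meet u c < S.land c (!ℓ)) (h2 : S.land d (!ℓ) < S.meet u d) : False := by
  have hB := hud.meet_mem_line hd h2
  have hA := S.land_mem_line c _ (hc !ℓ)
  have hrA : S.Reaches u (S.land c (!ℓ)) :=
    S.reaches_mono _ _ _ (S.reaches_meet huc.adj) h1.le
  rcases huc.meet_ne hud hne with t | t
  · have hcA : S.land c (!ℓ) < S.meet u d := by
      refine lt_of_le_of_ne ?_ (S.land_ne_meet _ _ _ _ (hc _) hud.adj)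
      rcases S.total _ _ hA _ hB with q | q
      · exact q
      · rcases q.eq_or_lt with e | e
        · exact e.ge
        · exact (S.land_not c _ (hc !ℓ) _ hB e
            (S.reaches_mono _ _ _ (S.reaches_meet' huc.adj) t.le)).elim
    exact S.meet_star u d hud.adj (.inr !ℓ) hB _ hA _ (S.land_mem_line d _ (hd !ℓ)) hcA h2 hrA
      (S.reaches_land (hd !ℓ))
  · -- `u` takes the information about the other line from `d` to `c`
    have hz := cut_mem_not (hc !ℓ)
    have hlc : S.land c (!ℓ) < S.land c ℓ := lc
    rcases S.cut_approach c (!ℓ) (hc !ℓ) (!ℓ) u _ _ hB (S.meet_mem _ _ hud.adj)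
      (S.meet_mem _ _ huc.adj) (S.meet_mem' huc.adj) t.le h1 with h | h | h
    · exact not_line_of_mem hz h.1
    · have h3 : S.meet u d < S.cut c (!ℓ) := lt_of_le_of_ne h.2.1
        (ne_of_lines hB (not_line_of_mem hz))
      exact S.line_disj' hB (S.meet_pass u d hud.adj (.inr ℓ) _ (S.land_mem u ℓ hud.src)
        (S.land_mem_line u ℓ hud.src) _ h.1 hz hud.lt_meet h3)
    · exact S.land_not c ℓ (hc ℓ) _ hz (h.2.2.trans hlc) (S.reaches_of_mem _ _ h.1)

/-- There is at most one arrow `u → c` along `ℓ` with `c` full and late on `ℓ`. -/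
lemma late_out_unique {ℓ : Bool} {u c d : I} (hc : S.Full c) (hd : S.Full d)
    (huc : S.Arrow ℓ u c) (hud : S.Arrow ℓ u d) (lc : S.Late ℓ c) (ld : S.Late ℓ d)
    (hne : c ≠ d) : False := by
  have cmp : ∀ e, S.Full e → S.Arrow ℓ u e →
      S.meet u e < S.land e (!ℓ) ∨ S.land e (!ℓ) < S.meet u e := by
    intro e he hue
    have hn := S.land_ne_meet e (!ℓ) u e (he _) hue.adj
    rcases S.total _ _ (S.meet_mem' hue.adj) _ (S.land_mem e _ (he !ℓ)) with t | t
    · exact Or.inl (lt_of_le_of_ne t hn.symm)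
    · exact Or.inr (lt_of_le_of_ne t hn)
  rcases cmp c hc huc with hBc | hBc <;> rcases cmp d hd hud with hBd | hBd
  · wlog hcd : S.land c (!ℓ) < S.land d (!ℓ) generalizing c d
    · exact this hd hc hud huc ld lc hne.symm hBd hBc
        ((land_lt_or (hc _) (hd _) hne).resolve_left hcd)
    have hz := cut_mem_not (hd !ℓ)
    have hlc : S.land c (!ℓ) < S.land c ℓ := lc
    have hld : S.land d (!ℓ) < S.land d ℓ := ld
    -- the walk along the other line, `c` and `ℓ` passes the cut vertex of `d`
    have hcut : S.land c ℓ ≤ S.cut d (!ℓ) := by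
      obtain ⟨x, hx, hx'⟩ := S.cut_walk d (!ℓ) (hd _) (!ℓ) ℓ c c _ _ _
        (S.land_mem_line c _ (hc !ℓ)) (S.land_mem c _ (hc !ℓ)) (S.land_mem c _ (hc !ℓ))
        (S.land_mem c _ (hc !ℓ)) (S.land_mem c ℓ (hc ℓ)) (S.land_mem_line c ℓ (hc ℓ)) le_rfl hlc.le
      rcases hx with rfl | rfl
      · exfalso
        rcases hx' with h | h | h | h
        · exact absurd hcd (not_lt_of_ge h.2)
        · exact absurd hcd (not_lt_of_ge h.2.2)
        · exact S.share_land (hc ℓ) (hd ℓ) hne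
            (S.reaches_mono _ _ _ (S.reaches_land (hd !ℓ)) h.2.2)
            (S.reaches_mono _ _ _ (S.reaches_of_mem _ _ h.1) hld.le)
        · exact not_line_of_mem h.1 (S.land_mem_line d _ (hd !ℓ))
      · have hlt : S.cut d (!ℓ) ∈ S.strand (.inl c) → ¬ S.cut d (!ℓ) < S.land c ℓ :=
          fun h1 h2 => S.land_not c _ (hc _) _ hz h2 (S.reaches_of_mem _ _ h1)
        rcases hx' with h | h | h | h
        · exact (not_line_of_mem hz h.1).elim
        · exact (hlt h.1 (h.2.2.trans_lt hlc)).elim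
        · rcases h.2.2.eq_or_lt with e1 | e1
          · exact e1.ge
          · exact (hlt h.1 e1).elim
        · exact h.2
    rcases S.cut_approach d (!ℓ) (hd _) ℓ u _ _ (S.land_mem_line u ℓ hud.src)
      (S.land_mem u ℓ hud.src) (S.meet_mem _ _ hud.adj) (S.meet_mem' hud.adj) hud.lt_meet.le hBd
      with h | h | h
    · exact absurd huc.lt (not_lt_of_ge (hcut.trans h.2))
    · have hB : S.meet u c ∈ S.strand (.inr ℓ) :=
        S.meet_pass u c huc.adj (.inr ℓ) _ (S.land_mem u ℓ hud.src) (S.land_mem_line u ℓ hud.src) _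
          h.1 hz huc.lt_meet (huc.meet_lt.trans_le hcut)
      exact S.land_not c ℓ (hc ℓ) _ hB huc.meet_lt (S.reaches_meet' huc.adj)
    · exact S.land_not d ℓ (hd ℓ) _ hz (h.2.2.trans hld) (S.reaches_of_mem _ _ h.1)
  · exact late_out_aux hc hd huc hud lc hne hBc hBd
  · exact late_out_aux hd hc hud huc ld hne.symm hBd hBc
  · have hB := huc.meet_mem_line hc hBc
    have hB' := hud.meet_mem_line hd hBd
    have aux : ∀ c d, S.Full c → S.Full d → S.Arrow ℓ u c → S.Arrow ℓ u d →
        S.meet u c ∈ S.strand (.inr !ℓ) → S.meet u d ∈ S.strand (.inr !ℓ) →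
        S.land d (!ℓ) < S.meet u d → S.meet u c < S.meet u d → False := by
      intro c d hc hd huc hud hB hB' hlt t
      exact S.meet_star u d hud.adj (.inr !ℓ) hB' _ hB _ (S.land_mem_line d _ (hd !ℓ)) t hlt
        (S.reaches_meet huc.adj) (S.reaches_land (hd !ℓ))
    rcases huc.meet_ne hud hne with t | t
    · exact aux c d hc hd huc hud hB hB' hBd t
    · exact aux d c hd hc hud huc hB' hB hBc t

/-- The cut vertex of a late player `d` lies before its first landing or on its own path. -/
lemma Full.cut_of_late {ℓ : Bool} {d : I} (hd : S.Full d) (ld : S.Late ℓ d) :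
    S.cut d ℓ ≤ S.land d (!ℓ) ∨ (S.cut d ℓ ∈ S.strand (.inl d) ∧ S.cut d ℓ < S.land d ℓ) := by
  have hld : S.land d (!ℓ) < S.land d ℓ := ld
  rcases S.cut_approach d ℓ (hd ℓ) (!ℓ) d _ _ (S.land_mem_line d _ (hd !ℓ)) (S.land_mem d _ (hd !ℓ))
    (S.land_mem d _ (hd !ℓ)) (S.land_mem d _ (hd !ℓ)) le_rfl hld with h | h | h
  · exact Or.inl h.2
  · exact Or.inl h.2.2
  · exact Or.inr ⟨h.1, h.2.2⟩

/-- If `i → u`, `d → u`, where `i` lands first and `d` is late, then the cut vertex of `d` is on the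
path of `i`. -/
lemma late_cut {ℓ : Bool} {i d u : I} (hd : S.Full d) (hi : S.Arrow ℓ i u) (hdu : S.Arrow ℓ d u)
    (ld : S.Late ℓ d) (hlt : S.land i ℓ < S.land d ℓ) :
    S.cut d ℓ ∈ S.strand (.inl i) ∧ S.land i ℓ < S.cut d ℓ ∧ S.cut d ℓ ≤ S.meet i u := by
  rcases hi.cut_earlier hdu hlt with h | h
  · exact h
  exfalso
  rcases hd.cut_of_late ld with t | t
  · exact S.meet_not' hdu.adj (S.land_mem d _ (hd !ℓ))
      ((show S.land d (!ℓ) < S.land d ℓ from ld).trans hdu.lt_meet)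
      (S.reaches_mono _ _ _ (S.reaches_of_mem _ _ h.1) t)
  · exact S.meet_not hdu.adj h.1 (t.2.trans hdu.lt_meet) (S.reaches_of_mem _ _ t.1)

/-- There is at most one arrow `c → u` along `ℓ` with `c` full and late on `ℓ`. -/
lemma late_in_unique {ℓ : Bool} {u c d : I} (hc : S.Full c) (hd : S.Full d)
    (hcu : S.Arrow ℓ c u) (hdu : S.Arrow ℓ d u) (lc : S.Late ℓ c) (ld : S.Late ℓ d)
    (hne : c ≠ d) : False := by
  wlog hcd : S.land c ℓ < S.land d ℓ generalizing c d
  · exact this hd hc hdu hcu ld lc hne.symm ((land_lt_or (hc _) (hd _) hne).resolve_left hcd)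
  obtain ⟨h1, h2, -⟩ := late_cut hd hcu hdu ld hcd
  exact not_line_of_mem (S.land_mem_line c ℓ (hc ℓ))
    (S.land_pass c ℓ (hc ℓ) (.inr !ℓ) _ (S.land_mem c _ (hc _)) (S.land_mem_line c _ (hc _)) _ h1
      (S.cut_mem d ℓ (hd ℓ)) lc h2)

/-- If `c → u`, `d → u` along `ℓ` with `d` late and `c` not, then `d` lands first. -/
lemma late_first {ℓ : Bool} {u c d : I} (hc : S.Full c) (hd : S.Full d)
    (hcu : S.Arrow ℓ c u) (hdu : S.Arrow ℓ d u) (lc : S.Late (!ℓ) c) (ld : S.Late ℓ d)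
    (hne : c ≠ d) : S.land d ℓ < S.land c ℓ := by
  refine (land_lt_or (hc ℓ) (hd ℓ) hne).resolve_left fun hlt => ?_
  have hlc : S.land c ℓ < S.land c (!ℓ) := by
    have := lc; unfold Late at this; rwa [Bool.not_not] at this
  have hld : S.land d (!ℓ) < S.land d ℓ := ld
  obtain ⟨z1, z2, z3⟩ := late_cut hd hcu hdu ld hlt
  have hB := hcu.order hdu hlt
  have hz := S.cut_mem d ℓ (hd ℓ)
  obtain ⟨y1, y2, y3, y4⟩ := hcu.cut_mem_tgt hdu hne
  have hy := S.cut_mem u ℓ hcu.tgt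
  have hzd : S.cut d ℓ ∉ S.strand (.inl d) := fun h =>
    S.meet_not hdu.adj (S.meet_mem' hcu.adj) hB
      (S.reaches_mono _ _ _ (S.reaches_of_mem _ _ h) z3)
  have hzle : S.cut d ℓ ≤ S.land d (!ℓ) := (hd.cut_of_late ld).resolve_right fun h => hzd h.1
  have hcz : S.land c (!ℓ) ≤ S.cut d ℓ := by
    rcases S.total _ _ (S.land_mem_line c _ (hc !ℓ)) _ hz with t | t
    · exact t
    · rcases t.eq_or_lt with e | e
      · exact e.ge
      · exact (S.land_not c _ (hc _) _ hz e (S.reaches_of_mem _ _ z1)).elim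
  -- the walk from the cut vertex of `d` along `c` and `u` to the cut vertex of `u` goes round the
  -- landing of `d` on the other line
  obtain ⟨x, hx, hx'⟩ := S.cut_walk d (!ℓ) (hd _) (!ℓ) (!ℓ) c u _ _ _ hz z1
    (S.meet_mem _ _ hcu.adj) (S.meet_mem' hcu.adj) y1 hy z3 y2
  have hdB : S.land d (!ℓ) < S.meet d u := hld.trans hdu.lt_meet
  rcases hx with rfl | rfl
  · rcases hx' with h | h | h | h
    · exact hzd ((hzle.antisymm h.2) ▸ S.land_mem d _ (hd _))
    · exact S.meet_not hdu.adj (S.meet_mem' hcu.adj) hB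
        (S.reaches_mono _ _ _ (S.reaches_land (hd _)) h.2.2)
    · exact S.meet_not hdu.adj h.1 hdB (S.reaches_land (hd _))
    · exact absurd (hdB.trans_le y3) (not_lt_of_ge h.2)
  · have hw := cut_mem_not (hd !ℓ)
    rcases hx' with h | h | h | h
    · exact not_line_of_mem hw h.1
    · refine not_line_of_mem (ℓ := ℓ) ?_ (S.land_mem_line c _ (hc !ℓ))
      refine S.land_pass c _ (hc !ℓ) (.inr ℓ) _ (S.land_mem c ℓ (hc ℓ)) (S.land_mem_line c ℓ (hc ℓ))
        _ h.1 hw hlc (hcz.trans_lt (lt_of_le_of_ne h.2.1 (ne_of_lines hz ?_)))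
      exact not_line_of_mem hw
    · exact S.land_not u ℓ hcu.tgt _ hw (h.2.2.trans_lt y4) (S.reaches_of_mem _ _ h.1)
    · exact not_line_of_mem hw h.1

/-- Among the players that land on both lines, and on `ℓ` after the other line, at most two meet a
given player that lands on `ℓ`. -/
lemma late_three {ℓ : Bool} {u a b c : I} (hu : S.Lands u ℓ) (ha : S.Full a) (hb : S.Full b)
    (hc : S.Full c) (hau : S.Adj a u) (hbu : S.Adj b u) (hcu : S.Adj c u) (la : S.Late ℓ a)
    (lb : S.Late ℓ b) (lc : S.Late ℓ c) (hab : a ≠ b) (hac : a ≠ c) (hbc : b ≠ c) : False := by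
  rcases orient (ha ℓ) hu hau with h1 | h1 <;> rcases orient (hb ℓ) hu hbu with h2 | h2 <;>
    rcases orient (hc ℓ) hu hcu with h3 | h3
  all_goals first
    | exact late_in_unique ha hb h1 h2 la lb hab
    | exact late_in_unique ha hc h1 h3 la lc hac
    | exact late_in_unique hb hc h2 h3 lb lc hbc
    | exact late_out_unique ha hb h1 h2 la lb hab
    | exact late_out_unique ha hc h1 h3 la lc hac
    | exact late_out_unique hb hc h2 h3 lb lc hbc

lemma late_two {ℓ : Bool} {u a b : I} (hu : S.Lands u ℓ) (ha : S.Full a) (hb : S.Full b)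
    (hau : S.Adj a u) (hbu : S.Adj b u) (la : S.Late ℓ a) (lb : S.Late ℓ b) (hab : a ≠ b) :
    S.Arrow ℓ a u ∨ S.Arrow ℓ b u := by
  rcases orient (ha ℓ) hu hau with h1 | h1
  · exact Or.inl h1
  rcases orient (hb ℓ) hu hbu with h2 | h2
  · exact Or.inr h2
  · exact (late_out_unique ha hb h1 h2 la lb hab).elim

lemma late_order {ℓ : Bool} {u c d : I} (hc : S.Full c) (hd : S.Full d)
    (hdu : S.Arrow ℓ d u) (hcu : S.Adj c u) (lc : S.Late (!ℓ) c) (ld : S.Late ℓ d) (hne : c ≠ d) :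
    S.land d ℓ < S.land c ℓ := by
  rcases orient (hc ℓ) hdu.tgt hcu with h | h
  · exact late_first hc hd h hdu lc ld hne
  · exact hdu.lt.trans h.lt

/-- The landings of `c` and `d` on the two lines would precede each other in a cycle. -/
lemma late_cycle {ℓ : Bool} {u v c d : I} (hc : S.Full c) (hd : S.Full d) (hdu : S.Arrow ℓ d u)
    (hcu : S.Adj c u) (hcv : S.Arrow (!ℓ) c v) (hdv : S.Adj d v) (lc : S.Late (!ℓ) c)
    (ld : S.Late ℓ d) (hne : c ≠ d) : False := by
  have h1 := late_order hc hd hdu hcu lc ld hne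
  have h2 := late_order (ℓ := !ℓ) hd hc hcv hdv (by rwa [Bool.not_not]) lc hne.symm
  unfold Late at lc ld
  rw [Bool.not_not] at lc
  exact lt_irrefl _ (h1.trans (lc.trans (h2.trans ld)))

/-- A player that lands on one line and a player that lands on the other one do not have four common
neighbours that land on both lines: two of them would be late on `ℓ` and two on the other line,
which leads to `late_cycle`. -/
lemma no_two_four {ℓ : Bool} {u v a b c d : I} (hu : S.Lands u ℓ) (hv : S.Lands v (!ℓ))
    (fa : S.Full a) (fb : S.Full b) (fc : S.Full c) (fd : S.Full d)
    (hau : S.Adj a u) (hbu : S.Adj b u) (hcu : S.Adj c u) (hdu : S.Adj d u)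
    (hav : S.Adj a v) (hbv : S.Adj b v) (hcv : S.Adj c v) (hdv : S.Adj d v)
    (hab : a ≠ b) (hac : a ≠ c) (had : a ≠ d) (hbc : b ≠ c) (hbd : b ≠ d) (hcd : c ≠ d) :
    False := by
  have two : ∀ p q r s : I, S.Full p → S.Full q → S.Full r → S.Full s → S.Adj p u → S.Adj q u →
      S.Adj r u → S.Adj s u → S.Adj p v → S.Adj q v → S.Adj r v → S.Adj s v → p ≠ q → p ≠ r →
      p ≠ s → q ≠ r → q ≠ s → r ≠ s → S.Late ℓ p → S.Late ℓ q → S.Late (!ℓ) r → S.Late (!ℓ) s →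
      False := by
    intro p q r s fp fq fr fs pu qu ru su pv qv rv sv pq pr ps qr qs rs lp lq lr ls
    rcases late_two hu fp fq pu qu lp lq pq with h | h <;>
      rcases late_two hv fr fs rv sv lr ls rs with h' | h'
    · exact late_cycle fr fp h ru h' pv lr lp pr.symm
    · exact late_cycle fs fp h su h' pv ls lp ps.symm
    · exact late_cycle fr fq h ru h' qv lr lq qr.symm
    · exact late_cycle fs fq h su h' qv ls lq qs.symm
  rcases fa.late ℓ with la | la <;> rcases fb.late ℓ with lb | lb <;>
    rcases fc.late ℓ with lc | lc <;> rcases fd.late ℓ with ld | ld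
  · exact late_three hu fa fb fc hau hbu hcu la lb lc hab hac hbc
  · exact late_three hu fa fb fc hau hbu hcu la lb lc hab hac hbc
  · exact late_three hu fa fb fd hau hbu hdu la lb ld hab had hbd
  · exact two a b c d fa fb fc fd hau hbu hcu hdu hav hbv hcv hdv hab hac had hbc hbd hcd
      la lb lc ld
  · exact late_three hu fa fc fd hau hcu hdu la lc ld hac had hcd
  · exact two a c b d fa fc fb fd hau hcu hbu hdu hav hcv hbv hdv hac hab had hbc.symm hcd hbd
      la lc lb ld
  · exact two a d b c fa fd fb fc hau hdu hbu hcu hav hdv hbv hcv had hab hac hbd.symm hcd.symm hbc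
      la ld lb lc
  · exact late_three hv fb fc fd hbv hcv hdv lb lc ld hbc hbd hcd
  · exact late_three hu fb fc fd hbu hcu hdu lb lc ld hbc hbd hcd
  · exact two b c a d fb fc fa fd hbu hcu hau hdu hbv hcv hav hdv hbc hab.symm hbd hac.symm hcd had
      lb lc la ld
  · exact two b d a c fb fd fa fc hbu hdu hau hcu hbv hdv hav hcv hbd hab.symm hbc had.symm
      hcd.symm hac lb ld la lc
  · exact late_three hv fa fc fd hav hcv hdv la lc ld hac had hcd
  · exact two c d a b fc fd fa fb hcu hdu hau hbu hcv hdv hav hbv hcd hac.symm hbc.symm had.symm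
      hbd.symm hab lc ld la lb
  · exact late_three hv fa fb fd hav hbv hdv la lb ld hab had hbd
  · exact late_three hv fa fb fc hav hbv hcv la lb lc hab hac hbc
  · exact late_three hv fa fb fc hav hbv hcv la lb lc hab hac hbc

end FlowSystem

/-! ### Connections, and two disjoint connections -/

/-- `Conn T s a b`: the relation `T` leads from `a` to `b` inside the vertex set `s`. -/
def Conn {E : Type} (T : E → E → Prop) (s : Set E) (a b : E) : Prop :=
  a ∈ s ∧ Relation.ReflTransGen (fun x y => T x y ∧ y ∈ s) a b

namespace Conn

variable {E : Type} {T T' : E → E → Prop} {s t : Set E} {a b c : E}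

lemma refl (h : a ∈ s) : Conn T s a a := ⟨h, .refl⟩

lemma left_mem (h : Conn T s a b) : a ∈ s := h.1

lemma right_mem (h : Conn T s a b) : b ∈ s := by
  rcases Relation.ReflTransGen.cases_tail h.2 with e | ⟨_, _, h'⟩
  · exact e ▸ h.1
  · exact h'.2

lemma tail (h : Conn T s a b) (hbc : T b c) (hc : c ∈ s) : Conn T s a c :=
  ⟨h.1, h.2.tail ⟨hbc, hc⟩⟩

lemma head (ha : a ∈ s) (hab : T a b) (h : Conn T s b c) : Conn T s a c :=
  ⟨ha, Relation.ReflTransGen.head ⟨hab, h.1⟩ h.2⟩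

@[elab_as_elim]
lemma induct {P : E → Prop} (h : Conn T s a b) (h0 : P a)
    (h1 : ∀ x y, Conn T s a x → T x y → y ∈ s → P x → P y) : P b := by
  have : P b ∧ Conn T s a b := by
    obtain ⟨ha, h⟩ := h
    induction h with
    | refl => exact ⟨h0, refl ha⟩
    | tail _ hxy ih => exact ⟨h1 _ _ ih.2 hxy.1 hxy.2 ih.1, ih.2.tail hxy.1 hxy.2⟩
  exact this.1

lemma trans (h : Conn T s a b) (h' : Conn T s b c) : Conn T s a c := ⟨h.1, h.2.trans h'.2⟩

lemma imp_of_mem (h : Conn T s a b) (hst : s ⊆ t) (hT : ∀ x ∈ s, ∀ y ∈ s, T x y → T' x y) :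
    Conn T' t a b := by
  refine h.induct (P := fun b => Conn T' t a b) (refl (hst h.1)) ?_
  intro x y hx hxy hy ih
  exact ih.tail (hT x hx.right_mem y hy hxy) (hst hy)

lemma mono (h : Conn T s a b) (hst : s ⊆ t) : Conn T t a b := h.imp_of_mem hst fun _ _ _ _ h => h

lemma mono_rel (h : Conn T s a b) (hT : ∀ x y, T x y → T' x y) : Conn T' s a b :=
  h.imp_of_mem subset_rfl fun x _ y _ => hT x y

lemma swap (h : Conn T s a b) : Conn (fun x y => T y x) s b a := by
  refine h.induct (P := fun b => Conn (fun x y => T y x) s b a) (refl h.1) ?_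
  intro x y hx hxy hy ih
  exact head hy hxy ih

/-- Every vertex may be taken to be accessible from the first one. -/
lemma shrink (h : Conn T s a b) : Conn T {v | Conn T s a v} a b := by
  refine h.induct (P := fun b => Conn T {v | Conn T s a v} a b) (refl (refl h.1)) ?_
  intro x y hx hxy hy ih
  exact ih.tail hxy (hx.tail hxy hy)

/-- Every vertex but the last one may be taken to be accessible from the first one without passing
the last one. -/
lemma shrink_to (h : Conn T s a b) : Conn T ({v | Conn T (s \ {b}) a v} ∪ {b}) a b := by
  have key : ∀ {c}, Conn T s a c →
      Conn T (s \ {b}) a c ∨ Conn T ({v | Conn T (s \ {b}) a v} ∪ {b}) a b := by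
    intro c hc
    refine hc.induct (P := fun c => Conn T (s \ {b}) a c ∨
      Conn T ({v | Conn T (s \ {b}) a v} ∪ {b}) a b) ?_ ?_
    · by_cases hab : a = b
      · subst hab
        exact Or.inr (refl (Or.inr rfl))
      · exact Or.inl (refl ⟨hc.1, hab⟩)
    · rintro x y - hxy hy (ih | ih)
      · by_cases hyb : y = b
        · subst hyb
          exact Or.inr ((ih.shrink.mono Set.subset_union_left).tail hxy (Or.inr rfl))
        · exact Or.inl (ih.tail hxy ⟨hy, hyb⟩)
      · exact Or.inr ih
  rcases key h with h' | h'
  · exact absurd rfl h'.right_mem.2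
  · exact h'

lemma reflTransGen (h : Conn T s a b) : Relation.ReflTransGen T a b :=
  Relation.ReflTransGen.mono (fun _ _ h => h.1) _ _ h.2

lemma of_reflTransGen (h : Relation.ReflTransGen T a b) : Conn T Set.univ a b :=
  ⟨trivial, Relation.ReflTransGen.mono (fun _ _ h => ⟨h, trivial⟩) _ _ h⟩

/-- A connection is realized by a list. -/
lemma exists_list (h : Conn T s a b) : ∃ l : List E, l.IsChain T ∧ l.head? = some a ∧
    l.getLast? = some b ∧ ∀ x ∈ l, x ∈ s := by
  refine h.induct (P := fun b => ∃ l : List E, l.IsChain T ∧ l.head? = some a ∧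
    l.getLast? = some b ∧ ∀ x ∈ l, x ∈ s) ⟨[a], by simp, rfl, rfl, by simpa using h.1⟩ ?_
  rintro x y - hxy hy ⟨l, h1, h2, h3, h4⟩
  refine ⟨l ++ [y], ?_, ?_, by simp, ?_⟩
  · rw [List.isChain_append]
    refine ⟨h1, by simp, ?_⟩
    intro u hu v hv
    simp only [Option.mem_def, h3, Option.some.injEq, List.head?_cons] at hu hv
    subst hu; subst hv
    exact hxy
  · simp [List.head?_append, h2]
  · intro z hz
    rw [List.mem_append, List.mem_singleton] at hz
    rcases hz with hz | rfl
    · exact h4 z hz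
    · exact hy

/-- A list realizes a connection. -/
lemma of_list {l : List E} (h : l.IsChain T) (ha : l.head? = some a) (hb : l.getLast? = some b) :
    Conn T {x | x ∈ l} a b := by
  induction l generalizing a with
  | nil => simp at ha
  | cons x l ih =>
    simp only [List.head?_cons, Option.some.injEq] at ha
    subst ha
    cases l with
    | nil =>
      simp only [List.getLast?_singleton, Option.some.injEq] at hb
      subst hb
      exact refl (by simp)
    | cons y l =>
      rw [List.isChain_cons_cons] at h
      have := ih (a := y) h.2 rfl (by simpa using hb)
      exact head (by simp) h.1 (this.mono fun z hz => List.mem_cons_of_mem _ hz)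

end Conn

/-- Menger's theorem for two disjoint connections from `A` to `B`: they exist if no single vertex
meets all connections from `A` to `B`. The induction removes one arc at a time. -/
theorem exists_two_disjoint_conn {E : Type} [Finite E] [Nonempty E] (T : E → E → Prop)
    (A B : Set E) (h : ∀ z, ∃ a ∈ A, ∃ b ∈ B, Conn T {z}ᶜ a b) :
    ∃ s t : Set E, Disjoint s t ∧ (∃ a ∈ A, ∃ b ∈ B, Conn T s a b) ∧
      ∃ a ∈ A, ∃ b ∈ B, Conn T t a b := by
  induction hn : {e : E × E | T e.1 e.2}.ncard using Nat.strong_induction_on generalizing T A B with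
  | _ n ih =>
  by_cases hT : ∃ x y, T x y
  swap
  · have hconn : ∀ z, ∃ a, a ∈ A ∧ a ∈ B ∧ a ≠ z := by
      intro z
      obtain ⟨a, ha, b, hb, hc⟩ := h z
      have : a = b := by
        refine hc.induct (P := fun b => a = b) rfl ?_
        intro x y _ hxy
        exact absurd ⟨x, y, hxy⟩ hT
      subst this
      exact ⟨a, ha, hb, hc.1⟩
    obtain ⟨a, ha, ha', -⟩ := hconn (Classical.arbitrary E)
    obtain ⟨b, hb, hb', hne⟩ := hconn a
    refine ⟨{a}, {b}, by simpa using hne.symm, ⟨a, ha, a, ha', .refl rfl⟩,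
      ⟨b, hb, b, hb', .refl rfl⟩⟩
  obtain ⟨x, y, hxy⟩ := hT
  set T' : E → E → Prop := fun u v => T u v ∧ ¬ (u = x ∧ v = y) with hT'
  have hle : ∀ u v, T' u v → T u v := fun u v h => h.1
  have hlt : {e : E × E | T' e.1 e.2}.ncard < n := by
    rw [← hn]
    refine Set.ncard_lt_ncard ⟨fun e he => he.1, fun hsub => ?_⟩ (Set.toFinite _)
    have : T' x y := hsub (a := (x, y)) hxy
    exact this.2 ⟨rfl, rfl⟩
  by_cases h' : ∀ z, ∃ a ∈ A, ∃ b ∈ B, Conn T' {z}ᶜ a b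
  · obtain ⟨s, t, hd, ⟨a, ha, b, hb, h1⟩, ⟨a', ha', b', hb', h2⟩⟩ := ih _ hlt T' A B h' rfl
    exact ⟨s, t, hd, ⟨a, ha, b, hb, h1.mono_rel hle⟩, ⟨a', ha', b', hb', h2.mono_rel hle⟩⟩
  push Not at h'
  obtain ⟨s, hs⟩ := h'
  -- a connection in `T` either avoids the arc from `x` to `y` or reaches `x` without it
  have split : ∀ z a b, Conn T {z}ᶜ a b → Conn T' {z}ᶜ a b ∨ Conn T' {z}ᶜ a x := by
    intro z a b hab
    refine hab.induct (P := fun b => Conn T' {z}ᶜ a b ∨ Conn T' {z}ᶜ a x) (.inl (.refl hab.1)) ?_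
    rintro u v - huv hv (hu | hu)
    · by_cases he : u = x ∧ v = y
      · exact Or.inr (he.1 ▸ hu)
      · exact Or.inl (hu.tail ⟨huv, he⟩ hv)
    · exact Or.inr hu
  have split' : ∀ z a b, Conn T {z}ᶜ a b → Conn T' {z}ᶜ a b ∨ Conn T' {z}ᶜ y b := by
    intro z a b hab
    refine hab.induct (P := fun b => Conn T' {z}ᶜ a b ∨ Conn T' {z}ᶜ y b) (.inl (.refl hab.1)) ?_
    rintro u v - huv hv hu
    by_cases he : u = x ∧ v = y
    · exact Or.inr (he.2 ▸ .refl hv)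
    · rcases hu with hu | hu
      · exact Or.inl (hu.tail ⟨huv, he⟩ hv)
      · exact Or.inr (hu.tail ⟨huv, he⟩ hv)
  -- connections from `A` to `B` that avoid the arc pass `s`
  have through : ∀ z a b, a ∈ A → b ∈ B → Conn T' {z}ᶜ a b →
      Conn T' {z}ᶜ a s ∧ Conn T' {z}ᶜ s b := by
    intro z a b ha hb hab
    have hl := hab.induct (P := fun b => Conn T' {s}ᶜ a b ∨ (Conn T' {z}ᶜ a s ∧ Conn T' {z}ᶜ s b))
      (by
        by_cases has : a = s
        · exact Or.inr ⟨has ▸ .refl hab.1, has ▸ .refl hab.1⟩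
        · exact Or.inl (.refl has))
      (by
        rintro u v hu huv hv (h1 | h1)
        · by_cases hvs : v = s
          · exact Or.inr ⟨hvs ▸ hu.tail huv hv, hvs ▸ .refl hv⟩
          · exact Or.inl (h1.tail huv hvs)
        · exact Or.inr ⟨h1.1, h1.2.tail huv hv⟩)
    exact hl.resolve_left (hs a ha b hb)
  have hA : ∀ z, ∃ a ∈ A, ∃ b ∈ ({s, x} : Set E), Conn T' {z}ᶜ a b := by
    intro z
    obtain ⟨a, ha, b, hb, hab⟩ := h z
    rcases split z a b hab with h1 | h1
    · exact ⟨a, ha, s, by simp, (through z a b ha hb h1).1⟩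
    · exact ⟨a, ha, x, by simp, h1⟩
  have hB : ∀ z, ∃ a ∈ ({s, y} : Set E), ∃ b ∈ B, Conn T' {z}ᶜ a b := by
    intro z
    obtain ⟨a, ha, b, hb, hab⟩ := h z
    rcases split' z a b hab with h1 | h1
    · exact ⟨s, by simp, b, hb, (through z a b ha hb h1).2⟩
    · exact ⟨y, by simp, b, hb, h1⟩
  have hA' : ∃ P P' : Set E, Disjoint P P' ∧ (∃ a ∈ A, Conn T' P a s) ∧
      ∃ a ∈ A, Conn T' P' a x := by
    obtain ⟨P, P', hd, ⟨a, ha, b, hb, h1⟩, ⟨a', ha', b', hb', h2⟩⟩ := ih _ hlt T' A _ hA rfl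
    have hne : b ≠ b' := fun e => Set.disjoint_left.1 hd h1.right_mem (e ▸ h2.right_mem)
    rcases hb with rfl | rfl <;> rcases hb' with rfl | rfl
    · exact absurd rfl hne
    · exact ⟨P, P', hd, ⟨a, ha, h1⟩, ⟨a', ha', h2⟩⟩
    · exact ⟨P', P, hd.symm, ⟨a', ha', h2⟩, ⟨a, ha, h1⟩⟩
    · exact absurd rfl hne
  have hB' : ∃ Q Q' : Set E, Disjoint Q Q' ∧ (∃ b ∈ B, Conn T' Q s b) ∧
      ∃ b ∈ B, Conn T' Q' y b := by
    obtain ⟨P, P', hd, ⟨a, ha, b, hb, h1⟩, ⟨a', ha', b', hb', h2⟩⟩ := ih _ hlt T' _ B hB rfl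
    have hne : a ≠ a' := fun e => Set.disjoint_left.1 hd h1.left_mem (e ▸ h2.left_mem)
    rcases ha with rfl | rfl <;> rcases ha' with rfl | rfl
    · exact absurd rfl hne
    · exact ⟨P, P', hd, ⟨b, hb, h1⟩, ⟨b', hb', h2⟩⟩
    · exact ⟨P', P, hd.symm, ⟨b', hb', h2⟩, ⟨b, hb, h1⟩⟩
    · exact absurd rfl hne
  obtain ⟨P, P', hdP, ⟨a, ha, hP⟩, ⟨a', ha', hP'⟩⟩ := hA'
  obtain ⟨Q, Q', hdQ, ⟨b, hb, hQ⟩, ⟨b', hb', hQ'⟩⟩ := hB'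
  have hsP := hP.right_mem
  have hsQ := hQ.left_mem
  have hP1 := hP.shrink_to
  have hP1' := hP'.shrink
  have hQ1 := hQ.swap.shrink_to.swap
  have hQ1' := hQ'.swap.shrink.swap
  have hsub : ({v | Conn T' (P \ {s}) a v} ∪ {s}) ⊆ P := by
    rintro v (hv | rfl)
    · exact hv.right_mem.1
    · exact hsP
  have hsub' : ({v | Conn (fun x y => T' y x) (Q \ {s}) b v} ∪ {s}) ⊆ Q := by
    rintro v (hv | rfl)
    · exact hv.right_mem.1
    · exact hsQ
  have hsub1 : {v | Conn T' P' a' v} ⊆ P' := fun v hv => hv.right_mem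
  have hsub1' : {v | Conn (fun x y => T' y x) Q' b' v} ⊆ Q' := fun v hv => hv.right_mem
  -- two pieces that meet outside `s` make a connection from `A` to `B` that avoids `s`
  have glue : ∀ v a b, a ∈ A → b ∈ B → Conn T' {s}ᶜ a v → Conn T' {s}ᶜ v b → False :=
    fun v a b ha hb h1 h2 => hs a ha b hb (h1.trans h2)
  have nsP' : ∀ {v w}, Conn T' P' v w → Conn T' {s}ᶜ v w := fun h => h.mono fun u hu hus =>
    Set.disjoint_left.1 hdP hsP ((show u = s from hus) ▸ hu)
  have nsQ' : ∀ {v w}, Conn T' Q' v w → Conn T' {s}ᶜ v w := fun h => h.mono fun u hu hus =>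
    Set.disjoint_left.1 hdQ hsQ ((show u = s from hus) ▸ hu)
  refine ⟨_, _, ?_, ⟨a, ha, b, hb, (((hP1.mono Set.subset_union_left).trans
      (hQ1.mono Set.subset_union_right)).mono_rel hle)⟩,
    ⟨a', ha', b', hb', (((hP1'.mono Set.subset_union_left).mono_rel hle).tail hxy
      (Or.inr hQ1'.left_mem)).trans ((hQ1'.mono Set.subset_union_right).mono_rel hle)⟩⟩
  rw [Set.disjoint_left]
  rintro v (hv | hv) (hv' | hv')
  · exact Set.disjoint_left.1 hdP (hsub hv) (hsub1 hv')
  · have h2 : Conn T' Q' v b' := hv'.swap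
    rcases hv with hv | hv
    · exact glue v a b' ha hb' (hv.mono fun u hu => hu.2) (nsQ' h2)
    · exact (nsQ' h2).left_mem hv
  · have h2 : Conn T' P' a' v := hv'
    rcases hv with hv | hv
    · exact glue v a' b ha' hb (nsP' h2) (Conn.mono (hv.swap) fun u hu => hu.2)
    · exact (nsP' h2).right_mem hv
  · exact Set.disjoint_left.1 hdQ (hsub' hv) (hsub1' hv')

/-! ### Routings with few transitions -/

namespace List

variable {E : Type} {l : List E}

/-- A chain of a relation that omits a step is a chain of the relation without that step. -/
lemma IsChain.avoid {T : E → E → Prop} (h : l.IsChain T) {f e : E} (hn : ¬ [f, e] <:+: l) :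
    l.IsChain fun x y => T x y ∧ ¬ (x = f ∧ y = e) := by
  induction l with
  | nil => simp
  | cons x l ih =>
    cases l with
    | nil => simp
    | cons y l =>
      rw [List.isChain_cons_cons] at h ⊢
      refine ⟨⟨h.1, ?_⟩, ih h.2 fun hi => hn (hi.trans (List.suffix_cons _ _).isInfix)⟩
      rintro ⟨rfl, rfl⟩
      exact hn ⟨[], l, by simp⟩

lemma IsChain.rel_of_infix {T : E → E → Prop} (h : l.IsChain T) {f e : E} (hi : [f, e] <:+: l) :
    T f e := by
  have := h.infix hi
  simpa using this

end List

/-- The commodity that a strand belongs to; the two lines belong to the commodity `none`. -/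
def commodity {I : Type} : I ⊕ Bool → Option I
  | .inl i => some i
  | .inr _ => none

/-- The relation `T` without the arc from `f` to `e`. -/
def Without {E : Type} (T : E → E → Prop) (f e : E) : E → E → Prop :=
  fun x y => T x y ∧ ¬ (x = f ∧ y = e)

/-- The relation `T` is rich enough for one route of each player and for two disjoint routes of the
commodity `none`. -/
def Routable {I E : Type} (A B : Option I → Set E) (T : E → E → Prop) : Prop :=
  (∀ i, ∃ a ∈ A (some i), ∃ b ∈ B (some i), Conn T Set.univ a b) ∧
    ∃ s t : Set E, Disjoint s t ∧ (∃ a ∈ A none, ∃ b ∈ B none, Conn T s a b) ∧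
      ∃ a ∈ A none, ∃ b ∈ B none, Conn T t a b

/-- Routes of all commodities in an acyclic relation `T` that is minimal among the relations that
admit such routes. The elements of `E` are the edges of the network, `T x y` says that `y` may
follow `x`, and `A` and `B` are the sets of edges at the sources and at the sinks. -/
structure Routing (I E : Type) [PartialOrder E] where
  T : E → E → Prop
  le_iff : ∀ x y, x ≤ y ↔ Relation.ReflTransGen T x y
  irrefl : ∀ x, ¬ T x x
  A : Option I → Set E
  B : Option I → Set E
  path : I ⊕ Bool → List E
  chain : ∀ s, (path s).IsChain T
  head : ∀ s, ∃ a ∈ A (commodity s), (path s).head? = some a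
  last : ∀ s, ∃ b ∈ B (commodity s), (path s).getLast? = some b
  disj : ∀ ℓ, ∀ x ∈ path (.inr ℓ), x ∉ path (.inr !ℓ)
  minimal : ∀ T' : E → E → Prop, (∀ x y, T' x y → T x y) → Routable A B T' → ∀ x y, T x y → T' x y

namespace Routing

variable {I E : Type} [PartialOrder E] (R : Routing I E)

lemma lt_of_arc {x y : E} (h : R.T x y) : x < y :=
  lt_of_le_of_ne ((R.le_iff _ _).2 (.single h)) fun e => R.irrefl y (e ▸ h)

lemma le_of_conn {s : Set E} {x y : E} (h : Conn R.T s x y) : x ≤ y :=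
  (R.le_iff _ _).2 h.reflTransGen

lemma conn_of_le {x y : E} (h : x ≤ y) : Conn R.T {z | x ≤ z ∧ z ≤ y} x y := by
  have h1 := Conn.of_reflTransGen ((R.le_iff _ _).1 h)
  have h2 := h1.shrink.swap.shrink.swap
  exact h2.mono fun z hz => ⟨R.le_of_conn hz.right_mem, R.le_of_conn hz.swap⟩

lemma conn_of_append {l₁ l₂ : List E} {x y : E} {s : I ⊕ Bool} {m : List E}
    (h : R.path s = l₁ ++ m ++ l₂) (hx : m.head? = some x) (hy : m.getLast? = some y) :
    Conn R.T {z | z ∈ R.path s ∧ x ≤ z ∧ z ≤ y} x y := by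
  have hc := R.chain s
  rw [h] at hc
  have hm : Conn R.T {z | z ∈ m} x y :=
    Conn.of_list (List.isChain_append.1 (List.isChain_append.1 hc).1).2.1 hx hy
  refine hm.shrink.swap.shrink.swap.mono fun z hz => ⟨?_, ?_, ?_⟩
  · rw [h]
    have : z ∈ m := hz.right_mem.right_mem
    simp [this]
  · exact R.le_of_conn hz.right_mem
  · exact R.le_of_conn hz.swap

lemma conn_start {s : I ⊕ Bool} {y : E} (hy : y ∈ R.path s) :
    ∃ a ∈ R.A (commodity s), Conn R.T {z | z ∈ R.path s ∧ z ≤ y} a y := by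
  obtain ⟨l₁, l₂, h⟩ := List.append_of_mem hy
  obtain ⟨a, ha, ha'⟩ := R.head s
  refine ⟨a, ha, (R.conn_of_append (l₁ := []) (m := l₁ ++ [y]) (l₂ := l₂) (s := s) (y := y) (x := a)
    (by simp [h]) ?_ (by simp)).mono fun z hz => ⟨hz.1, hz.2.2⟩⟩
  rw [← ha', h]
  cases l₁ <;> simp

lemma conn_end {s : I ⊕ Bool} {y : E} (hy : y ∈ R.path s) :
    ∃ b ∈ R.B (commodity s), Conn R.T {z | z ∈ R.path s ∧ y ≤ z} y b := by
  obtain ⟨l₁, l₂, h⟩ := List.append_of_mem hy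
  obtain ⟨b, hb, hb'⟩ := R.last s
  refine ⟨b, hb, (R.conn_of_append (l₁ := l₁) (m := y :: l₂) (l₂ := []) (s := s) (x := y) (y := b)
    (by simp [h]) (by simp) ?_).mono fun z hz => ⟨hz.1, hz.2.1⟩⟩
  rw [← hb', h, List.getLast?_append]
  simp [List.getLast?_cons]

lemma le_or_conn {s : I ⊕ Bool} {x y : E} (hx : x ∈ R.path s) (hy : y ∈ R.path s) :
    Conn R.T {z | z ∈ R.path s ∧ x ≤ z ∧ z ≤ y} x y ∨
      Conn R.T {z | z ∈ R.path s ∧ y ≤ z ∧ z ≤ x} y x := by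
  obtain ⟨l₁, l₂, h⟩ := List.append_of_mem hx
  have hy' := hy
  rw [h, List.mem_append] at hy'
  rcases hy' with hy' | hy'
  · obtain ⟨m₁, m₂, h'⟩ := List.append_of_mem hy'
    refine Or.inr (R.conn_of_append (l₁ := m₁) (m := (y :: m₂) ++ [x]) (l₂ := l₂) ?_ (by simp)
      (by rw [List.getLast?_append]; simp))
    simp [h, h']
  · obtain ⟨m₁, m₂, h'⟩ := List.append_of_mem hy'
    refine Or.inl (R.conn_of_append (l₁ := l₁) (m := m₁ ++ [y]) (l₂ := m₂) ?_ ?_ (by simp))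
    · simp [h, h']
    · cases m₁ with
      | nil => simpa using (List.cons.inj h').1.symm
      | cons z m => simpa using (List.cons.inj h').1.symm

lemma conn_path {s : I ⊕ Bool} {x y : E} (hx : x ∈ R.path s) (hy : y ∈ R.path s) (hxy : x ≤ y) :
    Conn R.T {z | z ∈ R.path s ∧ x ≤ z ∧ z ≤ y} x y := by
  rcases R.le_or_conn hx hy with h | h
  · exact h
  · obtain rfl := le_antisymm hxy (R.le_of_conn h)
    exact h

lemma total {s : I ⊕ Bool} {x y : E} (hx : x ∈ R.path s) (hy : y ∈ R.path s) : x ≤ y ∨ y ≤ x :=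
  (R.le_or_conn hx hy).imp R.le_of_conn R.le_of_conn

lemma arc_of_infix {s : I ⊕ Bool} {f e : E} (h : [f, e] <:+: R.path s) : R.T f e :=
  (R.chain s).rel_of_infix h

lemma mem_of_infix {s : I ⊕ Bool} {f e : E} (h : [f, e] <:+: R.path s) :
    f ∈ R.path s ∧ e ∈ R.path s :=
  ⟨h.subset (by simp), h.subset (by simp)⟩

lemma le_of_infix {s : I ⊕ Bool} {f e x : E} (h : [f, e] <:+: R.path s) (hx : x ∈ R.path s)
    (hlt : x < e) : x ≤ f := by
  obtain ⟨l₁, l₂, h'⟩ := h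
  rw [← h'] at hx
  have hx' : x ∈ l₁ ++ [f] ∨ x ∈ e :: l₂ := by
    simp only [List.mem_append, List.mem_cons, List.not_mem_nil, or_false] at hx ⊢
    tauto
  rcases hx' with hx' | hx'
  · obtain ⟨m₁, m₂, h2⟩ := List.append_of_mem hx'
    refine R.le_of_conn (R.conn_of_append (s := s) (l₁ := m₁) (m := x :: m₂) (l₂ := e :: l₂) (x := x)
      (y := f) ?_ rfl ?_)
    · rw [← h2, ← h']
      simp
    · have : (m₁ ++ x :: m₂).getLast? = some f := by rw [← h2]; simp
      rw [List.getLast?_append] at this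
      simpa [List.getLast?_cons] using this
  · obtain ⟨m₁, m₂, h2⟩ := List.append_of_mem hx'
    refine absurd hlt (not_lt_of_ge (R.le_of_conn (R.conn_of_append (s := s) (l₁ := l₁ ++ [f])
      (m := m₁ ++ [x]) (l₂ := m₂) (x := e) (y := x) ?_ ?_ (by simp))))
    · rw [← h']
      simp only [List.append_assoc, List.cons_append, List.nil_append]
      rw [h2]
    · cases m₁ with
      | nil => simpa using (List.cons.inj h2).1.symm
      | cons z m => simpa using (List.cons.inj h2).1.symm

lemma exists_pred {s : I ⊕ Bool} {x y : E} (hx : x ∈ R.path s) (hy : y ∈ R.path s) (h : x < y) :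
    ∃ f, [f, y] <:+: R.path s := by
  obtain ⟨l₁, l₂, h1⟩ := List.append_of_mem hy
  rcases List.eq_nil_or_concat l₁ with rfl | ⟨m, f, rfl⟩
  · exfalso
    rw [h1] at hx
    obtain ⟨m₁, m₂, h2⟩ := List.append_of_mem hx
    refine absurd h (not_lt_of_ge (R.le_of_conn (R.conn_of_append (s := s) (l₁ := [])
      (m := m₁ ++ [x]) (l₂ := m₂) (x := y) (y := x) ?_ ?_ (by simp))))
    · rw [h1, h2]
      simp
    · cases m₁ with
      | nil => simpa using (List.cons.inj h2).1.symm
      | cons z m => simpa using (List.cons.inj h2).1.symm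
  · exact ⟨f, m, l₂, by simp [h1]⟩

lemma infix_unique {s : I ⊕ Bool} {f g e : E} (h : [f, e] <:+: R.path s)
    (h' : [g, e] <:+: R.path s) : f = g :=
  le_antisymm (R.le_of_infix h' (R.mem_of_infix h).1 (R.lt_of_arc (R.arc_of_infix h)))
    (R.le_of_infix h (R.mem_of_infix h').1 (R.lt_of_arc (R.arc_of_infix h')))

/-- Some route of the player `i` may reach `y`. -/
def Reaches (i : I) (y : E) : Prop := ∃ a ∈ R.A (some i), a ≤ y

lemma Reaches.mono {R : Routing I E} {i : I} {x y : E} (h : R.Reaches i x) (hxy : x ≤ y) :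
    R.Reaches i y := by
  obtain ⟨a, ha, hax⟩ := h
  exact ⟨a, ha, hax.trans hxy⟩

lemma reaches_of_mem {i : I} {x : E} (hx : x ∈ R.path (.inl i)) : R.Reaches i x := by
  obtain ⟨a, ha, h⟩ := R.conn_start hx
  exact ⟨a, ha, R.le_of_conn h⟩

/-- The arc from `f` to `e` is indispensable to the player `i`. -/
def Crit (i : I) (f e : E) : Prop :=
  R.T f e ∧ ¬ ∃ a ∈ R.A (some i), ∃ b ∈ R.B (some i), Conn (Without R.T f e) Set.univ a b

/-- The arc from `f` to `e` is indispensable to the commodity `none`. -/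
def CritLine (f e : E) : Prop :=
  R.T f e ∧ ¬ ∃ s t : Set E, Disjoint s t ∧
    (∃ a ∈ R.A none, ∃ b ∈ R.B none, Conn (Without R.T f e) s a b) ∧
      ∃ a ∈ R.A none, ∃ b ∈ R.B none, Conn (Without R.T f e) t a b

/-- Because of minimality, every arc is indispensable to somebody. -/
lemma crit_or {f e : E} (h : R.T f e) : (∃ i, R.Crit i f e) ∨ R.CritLine f e := by
  by_contra hcon
  push Not at hcon
  have hmin := R.minimal (Without R.T f e) (fun x y h => h.1) ⟨?_, ?_⟩ f e h
  · exact hmin.2 ⟨rfl, rfl⟩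
  · intro i
    by_contra h'
    exact hcon.1 i ⟨h, h'⟩
  · by_contra h'
    exact hcon.2 ⟨h, h'⟩

variable {R}

lemma conn_without {f e : E} {s t : Set E} {x y : E} (h : Conn R.T s x y) (hst : s ⊆ t)
    (hs : ¬ (f ∈ s ∧ e ∈ s)) : Conn (Without R.T f e) t x y := by
  refine h.imp_of_mem hst fun u hu v hv huv => ⟨huv, ?_⟩
  rintro ⟨rfl, rfl⟩
  exact hs ⟨hu, hv⟩

lemma Crit.arc {i : I} {f e : E} (h : R.Crit i f e) : R.T f e := h.1

lemma Crit.lt {i : I} {f e : E} (h : R.Crit i f e) : f < e := R.lt_of_arc h.1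

lemma Crit.mem_conn {i : I} {f e : E} (h : R.Crit i f e) {s : Set E} {a b : E}
    (ha : a ∈ R.A (some i)) (hb : b ∈ R.B (some i)) (hc : Conn R.T s a b) : f ∈ s ∧ e ∈ s := by
  by_contra hcon
  exact h.2 ⟨a, ha, b, hb, conn_without hc (Set.subset_univ _) hcon⟩

lemma Crit.infix {i : I} {f e : E} (h : R.Crit i f e) : [f, e] <:+: R.path (.inl i) := by
  by_contra hcon
  obtain ⟨a, ha, ha'⟩ := R.head (.inl i)
  obtain ⟨b, hb, hb'⟩ := R.last (.inl i)
  exact h.2 ⟨a, ha, b, hb,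
    (Conn.of_list ((R.chain (.inl i)).avoid hcon) ha' hb').mono (Set.subset_univ _)⟩

lemma Crit.mem {i : I} {f e : E} (h : R.Crit i f e) : e ∈ R.path (.inl i) :=
  (R.mem_of_infix h.infix).2

/-- No other arc that enters `e` is accessible to `i`. -/
lemma Crit.eq_of_reaches {i : I} {f g e : E} (h : R.Crit i f e) (hg : R.T g e)
    (hr : R.Reaches i g) : g = f := by
  by_contra hne
  obtain ⟨a, ha, hag⟩ := hr
  obtain ⟨b, hb, heb⟩ := R.conn_end h.mem
  have h1 : Conn (Without R.T f e) Set.univ a g :=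
    conn_without (R.conn_of_le hag) (Set.subset_univ _) fun h' =>
      absurd h'.2.2 (not_le_of_gt (R.lt_of_arc hg))
  have h2 : Conn (Without R.T f e) Set.univ e b :=
    conn_without heb (Set.subset_univ _) fun h' => absurd h'.1.2 (not_le_of_gt h.lt)
  exact h.2 ⟨a, ha, b, hb, (h1.tail ⟨hg, fun h' => hne h'.1⟩ trivial).trans h2⟩

/-- A player cannot bypass an indispensable arc along another strand. -/
lemma Crit.pass {i : I} {f e : E} (h : R.Crit i f e) {s : I ⊕ Bool} {y w : E}
    (hy : y ∈ R.path (.inl i)) (hys : y ∈ R.path s) (hw : w ∈ R.path (.inl i))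
    (hws : w ∈ R.path s) (hye : y < e) (hew : e < w) : e ∈ R.path s := by
  obtain ⟨a, ha, h1⟩ := R.conn_start hy
  obtain ⟨b, hb, h3⟩ := R.conn_end hw
  have h2 := R.conn_path hys hws (hye.trans hew).le
  have := (h.mem_conn (s := {z | z ≤ y} ∪ {z | z ∈ R.path s} ∪ {z | w ≤ z}) ha hb
    (((h1.mono fun z hz => Or.inl (Or.inl hz.2)).trans
      (h2.mono fun z hz => Or.inl (Or.inr hz.1))).trans (h3.mono fun z hz => Or.inr hz.2))).2
  rcases this with (h' | h') | h'
  · exact absurd h' (not_le_of_gt hye)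
  · exact h'
  · exact absurd h' (not_le_of_gt hew)

lemma CritLine.infix {f e : E} (h : R.CritLine f e) : ∃ ℓ, [f, e] <:+: R.path (.inr ℓ) := by
  by_contra hcon
  push Not at hcon
  have key : ∀ ℓ, ∃ a ∈ R.A none, ∃ b ∈ R.B none,
      Conn (Without R.T f e) {x | x ∈ R.path (.inr ℓ)} a b := by
    intro ℓ
    obtain ⟨a, ha, ha'⟩ := R.head (.inr ℓ)
    obtain ⟨b, hb, hb'⟩ := R.last (.inr ℓ)
    exact ⟨a, ha, b, hb, Conn.of_list ((R.chain _).avoid (hcon ℓ)) ha' hb'⟩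
  exact h.2 ⟨_, _, Set.disjoint_left.2 (R.disj true), key true, key false⟩

variable (R)

/-- Two distinct arcs of `T` enter `e`. -/
def Merges (e : E) : Prop := ∃ f g, f ≠ g ∧ R.T f e ∧ R.T g e

/-- The players `i` and `j` enter `e` through distinct indispensable arcs. -/
def MeetAt (e : E) (i j : I) : Prop := i ≠ j ∧ ∃ f g, f ≠ g ∧ R.Crit i f e ∧ R.Crit j g e

/-- The player `i` and the line `ℓ` enter `e` through distinct indispensable arcs. -/
def LandAt (e : E) (i : I) (ℓ : Bool) : Prop :=
  ∃ f g, f ≠ g ∧ R.Crit i f e ∧ R.CritLine g e ∧ [g, e] <:+: R.path (.inr ℓ)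

/-- The two parties whose distinct indispensable arcs enter `e`. -/
def IsLabel (e : E) : I × (I ⊕ Bool) → Prop
  | (i, .inl j) => R.MeetAt e i j
  | (i, .inr ℓ) => R.LandAt e i ℓ

variable {R}

lemma MeetAt.symm {e : E} {i j : I} (h : R.MeetAt e i j) : R.MeetAt e j i := by
  obtain ⟨hne, f, g, hfg, h1, h2⟩ := h
  exact ⟨hne.symm, g, f, hfg.symm, h2, h1⟩

lemma MeetAt.mem {e : E} {i j : I} (h : R.MeetAt e i j) : e ∈ R.path (.inl i) := by
  obtain ⟨-, f, g, -, h1, -⟩ := h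
  exact h1.mem

lemma MeetAt.star {e : E} {i j : I} (h : R.MeetAt e i j) {s : I ⊕ Bool} (he : e ∈ R.path s)
    {y y' : E} (hy : y ∈ R.path s) (hy' : y' ∈ R.path s) (hlt : y < e) (hlt' : y' < e)
    (hr : R.Reaches i y) (hr' : R.Reaches j y') : False := by
  obtain ⟨-, f, g, hfg, h1, h2⟩ := h
  obtain ⟨p, hp⟩ := R.exists_pred hy he hlt
  have e1 := h1.eq_of_reaches (R.arc_of_infix hp) (hr.mono (R.le_of_infix hp hy hlt))
  have e2 := h2.eq_of_reaches (R.arc_of_infix hp) (hr'.mono (R.le_of_infix hp hy' hlt'))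
  exact hfg (e1.symm.trans e2)

/-- Two players meet only once. -/
lemma MeetAt.unique {e e' : E} {i j : I} (h : R.MeetAt e i j) (h' : R.MeetAt e' i j) : e = e' := by
  by_contra hne
  wlog hle : e ≤ e' generalizing e e'
  · exact this h' h (Ne.symm hne) ((R.total h.mem h'.mem).resolve_left hle)
  have hlt := lt_of_le_of_ne hle hne
  exact h'.star h'.mem h.mem h.mem hlt hlt (R.reaches_of_mem h.mem) (R.reaches_of_mem h.symm.mem)

lemma LandAt.mem {e : E} {i : I} {ℓ : Bool} (h : R.LandAt e i ℓ) : e ∈ R.path (.inl i) := by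
  obtain ⟨f, g, -, h1, -⟩ := h
  exact h1.mem

lemma LandAt.mem_line {e : E} {i : I} {ℓ : Bool} (h : R.LandAt e i ℓ) : e ∈ R.path (.inr ℓ) := by
  obtain ⟨f, g, -, -, -, h1⟩ := h
  exact (R.mem_of_infix h1).2

lemma LandAt.not_reaches {e : E} {i : I} {ℓ : Bool} (h : R.LandAt e i ℓ) {y : E}
    (hy : y ∈ R.path (.inr ℓ)) (hlt : y < e) : ¬ R.Reaches i y := by
  intro hr
  obtain ⟨f, g, hfg, h1, -, h3⟩ := h
  exact hfg (h1.eq_of_reaches (R.arc_of_infix h3) (hr.mono (R.le_of_infix h3 hy hlt))).symm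

/-- A player lands on a line only once. -/
lemma LandAt.unique {e e' : E} {i : I} {ℓ : Bool} (h : R.LandAt e i ℓ) (h' : R.LandAt e' i ℓ) :
    e = e' := by
  by_contra hne
  rcases R.total h.mem h'.mem with hle | hle
  · exact h'.not_reaches h.mem_line (lt_of_le_of_ne hle hne) (R.reaches_of_mem h.mem)
  · exact h.not_reaches h'.mem_line (lt_of_le_of_ne hle (Ne.symm hne)) (R.reaches_of_mem h'.mem)

/-- The vertex `z` of the other line meets all routes of the commodity `none` that do not use the
arc by which the line `ℓ` enters `e`. -/
def IsCut (R : Routing I E) (ℓ : Bool) (e z : E) : Prop :=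
  z ∈ R.path (.inr !ℓ) ∧ ∃ g, [g, e] <:+: R.path (.inr ℓ) ∧
    ∀ s a b, a ∈ R.A none → b ∈ R.B none → Conn (Without R.T g e) s a b → z ∈ s

/-- By Menger's theorem an arc that is indispensable to the pair of lines has a cut vertex. -/
lemma LandAt.exists_cut [Finite E] {e : E} {i : I} {ℓ : Bool} (h : R.LandAt e i ℓ) :
    ∃ z, R.IsCut ℓ e z := by
  obtain ⟨f, g, hfg, h1, h2, h3⟩ := h
  have he := (R.mem_of_infix h3).2
  have : ∃ z, ∀ a ∈ R.A none, ∀ b ∈ R.B none, ¬ Conn (Without R.T g e) {z}ᶜ a b := by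
    by_contra hcon
    push Not at hcon
    have : Nonempty E := ⟨e⟩
    exact h2.2 (exists_two_disjoint_conn _ _ _ hcon)
  obtain ⟨z, hz⟩ := this
  have hz' : ∀ s a b, a ∈ R.A none → b ∈ R.B none → Conn (Without R.T g e) s a b → z ∈ s := by
    intro s a b ha hb hc
    by_contra hzs
    exact hz a ha b hb (hc.mono fun x hx hxz => hzs ((show x = z from hxz) ▸ hx))
  refine ⟨z, ?_, g, h3, hz'⟩
  obtain ⟨a, ha, ha'⟩ := R.head (.inr !ℓ)
  obtain ⟨b, hb, hb'⟩ := R.last (.inr !ℓ)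
  exact hz' _ a b ha hb (conn_without (Conn.of_list (R.chain _) ha' hb') subset_rfl
    fun h => R.disj ℓ e he h.2)

lemma IsCut.walk {e z : E} {ℓ : Bool} (h : R.IsCut ℓ e z) {m m' : Bool} {r r' : I} {u v w : E}
    (h1 : u ∈ R.path (.inr m)) (h2 : u ∈ R.path (.inl r)) (h3 : v ∈ R.path (.inl r))
    (h4 : v ∈ R.path (.inl r')) (h5 : w ∈ R.path (.inl r')) (h6 : w ∈ R.path (.inr m'))
    (huv : u ≤ v) (hvw : v ≤ w) :
    ∃ x, (x = e ∨ x = z) ∧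
      ((x ∈ R.path (.inr m) ∧ x ≤ u) ∨ (x ∈ R.path (.inl r) ∧ u ≤ x ∧ x ≤ v) ∨
        (x ∈ R.path (.inl r') ∧ v ≤ x ∧ x ≤ w) ∨ (x ∈ R.path (.inr m') ∧ w ≤ x)) := by
  obtain ⟨-, g, -, hz⟩ := h
  obtain ⟨a, ha, c1⟩ := R.conn_start h1
  have c2 := R.conn_path h2 h3 huv
  have c3 := R.conn_path h4 h5 hvw
  obtain ⟨b, hb, c4⟩ := R.conn_end h6
  set s : Set E := {x | (x ∈ R.path (.inr m) ∧ x ≤ u) ∨ (x ∈ R.path (.inl r) ∧ u ≤ x ∧ x ≤ v) ∨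
        (x ∈ R.path (.inl r') ∧ v ≤ x ∧ x ≤ w) ∨ (x ∈ R.path (.inr m') ∧ w ≤ x)} with hs
  have c : Conn R.T s a b :=
    (((c1.mono fun x hx => Or.inl hx).trans (c2.mono fun x hx => Or.inr (Or.inl hx))).trans
      (c3.mono fun x hx => Or.inr (Or.inr (Or.inl hx)))).trans
        (c4.mono fun x hx => Or.inr (Or.inr (Or.inr hx)))
  by_cases he : e ∈ s
  · exact ⟨e, Or.inl rfl, he⟩
  · exact ⟨z, Or.inr rfl, hz s a b ha hb (conn_without c subset_rfl fun h => he h.2)⟩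

/-- The walk along a line, `r` and `i` enters the landing by the arc of `i`, so it can be continued
along `ℓ` without the arc of `ℓ`. -/
lemma LandAt.cut_approach {e z : E} {i : I} {ℓ : Bool} (h : R.LandAt e i ℓ) (hz : R.IsCut ℓ e z)
    {m : Bool} {r : I} {u v : E} (h1 : u ∈ R.path (.inr m)) (h2 : u ∈ R.path (.inl r))
    (h3 : v ∈ R.path (.inl r)) (h4 : v ∈ R.path (.inl i)) (huv : u ≤ v) (hve : v < e) :
    (z ∈ R.path (.inr m) ∧ z ≤ u) ∨ (z ∈ R.path (.inl r) ∧ u ≤ z ∧ z ≤ v) ∨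
      (z ∈ R.path (.inl i) ∧ v ≤ z ∧ z < e) := by
  obtain ⟨hzq, g', hg', hz⟩ := hz
  obtain ⟨f, g, hfg, hf, -, hg⟩ := h
  obtain rfl := R.infix_unique hg hg'
  have hvf : v ≤ f := R.le_of_infix hf.infix h4 hve
  obtain ⟨a, ha, c1⟩ := R.conn_start h1
  have c2 := R.conn_path h2 h3 huv
  have c3 := R.conn_path h4 (R.mem_of_infix hf.infix).1 hvf
  obtain ⟨b, hb, c4⟩ := R.conn_end (R.mem_of_infix hg).2
  set s : Set E := {x | (x ∈ R.path (.inr m) ∧ x ≤ u) ∨ (x ∈ R.path (.inl r) ∧ u ≤ x ∧ x ≤ v) ∨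
        (x ∈ R.path (.inl i) ∧ v ≤ x ∧ x < e) ∨ (x ∈ R.path (.inr ℓ) ∧ e ≤ x)} with hs
  -- up to `f` all vertices come before `e`, and from `e` on `g` does not occur
  have d1 : Conn (Without R.T g e) s a u := (conn_without c1 subset_rfl fun h =>
    absurd h.2.2 (not_le_of_gt (huv.trans_lt hve))).mono fun x hx => Or.inl hx
  have d2 : Conn (Without R.T g e) s u v := (conn_without c2 subset_rfl fun h =>
    absurd h.2.2.2 (not_le_of_gt hve)).mono fun x hx => Or.inr (Or.inl hx)
  have d3 : Conn (Without R.T g e) s v f := (conn_without c3 subset_rfl fun h =>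
    absurd h.2.2.2 (not_le_of_gt hf.lt)).mono
      fun x hx => Or.inr (Or.inr (Or.inl ⟨hx.1, hx.2.1, hx.2.2.trans_lt hf.lt⟩))
  have d4 : Conn (Without R.T g e) s e b := (conn_without c4 subset_rfl fun h =>
    absurd h.1.2 (not_le_of_gt (R.lt_of_arc (R.arc_of_infix hg)))).mono
      fun x hx => Or.inr (Or.inr (Or.inr hx))
  have := hz s a b ha hb
    ((((d1.trans d2).trans d3).tail ⟨hf.arc, fun h => hfg h.1⟩ d4.left_mem).trans d4)
  rcases this with h | h | h | h
  · exact Or.inl h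
  · exact Or.inr (Or.inl h)
  · exact Or.inr (Or.inr h)
  · exact absurd hzq (R.disj ℓ z h.1)

/-- Two indispensable arcs into the same edge do not both belong to the same player, nor to the
lines. -/
lemma Merges.exists_label {e : E} (h : R.Merges e) : ∃ L, R.IsLabel e L := by
  obtain ⟨f, g, hfg, hf, hg⟩ := h
  have aux : ∀ f g, f ≠ g → (∃ i, R.Crit i f e) → R.CritLine g e → ∃ L, R.IsLabel e L := by
    rintro f g hfg ⟨i, hi⟩ hq
    obtain ⟨ℓ, hℓ⟩ := hq.infix
    exact ⟨(i, .inr ℓ), f, g, hfg, hi, hq, hℓ⟩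
  rcases R.crit_or hf with h1 | h1 <;> rcases R.crit_or hg with h2 | h2
  · obtain ⟨i, hi⟩ := h1
    obtain ⟨j, hj⟩ := h2
    refine ⟨(i, .inl j), ?_, f, g, hfg, hi, hj⟩
    rintro rfl
    exact hfg (R.infix_unique hi.infix hj.infix)
  · exact aux f g hfg h1 h2
  · exact aux g f hfg.symm h2 h1
  · exfalso
    obtain ⟨ℓ, hℓ⟩ := h1.infix
    obtain ⟨ℓ', hℓ'⟩ := h2.infix
    by_cases hll : ℓ = ℓ'
    · subst hll
      exact hfg (R.infix_unique hℓ hℓ')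
    · obtain rfl : ℓ' = !ℓ := by revert hll; cases ℓ <;> cases ℓ' <;> simp
      exact R.disj ℓ e (R.mem_of_infix hℓ).2 (R.mem_of_infix hℓ').2

variable (R)

open Classical in
/-- A choice of a label for every vertex that two distinct arcs enter. -/
noncomputable def label (e : E) : Option (I × (I ⊕ Bool)) :=
  if h : R.Merges e then some h.exists_label.choose else none

lemma isLabel_of_label {e : E} {L : I × (I ⊕ Bool)} (h : R.label e = some L) : R.IsLabel e L := by
  unfold label at h
  split_ifs at h with hm
  obtain rfl := Option.some.inj h
  exact hm.exists_label.choose_spec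

/-- The label of `e` says that `i` and `j` meet there. -/
def MeetLabel (i j : I) (e : E) : Prop :=
  R.label e = some (i, .inl j) ∨ R.label e = some (j, .inl i)

lemma meetLabel_comm (i j : I) : R.MeetLabel i j = R.MeetLabel j i := by
  funext e
  exact propext or_comm

variable {R}

lemma MeetLabel.meetAt {i j : I} {e : E} (h : R.MeetLabel i j e) : R.MeetAt e i j := by
  rcases h with h | h
  · exact R.isLabel_of_label h
  · exact MeetAt.symm (R.isLabel_of_label h)

lemma nonempty (R : Routing I E) : Nonempty E := by
  obtain ⟨a, -, -⟩ := R.head (.inr true)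
  exact ⟨a⟩

/-- The flow system of a minimal routing: its meetings and landings are the labels of the vertices
that two distinct arcs enter. -/
noncomputable def flowSystem [Finite E] (R : Routing I E) : FlowSystem I E where
  strand s := {x | x ∈ R.path s}
  Reaches := R.Reaches
  Adj i j := ∃ e, R.MeetLabel i j e
  meet i j := @Classical.epsilon _ R.nonempty (R.MeetLabel i j)
  Lands i ℓ := ∃ e, R.label e = some (i, .inr ℓ)
  land i ℓ := @Classical.epsilon _ R.nonempty fun e => R.label e = some (i, .inr ℓ)
  cut i ℓ := @Classical.epsilon _ R.nonempty
    (R.IsCut ℓ (@Classical.epsilon _ R.nonempty fun e => R.label e = some (i, .inr ℓ)))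
  total s x hx y hy := R.total hx hy
  line_disj := R.disj
  reaches_of_mem i x hx := R.reaches_of_mem hx
  reaches_mono i x y := Reaches.mono
  adj_ne := fun i j ⟨e, he⟩ => he.meetAt.1
  adj_symm := fun i j ⟨e, he⟩ => ⟨e, he.symm⟩
  meet_comm i j := by rw [meetLabel_comm]
  meet_mem i j h := (Classical.epsilon_spec h).meetAt.mem
  meet_inj i j l h h' hjl := by
    have h1 := Classical.epsilon_spec h
    have h2 := Classical.epsilon_spec h'
    intro heq
    rw [← heq] at h2
    have hne := h1.meetAt.1
    unfold MeetLabel at h1 h2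
    rcases h1 with h1 | h1 <;> rcases h2 with h2 | h2 <;> rw [h1] at h2 <;>
      simp only [Option.some.injEq, Prod.mk.injEq, Sum.inl.injEq] at h2
    · exact hjl h2.2
    · exact hne h2.2.symm
    · exact hne h2.1.symm
    · exact hjl h2.1
  meet_star i j h s hs y hy y' hy' := (Classical.epsilon_spec h).meetAt.star hs hy hy'
  meet_pass i j h s y hy hys w hw hws := by
    obtain ⟨-, f, g, -, hf, -⟩ := (Classical.epsilon_spec h).meetAt
    exact hf.pass hy hys hw hws
  land_mem i ℓ h := LandAt.mem (R.isLabel_of_label (Classical.epsilon_spec h))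
  land_mem_line i ℓ h := LandAt.mem_line (R.isLabel_of_label (Classical.epsilon_spec h))
  land_inj i j ℓ h h' hij := by
    have h1 := Classical.epsilon_spec h
    have h2 := Classical.epsilon_spec h'
    intro heq
    rw [← heq, h1] at h2
    simp only [Option.some.injEq, Prod.mk.injEq] at h2
    exact hij h2.1
  land_ne_meet i ℓ j l h h' := by
    have h1 := Classical.epsilon_spec h
    have h2 := Classical.epsilon_spec h'
    intro heq
    rw [← heq] at h2
    unfold MeetLabel at h2
    rw [h1] at h2
    simp at h2
  cut_mem i ℓ h :=
    (Classical.epsilon_spec (R.isLabel_of_label (Classical.epsilon_spec h)).exists_cut).1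
  land_not i ℓ h y := LandAt.not_reaches (R.isLabel_of_label (Classical.epsilon_spec h))
  land_pass i ℓ h s y hy hys w hw hws := by
    obtain ⟨f, g, -, hf, -⟩ := R.isLabel_of_label (Classical.epsilon_spec h)
    exact hf.pass hy hys hw hws
  cut_walk i ℓ h m m' r r' u v w h1 h2 h3 h4 h5 h6 :=
    (Classical.epsilon_spec (R.isLabel_of_label (Classical.epsilon_spec h)).exists_cut).walk
      h1 h2 h3 h4 h5 h6
  cut_approach i ℓ h m r u v :=
    LandAt.cut_approach (R.isLabel_of_label (Classical.epsilon_spec h))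
      (Classical.epsilon_spec (R.isLabel_of_label (Classical.epsilon_spec h)).exists_cut)

end Routing

/-! ### The upper bound -/

open Classical in
/-- The meetings and landings of a flow system. -/
noncomputable def FlowSystem.mergeGraph {I E : Type} [PartialOrder E] (S : FlowSystem I E) :
    MergeGraph I where
  Adj := S.Adj
  X ℓ := {i | S.Lands i ℓ}
  symm := S.adj_symm
  irrefl a h := S.adj_ne a a h rfl
  triangle a b c h h' h'' := S.no_triangle h h' h''
  full_three c a₁ a₂ a₃ hc h1 h2 h3 n1 n2 n3 h12 h13 h23 := by
    rcases FlowSystem.orient (hc true) (h1 true) n1 with t1 | t1 <;>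
      rcases FlowSystem.orient (hc true) (h2 true) n2 with t2 | t2 <;>
      rcases FlowSystem.orient (hc true) (h3 true) n3 with t3 | t3
    · exact FlowSystem.full_out_unique hc h1 h2 t1 t2 h12
    · exact FlowSystem.full_out_unique hc h1 h2 t1 t2 h12
    · exact FlowSystem.full_out_unique hc h1 h3 t1 t3 h13
    · exact FlowSystem.full_in_unique hc h2 h3 t2 t3 h23
    · exact FlowSystem.full_out_unique hc h2 h3 t2 t3 h23
    · exact FlowSystem.full_in_unique hc h1 h3 t1 t3 h13
    · exact FlowSystem.full_in_unique hc h1 h2 t1 t2 h12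
    · exact FlowSystem.full_in_unique hc h1 h2 t1 t2 h12
  full_leaf W hW hfull := by
    obtain ⟨c, hc, hmax⟩ := W.exists_maximalFor (fun c => S.land c true) hW
    -- all neighbours of the player that lands last have arrows to it
    have key : ∀ a ∈ W, S.Adj c a → S.Arrow true a c := by
      intro a ha hca
      rcases FlowSystem.orient (hfull c hc true) (hfull a ha true) hca with t | t
      · exact absurd t.lt (hmax ha t.lt.le).not_gt
      · exact t
    refine ⟨c, hc, fun a ha b hb hca hcb => ?_⟩
    by_contra hab
    exact FlowSystem.full_in_unique (hfull c hc) (hfull a ha) (hfull b hb) (key a ha hca)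
      (key b hb hcb) hab
  four_cycle ℓ a ha b hb c hc d hd := FlowSystem.no_four_cycle ha hb hc hd
  two_four ℓ u hu v hv W hcard hfull h h' := by
    obtain ⟨a, W', ha, rfl, hW'⟩ := Finset.card_eq_succ.1 hcard
    obtain ⟨b, c, d, hbc, hbd, hcd, rfl⟩ := Finset.card_eq_three.1 hW'
    simp only [Finset.mem_insert, Finset.mem_singleton, not_or] at ha
    have ad : ∀ x ∈ (insert a {b, c, d} : Finset I), S.Adj x u ∧ S.Adj x v := fun x hx =>
      ⟨S.adj_symm _ _ (h x hx), S.adj_symm _ _ (h' x hx)⟩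
    have ma := ad a (by simp)
    have mb := ad b (by simp)
    have mc := ad c (by simp)
    have md := ad d (by simp)
    exact FlowSystem.no_two_four hu hv (hfull a (by simp)) (hfull b (by simp)) (hfull c (by simp))
      (hfull d (by simp)) ma.1 mb.1 mc.1 md.1 ma.2 mb.2 mc.2 md.2 ha.1 ha.2.1 ha.2.2 hbc hbd hcd

namespace Routing

open Classical Finset

variable {I E : Type} [PartialOrder E] (R : Routing I E)

lemma label_of_merges {e : E} (h : R.Merges e) : ∃ L, R.label e = some L :=
  ⟨_, dif_pos h⟩

variable [Finite E] [Fintype I]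

/-- Every vertex that two distinct arcs enter is a meeting or a landing. -/
lemma two_mul_ncard_merges_le : 2 * {e | R.Merges e}.ncard ≤ R.flowSystem.mergeGraph.total univ := by
  set M := R.flowSystem.mergeGraph with hM
  set D : Finset (I × I) := univ.filter fun x => M.Adj x.1 x.2 with hD
  set L : Finset (I × Bool) := univ.filter fun x => x.1 ∈ M.X x.2 with hL
  set m : I × I → E := fun x => R.flowSystem.meet x.1 x.2 with hm
  set l : I × Bool → E := fun x => R.flowSystem.land x.1 x.2 with hl
  have hsub : {e | R.Merges e} ⊆ ↑(D.image m ∪ L.image l) := by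
    intro e he
    rw [coe_union, coe_image, coe_image]
    obtain ⟨⟨i, j | ℓ⟩, hlab⟩ := R.label_of_merges he
    · have h1 : R.MeetLabel i j e := Or.inl hlab
      refine Or.inl ⟨(i, j), mem_coe.2 (mem_filter.2 ⟨mem_univ _, e, h1⟩), ?_⟩
      exact (Classical.epsilon_spec (⟨e, h1⟩ : ∃ e, R.MeetLabel i j e)).meetAt.unique h1.meetAt
    · refine Or.inr ⟨(i, ℓ), mem_coe.2 (mem_filter.2 ⟨mem_univ _, e, hlab⟩), ?_⟩
      exact LandAt.unique (R.isLabel_of_label (Classical.epsilon_spec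
        (⟨e, hlab⟩ : ∃ e, R.label e = some (i, .inr ℓ)))) (R.isLabel_of_label hlab)
  have h1 : {e | R.Merges e}.ncard ≤ (D.image m).card + L.card := by
    refine (Set.ncard_le_ncard hsub (Finset.finite_toSet _)).trans ?_
    rw [Set.ncard_coe_finset]
    exact (card_union_le _ _).trans (Nat.add_le_add_left card_image_le _)
  -- a meeting of `i` and `j` is counted for `(i, j)` and for `(j, i)`
  have h2 : 2 * (D.image m).card ≤ D.card := by
    rw [card_eq_sum_card_image m D, mul_comm, ← smul_eq_mul]
    refine card_nsmul_le_sum _ _ _ fun e he => ?_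
    obtain ⟨⟨i, j⟩, hij, rfl⟩ := mem_image.1 he
    have hA : M.Adj i j := (mem_filter.1 hij).2
    have hne : i ≠ j := fun h => M.irrefl j (h ▸ hA)
    refine one_lt_card_iff.2 ⟨(i, j), (j, i), mem_filter.2 ⟨hij, rfl⟩, mem_filter.2
      ⟨mem_filter.2 ⟨mem_univ _, M.symm _ _ hA⟩, R.flowSystem.meet_comm j i⟩, ?_⟩
    intro h
    exact hne (Prod.ext_iff.1 h).1
  have h3 : D.card = ∑ i, (M.nbr univ i).card := by
    rw [hD, card_filter, ← univ_product_univ, sum_product]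
    refine sum_congr rfl fun i _ => ?_
    rw [MergeGraph.nbr, card_filter]
  have h4 : L.card = ∑ i, M.wt i := by
    rw [hL, card_filter, ← univ_product_univ, sum_product]
    refine sum_congr rfl fun i _ => ?_
    rw [Fintype.sum_bool]
    rfl
  rw [MergeGraph.total, sum_add_distrib, ← mul_sum]
  omega

lemma ncard_merges_le : {e | R.Merges e}.ncard ≤ extremalValue (Fintype.card I) := by
  have h1 := R.two_mul_ncard_merges_le
  have h2 := R.flowSystem.mergeGraph.total_le univ
  rw [card_univ] at h2
  omega

end Routing

namespace DirGraph

variable {V E : Type} (G : DirGraph V E)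

/-- The edge `f` may follow the edge `e` on a path. -/
def Follows (e f : E) : Prop := G.tgt e = G.src f

variable {G}

lemma isPath_iff {s t : V} {p : List E} : G.IsPath s t p ↔ p.IsChain G.Follows ∧
    ∃ a b, p.head? = some a ∧ p.getLast? = some b ∧ G.src a = s ∧ G.tgt b = t := by
  unfold IsPath
  constructor
  · rintro ⟨h1, h2, h3⟩
    rw [Option.map_eq_some_iff] at h2 h3
    obtain ⟨a, ha, ha'⟩ := h2
    obtain ⟨b, hb, hb'⟩ := h3
    exact ⟨h1, a, b, ha, hb, ha', hb'⟩
  · rintro ⟨h1, a, b, ha, hb, ha', hb'⟩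
    exact ⟨h1, by simp [ha, ha'], by simp [hb, hb']⟩

lemma Acyclic.not_transGen (hG : G.Acyclic) (e : E) : ¬ Relation.TransGen G.Follows e e := by
  intro h
  obtain ⟨f, hef, hfe⟩ := Relation.TransGen.tail'_iff.1 h
  obtain ⟨l, h1, h2, h3, -⟩ := (Conn.of_reflTransGen hef).exists_list
  exact hG (G.src e) l (isPath_iff.2 ⟨h1, e, f, h2, h3, rfl, hfe⟩)

/-- A path out of a vertex set uses an edge that leaves it. -/
lemma IsPath.exists_leaving {s t : V} {p : List E} (h : G.IsPath s t p) {X : Set V} (hs : s ∈ X)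
    (ht : t ∉ X) : ∃ e ∈ p, G.src e ∈ X ∧ G.tgt e ∉ X := by
  obtain ⟨hc, a, b, ha, hb, rfl, rfl⟩ := isPath_iff.1 h
  by_contra hcon
  push Not at hcon
  have := Conn.of_list hc ha hb
  have key : G.src b ∈ X := by
    refine this.induct (P := fun b => G.src b ∈ X) hs ?_
    intro x y hx hxy hy ih
    rw [← show G.tgt x = G.src y from hxy]
    exact hcon x hx.right_mem ih
  exact ht (hcon b this.right_mem key)

/-- There are at most as many disjoint paths as edges in a cut. -/
lemma IsEdgeDisjointPaths.card_le_minCut {s t : V} {P : Finset (List E)}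
    (h : G.IsEdgeDisjointPaths s t P) : (P.card : ℕ∞) ≤ G.minCut s t := by
  refine le_iInf fun X => le_iInf fun hs => le_iInf fun ht => ?_
  have hex : ∀ p ∈ P, ∃ e ∈ p, G.src e ∈ X ∧ G.tgt e ∉ X := fun p hp =>
    (h.1 p hp).exists_leaving hs ht
  rcases P.eq_empty_or_nonempty with rfl | ⟨p₀, hp₀⟩
  · simp
  have : Nonempty E := ⟨(hex p₀ hp₀).choose⟩
  choose! f hf hf' using hex
  rw [← Set.encard_coe_eq_coe_finsetCard]
  refine Set.encard_le_encard_of_injOn (f := f) (fun p hp => hf' p hp) ?_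
  intro p hp q hq hpq
  by_contra hne
  exact h.2 p hp q hq hne (hf p hp) (hpq ▸ hf q hq)

lemma minCut_le {s t : V} {X : Set V} (hs : s ∈ X) (ht : t ∉ X) :
    G.minCut s t ≤ {e | G.src e ∈ X ∧ G.tgt e ∉ X}.encard :=
  iInf_le_of_le X (iInf_le_of_le hs (iInf_le _ ht))

/-- A set of fewer edges than the min-cut is avoided by some connection. -/
lemma exists_conn_of_lt_minCut {s t : V} (hst : s ≠ t) {F : Set E} (hF : F.encard < G.minCut s t) :
    ∃ a ∈ {e | G.src e = s}, ∃ b ∈ {e | G.tgt e = t}, Conn G.Follows Fᶜ a b := by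
  by_contra hcon
  set X : Set V := {v | v = s ∨ ∃ a e, G.src a = s ∧ G.tgt e = v ∧ Conn G.Follows Fᶜ a e} with hX
  have hs : s ∈ X := Or.inl rfl
  have ht : t ∉ X := by
    rintro (h | ⟨a, e, ha, he, hc⟩)
    · exact hst h.symm
    · exact hcon ⟨a, ha, e, he, hc⟩
  refine absurd hF (not_lt_of_ge ((minCut_le hs ht).trans (Set.encard_le_encard ?_)))
  rintro e ⟨he, he'⟩
  by_contra heF
  refine he' ?_
  rcases he with he | ⟨a, f, ha, hf, hc⟩
  · exact Or.inr ⟨e, e, he, rfl, .refl heF⟩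
  · exact Or.inr ⟨a, e, ha, rfl, hc.tail hf heF⟩

lemma ne_of_minCut {s t : V} {n : ℕ} (h : G.minCut s t = n) : s ≠ t := by
  rintro rfl
  have : G.minCut s s = ⊤ := by
    unfold minCut
    simp only [iInf_eq_top]
    intro X h1 h2
    exact absurd h1 h2
  rw [this] at h
  exact ENat.top_ne_natCast n h

end DirGraph

/-- Every network has Menger's paths with at most `extremalValue k` mergings. -/
theorem Network.minMergings_le {k : ℕ}
    (G : Network (Fin.snoc (α := fun _ => ℕ) (fun _ : Fin k => 1) 2 : Fin (k + 1) → ℕ)) :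
    G.minMergings ≤ (extremalValue k : ℕ∞) := by
  classical
  have := G.finite_E
  set src : Option (Fin k) → Fin (k + 1) := fun o => o.elim (Fin.last k) Fin.castSucc with hsrc
  set A : Option (Fin k) → Set G.E := fun o => {e | G.graph.src e = G.S (src o)} with hA
  set B : Option (Fin k) → Set G.E := fun o => {e | G.graph.tgt e = G.R (src o)} with hB
  have cut1 : ∀ i : Fin k, G.graph.minCut (G.S i.castSucc) (G.R i.castSucc) = (1 : ℕ) := fun i => by
    rw [G.minCut_eq, Fin.snoc_castSucc]
  have cut2 : G.graph.minCut (G.S (Fin.last k)) (G.R (Fin.last k)) = (2 : ℕ) := by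
    rw [G.minCut_eq, Fin.snoc_last]
  have hrout : Routable A B G.graph.Follows := by
    refine ⟨fun i => ?_, ?_⟩
    · obtain ⟨a, ha, b, hb, hc⟩ := G.graph.exists_conn_of_lt_minCut (F := ∅)
        (G.graph.ne_of_minCut (cut1 i)) (by rw [cut1]; simp)
      exact ⟨a, ha, b, hb, hc.mono (Set.subset_univ _)⟩
    · have hlt : ∀ z : G.E, ({z} : Set G.E).encard <
          G.graph.minCut (G.S (Fin.last k)) (G.R (Fin.last k)) := fun z => by
        rw [cut2, Set.encard_singleton]
        norm_num
      have hne := G.graph.ne_of_minCut cut2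
      obtain ⟨a, -, -⟩ := G.graph.exists_conn_of_lt_minCut (F := ∅) hne (by rw [cut2]; simp)
      have : Nonempty G.E := ⟨a⟩
      exact exists_two_disjoint_conn _ _ _ fun z => G.graph.exists_conn_of_lt_minCut hne (hlt z)
  -- a minimal relation that admits routes; its paths are acyclic, hence it induces an order
  obtain ⟨T, hTle, hT⟩ := exists_minimal_le_of_wellFoundedLT (Routable A B) G.graph.Follows hrout
  have hacyc : ∀ e, ¬ Relation.TransGen T e e := fun e h =>
    G.acyclic.not_transGen e (Relation.TransGen.mono hTle _ _ h)
  let _ : PartialOrder G.E :=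
    { le := Relation.ReflTransGen T
      le_refl := fun _ => .refl
      le_trans := fun _ _ _ => Relation.ReflTransGen.trans
      le_antisymm := by
        intro a b hab hba
        rcases Relation.reflTransGen_iff_eq_or_transGen.1 hab with h | h
        · exact h.symm
        · exact absurd (h.trans_left hba) (hacyc a) }
  have hlist : ∀ o (s : Set G.E), (∃ a ∈ A o, ∃ b ∈ B o, Conn T s a b) → ∃ l : List G.E,
      l.IsChain T ∧ (∃ a ∈ A o, l.head? = some a) ∧ (∃ b ∈ B o, l.getLast? = some b) ∧
        ∀ x ∈ l, x ∈ s := by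
    rintro o s ⟨a, ha, b, hb, hc⟩
    obtain ⟨l, h1, h2, h3, h4⟩ := hc.exists_list
    exact ⟨l, h1, ⟨a, ha, h2⟩, ⟨b, hb, h3⟩, h4⟩
  obtain ⟨hT1, s, t, hst, hs, ht⟩ := hT.prop
  choose p hp1 hp2 hp3 hp4 using fun i => hlist (some i) _ (hT1 i)
  obtain ⟨q, hq1, hq2, hq3, hq4⟩ := hlist none _ hs
  obtain ⟨q', hq1', hq2', hq3', hq4'⟩ := hlist none _ ht
  have hqq : List.Disjoint q q' := fun x hx hx' =>
    Set.disjoint_left.1 hst (hq4 x hx) (hq4' x hx')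
  let R : Routing (Fin k) G.E :=
    { T := T
      le_iff := fun _ _ => Iff.rfl
      irrefl := fun x h => hacyc x (.single h)
      A := A
      B := B
      path := Sum.elim p fun ℓ => if ℓ then q else q'
      chain := by rintro (i | _ | _) <;> simp [hp1, hq1, hq1']
      head := by
        rintro (i | _ | _)
        · exact hp2 i
        · exact hq2'
        · exact hq2
      last := by
        rintro (i | _ | _)
        · exact hp3 i
        · exact hq3'
        · exact hq3
      disj := by
        rintro (_ | _) x h h'
        · exact hqq (by simpa using h') (by simpa using h)
        · exact hqq (by simpa using h) (by simpa using h')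
      minimal := fun T' hle hr => hT.le_of_le hr hle }
  have hpath : ∀ c, G.graph.IsPath (G.S (src (commodity c))) (G.R (src (commodity c)))
      (R.path c) := by
    intro c
    obtain ⟨a, ha, ha'⟩ := R.head c
    obtain ⟨b, hb, hb'⟩ := R.last c
    exact DirGraph.isPath_iff.2 ⟨(R.chain c).imp fun x y h => hTle x y h, a, b, ha', hb', ha, hb⟩
  have hne : q ≠ q' := by
    rintro rfl
    obtain ⟨a, -, ha⟩ := hq2
    exact hqq (List.mem_of_mem_head? ha) (List.mem_of_mem_head? ha)
  set α : Fin (k + 1) → Finset (List G.E) :=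
    Fin.snoc (α := fun _ => Finset (List G.E)) (fun i => {p i}) {q, q'} with hα
  have hα1 : ∀ i : Fin k, α i.castSucc = {p i} := fun i => by rw [hα, Fin.snoc_castSucc]
  have hα2 : α (Fin.last k) = {q, q'} := by rw [hα, Fin.snoc_last]
  have hmenger : ∀ i, G.graph.IsMengerPaths (G.S i) (G.R i) (α i) := by
    intro i
    induction i using Fin.lastCases with
    | last =>
      rw [hα2]
      refine ⟨⟨?_, ?_⟩, fun Q hQ => ?_⟩
      · intro r hr
        simp only [Finset.mem_insert, Finset.mem_singleton] at hr
        rcases hr with rfl | rfl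
        · exact hpath (.inr true)
        · exact hpath (.inr false)
      · intro r hr r' hr' hne'
        simp only [Finset.mem_insert, Finset.mem_singleton] at hr hr'
        rcases hr with rfl | rfl <;> rcases hr' with rfl | rfl
        · exact absurd rfl hne'
        · exact hqq
        · exact hqq.symm
        · exact absurd rfl hne'
      · have := hQ.card_le_minCut
        rw [cut2] at this
        rw [Finset.card_pair hne]
        exact_mod_cast this
    | cast i =>
      rw [hα1]
      refine ⟨⟨?_, ?_⟩, fun Q hQ => ?_⟩
      · intro r hr
        rw [Finset.mem_singleton] at hr
        subst hr
        exact hpath (.inl i)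
      · intro r hr r' hr' hne'
        rw [Finset.mem_singleton] at hr hr'
        exact absurd (hr.trans hr'.symm) hne'
      · have := hQ.card_le_minCut
        rw [cut1] at this
        rw [Finset.card_singleton]
        exact_mod_cast this
  have hmem : ∀ i, ∀ r ∈ α i, ∃ c, r = R.path c := by
    intro i
    induction i using Fin.lastCases with
    | last =>
      rw [hα2]
      intro r hr
      simp only [Finset.mem_insert, Finset.mem_singleton] at hr
      rcases hr with rfl | rfl
      · exact ⟨.inr true, rfl⟩
      · exact ⟨.inr false, rfl⟩
    | cast i =>
      rw [hα1]
      intro r hr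
      rw [Finset.mem_singleton] at hr
      exact ⟨.inl i, hr⟩
  refine (iInf_le_of_le α (iInf_le _ hmenger)).trans ?_
  -- a merging is entered by two distinct arcs of `T`
  have hsub : {e | IsMergingEdge α e} ⊆ {e | R.Merges e} := by
    rintro e ⟨i, j, -, r, hr, r', hr', f, g, hfg, h1, h2⟩
    obtain ⟨c, rfl⟩ := hmem i r hr
    obtain ⟨c', rfl⟩ := hmem j r' hr'
    exact ⟨f, g, hfg, R.arc_of_infix h1, R.arc_of_infix h2⟩
  unfold numMergings
  refine (Set.encard_le_encard hsub).trans ?_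
  rw [← (Set.toFinite _).cast_ncard_eq]
  have := R.ncard_merges_le
  rw [Fintype.card_fin] at this
  exact_mod_cast this

/-! ### Networks from timetables -/

/-- Two lines are identified at time `t`. -/
def SameLine (Ev : ℕ → ℕ → ℕ → Prop) (t l m : ℕ) : Prop := l = m ∨ Ev t l m ∨ Ev t m l

lemma SameLine.symm {Ev : ℕ → ℕ → ℕ → Prop} {t l m : ℕ} (h : SameLine Ev t l m) :
    SameLine Ev t m l := by
  rcases h with rfl | h | h
  · exact Or.inl rfl
  · exact Or.inr (Or.inr h)
  · exact Or.inr (Or.inl h)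

/-- A timetable for `k` players, the lines `0, …, k - 1`, and the two lines `k` and `k + 1` of the
last commodity: `Ev t x y` says that the lines `x < y` run together for a moment at time `t`.

`Know i t l` is a superset of the lines `l` on which a route of the player `i` may be at time `t`.
The colours `col t l` bound the pairs of lines on which two disjoint routes of the last commodity
may be at time `t`: neither line has colour `0`, and they do not share one of the colours `1` and
`2`. Other colours impose no restriction. -/
structure Timetable (k : ℕ) where
  /-- The end of time. -/
  T : ℕ
  Ev : ℕ → ℕ → ℕ → Prop
  Know : ℕ → ℕ → ℕ → Prop
  col : ℕ → ℕ → ℕ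
  ev_lt : ∀ t x y, Ev t x y → x < k ∧ x < y ∧ y < k + 2 ∧ t < T
  matching : ∀ t x y x' y', Ev t x y → Ev t x' y' → (x = x' ∨ x = y' ∨ y = x' ∨ y = y') →
    x = x' ∧ y = y'
  know_self : ∀ i t, Know i t i
  know_mono : ∀ i t l, i < k → Know i t l → Know i (t + 1) l
  know_step : ∀ i t x y, i < k → Ev t x y → (Know i t x → Know i (t + 1) y) ∧
    (Know i t y → Know i (t + 1) x)
  /-- When a player runs together with a line, none of its routes may be there already. -/
  know_avoid : ∀ t x y, Ev t x y → ¬ Know x t y ∧ (y < k → ¬ Know y t x)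
  col_start : col 0 k = 1 ∧ col 0 (k + 1) = 2
  col_ne_zero : ∀ t l m, t < T → SameLine Ev t l m → col t l ≠ 0 → col (t + 1) m ≠ 0
  /-- If a route passes from a line with a colour different from `0` and `c` to a line with colour
  `c`, then all lines that have colour `c` afterwards are identified with it at that moment. -/
  col_live : ∀ t l m m' c, t < T → (c = 1 ∨ c = 2) → SameLine Ev t l m → col t l ≠ 0 →
    col t l ≠ c → m' < k + 2 → col (t + 1) m = c → col (t + 1) m' = c → SameLine Ev t m' m
  /-- When the line `k` runs together with `x`, a route on the line `k + 1` excludes a route on `x`.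
  -/
  col_first : ∀ t x, Ev t x k → col t (k + 1) = 2 ∧ (col t x = 0 ∨ col t x = 2)
  /-- When the line `k + 1` runs together with `x`, a route on the line `k` excludes a route on `x`.
  -/
  col_second : ∀ t x, Ev t x (k + 1) → col t k = 1 ∧ (col t x = 0 ∨ col t x = 1)
  not_both : ∀ t x y, Ev t x k → ¬ Ev t y (k + 1)

namespace Timetable

/-- The edges from which the network is made: the line `l` at time `t`, and the common edge of the
lines that are represented by `r` at time `t`. -/
inductive Edge
  | seg (l t : ℕ)
  | run (r t : ℕ)

/-- The vertices of the network: sources, sinks and the ends of the common edges. -/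
inductive Vert
  | source (i : ℕ)
  | entry (r t : ℕ)
  | exit (r t : ℕ)
  | sink (i : ℕ)

variable {k : ℕ} (S : Timetable k)

open Classical in
/-- The smaller one of the lines that are identified with `l` at time `t`. -/
noncomputable def rep (t l : ℕ) : ℕ := if h : ∃ x, S.Ev t x l then h.choose else l

variable {S}

lemma rep_of_ev {t x y : ℕ} (h : S.Ev t x y) : S.rep t x = x ∧ S.rep t y = x := by
  have hx : ¬ ∃ z, S.Ev t z x := by
    rintro ⟨z, hz⟩
    have := S.matching t z x x y hz h (by simp)
    have := (S.ev_lt _ _ _ h).2.1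
    omega
  have hy : ∃ z, S.Ev t z y := ⟨x, h⟩
  constructor
  · rw [rep, dif_neg hx]
  · rw [rep, dif_pos hy]
    exact (S.matching t _ _ _ _ hy.choose_spec h (by simp)).1

lemma rep_eq_iff {t l m : ℕ} : S.rep t l = S.rep t m ↔ SameLine S.Ev t l m := by
  constructor
  · intro h
    by_cases hl : ∃ x, S.Ev t x l
    · obtain ⟨x, hx⟩ := hl
      rw [(rep_of_ev hx).2] at h
      by_cases hm : ∃ y, S.Ev t y m
      · obtain ⟨y, hy⟩ := hm
        rw [(rep_of_ev hy).2] at h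
        subst h
        exact Or.inl (S.matching t _ _ _ _ hx hy (by simp)).2
      · rw [rep, dif_neg hm] at h
        subst h
        exact Or.inr (Or.inr hx)
    · rw [rep, dif_neg hl] at h
      by_cases hm : ∃ y, S.Ev t y m
      · obtain ⟨y, hy⟩ := hm
        rw [(rep_of_ev hy).2] at h
        subst h
        exact Or.inr (Or.inl hy)
      · rw [rep, dif_neg hm] at h
        exact Or.inl h
  · rintro (rfl | h | h)
    · rfl
    · rw [(rep_of_ev h).1, (rep_of_ev h).2]
    · rw [(rep_of_ev h).1, (rep_of_ev h).2]

lemma rep_lt {t l : ℕ} (h : l < k + 2) : S.rep t l < k + 2 := by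
  by_cases hl : ∃ x, S.Ev t x l
  · obtain ⟨x, hx⟩ := hl
    rw [(rep_of_ev hx).2]
    have := S.ev_lt _ _ _ hx
    omega
  · rwa [rep, dif_neg hl]

variable (S)

/-- The start of an edge; the lines `k` and `k + 1` start at the same source. -/
noncomputable def src : Edge → Vert
  | .seg l 0 => .source (min l k)
  | .seg l (t + 1) => .exit (S.rep t l) t
  | .run r t => .entry r t

/-- The end of an edge; the lines end at time `T`. -/
noncomputable def tgt : Edge → Vert
  | .seg l t => if t = S.T then .sink (min l k) else .entry (S.rep t l) t
  | .run r t => .exit r t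

/-- The edges of the network form a finite set. -/
def Valid : Edge → Prop
  | .seg l t => l < k + 2 ∧ t ≤ S.T
  | .run r t => r < k + 2 ∧ t ≤ S.T

/-- The level of a vertex increases along edges. -/
def level : Vert → ℕ
  | .source _ => 0
  | .entry _ t => 2 * t + 1
  | .exit _ t => 2 * t + 2
  | .sink _ => 2 * S.T + 1

lemma level_lt (e : Edge) : S.level (S.src e) < S.level (S.tgt e) := by
  rcases e with ⟨l, _ | t⟩ | ⟨r, t⟩
  · simp only [src, tgt]
    split_ifs <;> simp [level]
  · simp only [src, tgt]
    split_ifs with h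
    · simp only [level]
      omega
    · simp only [level]
      omega
  · simp [src, tgt, level]

/-- The part of the line `l` from time `t` on, over `n` time steps. -/
noncomputable def line (l : ℕ) : ℕ → ℕ → List Edge
  | t, 0 => [.seg l t]
  | t, n + 1 => .seg l t :: .run (S.rep t l) t :: line l (t + 1) n

/-- The edge `f` may follow the edge `e`. -/
def Next (e f : Edge) : Prop := S.tgt e = S.src f

lemma line_eq_cons (l t n : ℕ) : ∃ p, S.line l t n = .seg l t :: p := by
  cases n <;> exact ⟨_, rfl⟩

lemma line_last (l t n : ℕ) : (S.line l t n).getLast? = some (.seg l (t + n)) := by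
  induction n generalizing t with
  | zero => rfl
  | succ n ih =>
    obtain ⟨p, hp⟩ := S.line_eq_cons l (t + 1) n
    have := ih (t + 1)
    rw [line, hp, List.getLast?_cons_cons, List.getLast?_cons_cons, ← hp, this]
    congr 2
    omega

lemma line_isChain (l t n : ℕ) (h : t + n = S.T) : (S.line l t n).IsChain S.Next := by
  induction n generalizing t with
  | zero => simp [line]
  | succ n ih =>
    obtain ⟨p, hp⟩ := S.line_eq_cons l (t + 1) n
    have := ih (t + 1) (by omega)
    rw [hp] at this
    rw [line, hp, List.isChain_cons_cons, List.isChain_cons_cons]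
    refine ⟨?_, ?_, this⟩
    · simp only [Next, tgt, src]
      rw [if_neg (by omega)]
    · simp only [Next, tgt, src]

lemma line_valid (l t n : ℕ) (hl : l < k + 2) (h : t + n = S.T) :
    ∀ e ∈ S.line l t n, S.Valid e := by
  induction n generalizing t with
  | zero =>
    intro e he
    rw [line, List.mem_singleton] at he
    subst he
    exact ⟨hl, by omega⟩
  | succ n ih =>
    intro e he
    rw [line, List.mem_cons, List.mem_cons] at he
    rcases he with rfl | rfl | he
    · exact ⟨hl, by omega⟩
    · exact ⟨rep_lt hl, by omega⟩
    · exact ih (t + 1) (by omega) e he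

lemma line_time (l t n : ℕ) : ∀ e ∈ S.line l t n, ∀ r s, (e = .seg r s → r = l ∧ t ≤ s) ∧
    (e = .run r s → r = S.rep s l ∧ t ≤ s) := by
  induction n generalizing t with
  | zero =>
    intro e he r s
    rw [line, List.mem_singleton] at he
    subst he
    constructor
    · intro h
      injection h with h1 h2
      exact ⟨h1.symm, h2.le⟩
    · intro h
      cases h
  | succ n ih =>
    intro e he r s
    rw [line, List.mem_cons, List.mem_cons] at he
    rcases he with rfl | rfl | he
    · constructor
      · intro h
        injection h with h1 h2
        exact ⟨h1.symm, h2.le⟩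
      · intro h
        cases h
    · constructor
      · intro h
        cases h
      · intro h
        injection h with h1 h2
        subst h2
        exact ⟨h1.symm, le_rfl⟩
    · obtain ⟨h1, h2⟩ := ih (t + 1) e he r s
      exact ⟨fun h => ⟨(h1 h).1, by have := (h1 h).2; omega⟩,
        fun h => ⟨(h2 h).1, by have := (h2 h).2; omega⟩⟩

lemma line_infix (l t n s : ℕ) (h1 : t ≤ s) (h2 : s < t + n) :
    [.seg l s, .run (S.rep s l) s] <:+: S.line l t n := by
  induction n generalizing t with
  | zero => omega
  | succ n ih =>
    rw [line]
    rcases h1.eq_or_lt with rfl | h1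
    · exact ⟨[], _, rfl⟩
    · exact (ih (t + 1) (by omega) (by omega)).trans
        ((List.suffix_cons _ _).trans (List.suffix_cons _ _)).isInfix

variable {S}

/-- How a path to a sink goes on. -/
lemma path_cases {l t i : ℕ} {p : List Edge} (hc : (Edge.seg l t :: p).IsChain S.Next)
    (hl : (Edge.seg l t :: p).getLast?.map S.tgt = some (.sink i)) :
    (t = S.T ∧ p = [] ∧ min l k = i) ∨ (t ≠ S.T ∧ ∃ l' p', p = .run (S.rep t l) t ::
      .seg l' (t + 1) :: p' ∧ SameLine S.Ev t l l') := by
  by_cases ht : t = S.T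
  · left
    refine ⟨ht, ?_⟩
    rcases p with _ | ⟨e, p⟩
    · simp only [List.getLast?_singleton, Option.map_some, tgt, if_pos ht, Option.some.injEq,
        Vert.sink.injEq] at hl
      exact ⟨rfl, hl⟩
    · exfalso
      have := (List.isChain_cons_cons.1 hc).1
      rw [Next, tgt, if_pos ht] at this
      rcases e with ⟨l', _ | t'⟩ | ⟨r, t'⟩ <;> simp [src] at this
  · right
    refine ⟨ht, ?_⟩
    rcases p with _ | ⟨e, p⟩
    · simp [tgt, if_neg ht] at hl
    obtain ⟨h1, hc⟩ := List.isChain_cons_cons.1 hc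
    rw [Next, tgt, if_neg ht] at h1
    rcases e with ⟨l', _ | t'⟩ | ⟨r, t'⟩
    · simp [src] at h1
    · simp [src] at h1
    simp only [src, Vert.entry.injEq] at h1
    obtain ⟨rfl, rfl⟩ := h1
    rcases p with _ | ⟨e, p⟩
    · simp [tgt] at hl
    obtain ⟨h1, hc⟩ := List.isChain_cons_cons.1 hc
    rw [Next, tgt] at h1
    rcases e with ⟨l', _ | t'⟩ | ⟨r, t'⟩
    · simp [src] at h1
    · simp only [src, Vert.exit.injEq] at h1
      obtain ⟨h1, rfl⟩ := h1
      exact ⟨l', p, rfl, rep_eq_iff.1 h1⟩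
    · simp [src] at h1

/-- The only route of a player is its line: `Know` is a superset of the lines that a route may have
come to, and it does not contain the lines from which the player could return. -/
lemma eq_line {i : ℕ} (hi : i < k) (n : ℕ) : ∀ (t l : ℕ) (p : List Edge), t + n = S.T →
    (Edge.seg l t :: p).IsChain S.Next →
    (Edge.seg l t :: p).getLast?.map S.tgt = some (.sink i) → l < k + 2 →
    (∀ e ∈ p, S.Valid e) → S.Know i t l → l = i ∧ Edge.seg l t :: p = S.line i t n := by
  induction n with
  | zero =>
    intro t l p ht hc hl hlk hv hK
    rcases path_cases hc hl with ⟨-, rfl, h⟩ | ⟨h, -⟩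
    · obtain rfl : l = i := by omega
      exact ⟨rfl, rfl⟩
    · exact absurd (by omega) h
  | succ n ih =>
    intro t l p ht hc hl hlk hv hK
    rcases path_cases hc hl with ⟨h, -⟩ | ⟨-, l', p, rfl, hs⟩
    · omega
    obtain ⟨-, hc⟩ := List.isChain_cons_cons.1 hc
    obtain ⟨-, hc⟩ := List.isChain_cons_cons.1 hc
    rw [List.getLast?_cons_cons, List.getLast?_cons_cons] at hl
    have hK' : S.Know i (t + 1) l' := by
      rcases hs with rfl | h | h
      · exact S.know_mono i t l hi hK
      · exact (S.know_step i t l l' hi h).1 hK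
      · exact (S.know_step i t l' l hi h).2 hK
    obtain ⟨rfl, h2⟩ := ih (t + 1) l' p (by omega) hc hl
      (show S.Valid (.seg l' (t + 1)) from hv _ (by simp)).1
      (fun e he => hv e (by simp [he])) hK'
    have hll : l = l' := by
      rcases hs with rfl | h | h
      · rfl
      · exact absurd hK ((S.know_avoid t l l' h).2 hi)
      · exact absurd hK (S.know_avoid t l' l h).1
    subst hll
    exact ⟨rfl, by rw [h2]; rfl⟩

/-- Two disjoint routes of the last commodity may be on the lines `l` and `m` at time `t`. -/
def Ok (S : Timetable k) (t l m : ℕ) : Prop :=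
  l ≠ m ∧ S.col t l ≠ 0 ∧ S.col t m ≠ 0 ∧ ∀ c, (c = 1 ∨ c = 2) → S.col t l = c → S.col t m ≠ c

lemma Ok.symm {t l m : ℕ} (h : S.Ok t l m) : S.Ok t m l :=
  ⟨h.1.symm, h.2.2.1, h.2.1, fun c hc h1 h2 => h.2.2.2 c hc h2 h1⟩

lemma sameLine_trans {t l m n : ℕ} (h : SameLine S.Ev t l m) (h' : SameLine S.Ev t m n) :
    SameLine S.Ev t l n :=
  rep_eq_iff.1 ((rep_eq_iff.2 h).trans (rep_eq_iff.2 h'))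

lemma Ok.step {t l l' m m' : ℕ} (h : S.Ok t l l') (ht : t < S.T) (hm : m < k + 2)
    (hm' : m' < k + 2) (hlm : SameLine S.Ev t l m) (hlm' : SameLine S.Ev t l' m')
    (hne : ¬ SameLine S.Ev t l l') : S.Ok (t + 1) m m' := by
  have hmm : ¬ SameLine S.Ev t m m' := fun h' =>
    hne (sameLine_trans (sameLine_trans hlm h') (SameLine.symm hlm'))
  refine ⟨fun e => hmm (Or.inl e), S.col_ne_zero t l m ht hlm h.2.1,
    S.col_ne_zero t l' m' ht hlm' h.2.2.1, fun c hc h1 h2 => ?_⟩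
  by_cases hl : S.col t l = c
  · have hl' := h.2.2.2 c hc hl
    exact hmm (S.col_live t l' m' m c ht hc hlm' h.2.2.1 hl' hm h2 h1)
  · exact hmm (SameLine.symm (S.col_live t l m m' c ht hc hlm h.2.1 hl hm' h1 h2))

/-- Disjoint routes that end on the lines of the last commodity stay there. -/
lemma Ok.back {t l l' : ℕ} (h : S.Ok t l l') (h1 : SameLine S.Ev t l k)
    (h2 : SameLine S.Ev t l' (k + 1)) : l = k ∧ l' = k + 1 := by
  have e1 : ∀ x, ¬ S.Ev t k x := fun x hx => by have := S.ev_lt _ _ _ hx; omega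
  have e2 : ∀ x, ¬ S.Ev t (k + 1) x := fun x hx => by have := S.ev_lt _ _ _ hx; omega
  rcases h1 with rfl | h1 | h1
  · rcases h2 with rfl | h2 | h2
    · exact ⟨rfl, rfl⟩
    · obtain ⟨c1, c2 | c2⟩ := S.col_second t l' h2
      · exact absurd c2 h.2.2.1
      · exact absurd c2 (h.2.2.2 1 (by simp) c1)
    · exact absurd h2 (e2 _)
  · obtain ⟨c1, c2⟩ := S.col_first t l h1
    rcases h2 with rfl | h2 | h2
    · rcases c2 with c2 | c2
      · exact absurd c2 h.2.1
      · exact absurd c1 (h.2.2.2 2 (by simp) c2)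
    · exact absurd h2 (S.not_both t l l' h1)
    · exact absurd h2 (e2 _)
  · exact absurd h1 (e1 _)

/-- The only pair of disjoint routes of the last commodity are its two lines. -/
lemma eq_lines (n : ℕ) : ∀ (t l l' : ℕ) (p p' : List Edge), t + n = S.T →
    (Edge.seg l t :: p).IsChain S.Next → (Edge.seg l' t :: p').IsChain S.Next →
    (Edge.seg l t :: p).getLast?.map S.tgt = some (.sink k) →
    (Edge.seg l' t :: p').getLast?.map S.tgt = some (.sink k) → l < k + 2 → l' < k + 2 →
    (∀ e ∈ p, S.Valid e) → (∀ e ∈ p', S.Valid e) → List.Disjoint p p' → S.Ok t l l' →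
    (l = k ∧ l' = k + 1 ∧ Edge.seg l t :: p = S.line k t n ∧
      Edge.seg l' t :: p' = S.line (k + 1) t n) ∨
    (l' = k ∧ l = k + 1 ∧ Edge.seg l' t :: p' = S.line k t n ∧
      Edge.seg l t :: p = S.line (k + 1) t n) := by
  induction n with
  | zero =>
    intro t l l' p p' ht hc hc' hl hl' hlk hlk' hv hv' hd hok
    rcases path_cases hc hl with ⟨-, rfl, h⟩ | ⟨h, -⟩
    · rcases path_cases hc' hl' with ⟨-, rfl, h'⟩ | ⟨h, -⟩
      · have hne := hok.1
        rcases (show (l = k ∧ l' = k + 1) ∨ (l' = k ∧ l = k + 1) by omega) with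
          ⟨rfl, rfl⟩ | ⟨rfl, rfl⟩
        · exact Or.inl ⟨rfl, rfl, rfl, rfl⟩
        · exact Or.inr ⟨rfl, rfl, rfl, rfl⟩
      · exact absurd (by omega) h
    · exact absurd (by omega) h
  | succ n ih =>
    intro t l l' p p' ht hc hc' hl hl' hlk hlk' hv hv' hd hok
    rcases path_cases hc hl with ⟨h, -⟩ | ⟨-, m, p, rfl, hs⟩
    · omega
    rcases path_cases hc' hl' with ⟨h, -⟩ | ⟨-, m', p', rfl, hs'⟩
    · omega
    obtain ⟨-, hc⟩ := List.isChain_cons_cons.1 hc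
    obtain ⟨-, hc⟩ := List.isChain_cons_cons.1 hc
    obtain ⟨-, hc'⟩ := List.isChain_cons_cons.1 hc'
    obtain ⟨-, hc'⟩ := List.isChain_cons_cons.1 hc'
    rw [List.getLast?_cons_cons, List.getLast?_cons_cons] at hl hl'
    have hmk : m < k + 2 := (show S.Valid (.seg m (t + 1)) from hv _ (by simp)).1
    have hmk' : m' < k + 2 := (show S.Valid (.seg m' (t + 1)) from hv' _ (by simp)).1
    have hne : ¬ SameLine S.Ev t l l' := by
      intro h
      refine hd (a := .run (S.rep t l) t) (by simp) ?_
      rw [rep_eq_iff.2 h]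
      simp
    have hok' := hok.step (by omega) hmk hmk' hs hs' hne
    have hd' : List.Disjoint p p' := fun e he he' => hd (a := e) (by simp [he]) (by simp [he'])
    rcases ih (t + 1) m m' p p' (by omega) hc hc' hl hl' hmk hmk'
      (fun e he => hv e (by simp [he])) (fun e he => hv' e (by simp [he])) hd' hok' with
      ⟨rfl, rfl, h1, h2⟩ | ⟨rfl, rfl, h1, h2⟩
    · obtain ⟨rfl, rfl⟩ := hok.back hs hs'
      exact Or.inl ⟨rfl, rfl, by rw [h1]; rfl, by rw [h2]; rfl⟩
    · obtain ⟨rfl, rfl⟩ := hok.symm.back hs' hs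
      exact Or.inr ⟨rfl, rfl, by rw [h1]; rfl, by rw [h2]; rfl⟩

variable (S)

/-- The edges of the network of a timetable. -/
abbrev NetEdge : Type := {e : Edge // S.Valid e}

/-- The ends of the edges of the network of a timetable. -/
abbrev NetVert : Type := {v : Vert // ∃ e, S.Valid e ∧ (S.src e = v ∨ S.tgt e = v)}

lemma finite_netEdge : Finite S.NetEdge := by
  have h : {e | S.Valid e} ⊆
      (fun x : ℕ × ℕ => Edge.seg x.1 x.2) '' (Set.Iio (k + 2) ×ˢ Set.Iic S.T) ∪
      (fun x : ℕ × ℕ => Edge.run x.1 x.2) '' (Set.Iio (k + 2) ×ˢ Set.Iic S.T) := by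
    rintro (⟨l, t⟩ | ⟨l, t⟩) h
    · exact Or.inl ⟨(l, t), ⟨h.1, h.2⟩, rfl⟩
    · exact Or.inr ⟨(l, t), ⟨h.1, h.2⟩, rfl⟩
  have hf := (Set.finite_Iio (k + 2)).prod (Set.finite_Iic S.T)
  exact (((hf.image _).union (hf.image _)).subset h).to_subtype

lemma finite_netVert : Finite S.NetVert := by
  have := S.finite_netEdge
  refine Finite.of_surjective (α := S.NetEdge × Bool)
    (fun x => (if x.2 then ⟨S.src x.1.1, x.1.1, x.1.2, Or.inl rfl⟩
      else ⟨S.tgt x.1.1, x.1.1, x.1.2, Or.inr rfl⟩ : S.NetVert)) ?_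
  rintro ⟨v, e, he, rfl | rfl⟩
  · exact ⟨(⟨e, he⟩, true), rfl⟩
  · exact ⟨(⟨e, he⟩, false), rfl⟩

/-- The graph of a timetable. -/
noncomputable def graph : DirGraph S.NetVert S.NetEdge where
  src e := ⟨S.src e.1, e.1, e.2, Or.inl rfl⟩
  tgt e := ⟨S.tgt e.1, e.1, e.2, Or.inr rfl⟩

lemma graph_isPath_iff {u v : S.NetVert} {p : List S.NetEdge} :
    S.graph.IsPath u v p ↔ (p.map Subtype.val).IsChain S.Next ∧
      (p.map Subtype.val).head?.map S.src = some u.1 ∧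
      (p.map Subtype.val).getLast?.map S.tgt = some v.1 := by
  have hs : ∀ e : S.NetEdge, ∀ w : S.NetVert, S.graph.src e = w ↔ S.src e.1 = w.1 := fun e w =>
    Subtype.ext_iff
  have ht : ∀ e : S.NetEdge, ∀ w : S.NetVert, S.graph.tgt e = w ↔ S.tgt e.1 = w.1 := fun e w =>
    Subtype.ext_iff
  unfold DirGraph.IsPath
  rw [List.isChain_map, List.head?_map, List.getLast?_map, Option.map_map, Option.map_map]
  refine and_congr ?_ (and_congr ?_ ?_)
  · exact Iff.of_eq (congrArg (fun r => List.IsChain r p) (by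
      funext e f
      exact propext (ht e _)))
  · rw [Option.map_eq_some_iff, Option.map_eq_some_iff]
    exact exists_congr fun e => and_congr_right fun _ => hs e _
  · rw [Option.map_eq_some_iff, Option.map_eq_some_iff]
    exact exists_congr fun e => and_congr_right fun _ => ht e _

lemma graph_acyclic : S.graph.Acyclic := by
  intro v p hp
  obtain ⟨hc, a, b, ha, hb, rfl, hab⟩ := DirGraph.isPath_iff.1 hp
  have h : S.level (S.graph.src a).1 < S.level (S.graph.tgt b).1 := by
    refine (Conn.of_list hc ha hb).induct
      (P := fun b => S.level (S.graph.src a).1 < S.level (S.graph.tgt b).1) (S.level_lt a.1) ?_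
    intro x y _ hxy _ ih
    refine ih.trans ?_
    rw [show S.graph.tgt x = S.graph.src y from hxy]
    exact S.level_lt y.1
  rw [hab] at h
  exact lt_irrefl _ h

/-- The source of the commodity `i`. -/
noncomputable def source (i : Fin (k + 1)) : S.NetVert :=
  ⟨.source i, .seg i 0, ⟨by omega, Nat.zero_le _⟩, Or.inl (by
    simp only [src]
    congr 1
    omega)⟩

/-- The sink of the commodity `i`. -/
noncomputable def target (i : Fin (k + 1)) : S.NetVert :=
  ⟨.sink i, .seg i S.T, ⟨by omega, le_rfl⟩, Or.inr (by
    simp only [tgt, if_true]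
    congr 1
    omega)⟩

/-- Every line is a path of the network. -/
lemma exists_netLine {l : ℕ} (hl : l < k + 2) :
    ∃ p : List S.NetEdge, p.map Subtype.val = S.line l 0 S.T ∧
      ∀ i : Fin (k + 1), (i : ℕ) = min l k → S.graph.IsPath (S.source i) (S.target i) p := by
  have hv := S.line_valid l 0 S.T hl (by omega)
  obtain ⟨p, hp⟩ : ∃ p : List S.NetEdge, p.map Subtype.val = S.line l 0 S.T :=
    ⟨(S.line l 0 S.T).attach.map fun e => ⟨e.1, hv e.1 e.2⟩, by simp [Function.comp_def]⟩
  refine ⟨p, hp, fun i hi => S.graph_isPath_iff.2 ?_⟩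
  rw [hp]
  refine ⟨S.line_isChain l 0 S.T (by omega), ?_, ?_⟩
  · obtain ⟨q, hq⟩ := S.line_eq_cons l 0 S.T
    rw [hq]
    simp [src, source, hi]
  · rw [S.line_last]
    simp [tgt, target, hi]

lemma line_disjoint {l m : ℕ} (h : ∀ t, ¬ SameLine S.Ev t l m) (n : ℕ) :
    List.Disjoint (S.line l 0 n) (S.line m 0 n) := by
  intro e he he'
  rcases e with ⟨r, t⟩ | ⟨r, t⟩
  · have h1 := ((S.line_time l 0 n _ he r t).1 rfl).1
    have h2 := ((S.line_time m 0 n _ he' r t).1 rfl).1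
    exact h 0 (Or.inl (h1.symm.trans h2))
  · have h1 := ((S.line_time l 0 n _ he r t).2 rfl).1
    have h2 := ((S.line_time m 0 n _ he' r t).2 rfl).1
    exact h t (rep_eq_iff.1 (h1.symm.trans h2))

lemma not_sameLine (t : ℕ) : ¬ SameLine S.Ev t k (k + 1) := by
  rintro (h | h | h)
  · omega
  · have := S.ev_lt _ _ _ h
    omega
  · have := S.ev_lt _ _ _ h
    omega

lemma disjoint_of_map {p q : List S.NetEdge}
    (h : List.Disjoint (p.map Subtype.val) (q.map Subtype.val)) : List.Disjoint p q :=
  fun _ he he' => h (List.mem_map_of_mem he) (List.mem_map_of_mem he')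

lemma map_disjoint {p q : List S.NetEdge} (h : List.Disjoint p q) :
    List.Disjoint (p.map Subtype.val) (q.map Subtype.val) := by
  intro e he he'
  obtain ⟨a, ha, rfl⟩ := List.mem_map.1 he
  obtain ⟨b, hb, hab⟩ := List.mem_map.1 he'
  obtain rfl := Subtype.ext hab
  exact h ha hb

/-- The number of lines of a commodity: one for each of the `k` players, two for the last one. -/
def demand (k : ℕ) : Fin (k + 1) → ℕ := Fin.snoc (α := fun _ => ℕ) (fun _ : Fin k => 1) 2

lemma exists_disjoint_lines (i : Fin (k + 1)) : ∃ P : Finset (List S.NetEdge),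
    S.graph.IsEdgeDisjointPaths (S.source i) (S.target i) P ∧ P.card = demand k i := by
  classical
  induction i using Fin.lastCases with
  | last =>
    obtain ⟨p, hp, hp'⟩ := S.exists_netLine (l := k) (by omega)
    obtain ⟨q, hq, hq'⟩ := S.exists_netLine (l := k + 1) (by omega)
    have hd : List.Disjoint p q := S.disjoint_of_map (by
      rw [hp, hq]
      exact S.line_disjoint S.not_sameLine _)
    have hne : p ≠ q := by
      rintro rfl
      obtain ⟨r, hr⟩ := S.line_eq_cons k 0 S.T
      rcases p with _ | ⟨e, p⟩
      · rw [hr] at hp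
        simp at hp
      · exact hd (a := e) (by simp) (by simp)
    have h1 := hp' (Fin.last k) (by simp)
    have h2 := hq' (Fin.last k) (by simp)
    refine ⟨{p, q}, ⟨?_, ?_⟩, by rw [Finset.card_pair hne]; simp [demand]⟩
    · intro r hr
      simp only [Finset.mem_insert, Finset.mem_singleton] at hr
      rcases hr with rfl | rfl
      · exact h1
      · exact h2
    · intro r hr r' hr' hrr
      simp only [Finset.mem_insert, Finset.mem_singleton] at hr hr'
      rcases hr with rfl | rfl <;> rcases hr' with rfl | rfl
      · exact absurd rfl hrr
      · exact hd
      · exact hd.symm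
      · exact absurd rfl hrr
  | cast i =>
    obtain ⟨p, hp, hp'⟩ := S.exists_netLine (l := i) (by omega)
    have h1 := hp' i.castSucc (by simp)
    refine ⟨{p}, ⟨?_, ?_⟩, by simp [demand]⟩
    · intro r hr
      rw [Finset.mem_singleton] at hr
      exact hr ▸ h1
    · intro r hr r' hr' hrr
      rw [Finset.mem_singleton] at hr hr'
      exact absurd (hr.trans hr'.symm) hrr

/-- The edges at the source make a cut. -/
lemma minCut_source_le (i : Fin (k + 1)) :
    S.graph.minCut (S.source i) (S.target i) ≤ (demand k i : ℕ∞) := by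
  have hv : ∀ l, l < k + 2 → S.Valid (.seg l 0) := fun l hl => ⟨hl, Nat.zero_le _⟩
  have ht : S.target i ∉ ({S.source i} : Set S.NetVert) := fun h => by
    have := congrArg Subtype.val (Set.mem_singleton_iff.1 h)
    simp [source, target] at this
  refine (DirGraph.minCut_le (X := {S.source i}) rfl ht).trans ?_
  have hout : ∀ e : S.NetEdge, S.graph.src e ∈ ({S.source i} : Set S.NetVert) →
      ∃ l, l < k + 2 ∧ min l k = i ∧ e.1 = .seg l 0 := by
    rintro ⟨e, he⟩ h
    have := congrArg Subtype.val (Set.mem_singleton_iff.1 h)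
    rcases e with ⟨l, _ | t⟩ | ⟨r, t⟩
    · simp only [graph, src, source, Vert.source.injEq] at this
      exact ⟨l, he.1, this, rfl⟩
    · simp [graph, src, source] at this
    · simp [graph, src, source] at this
  induction i using Fin.lastCases with
  | last =>
    have hsub : {e | S.graph.src e ∈ ({S.source (Fin.last k)} : Set S.NetVert) ∧
        S.graph.tgt e ∉ ({S.source (Fin.last k)} : Set S.NetVert)} ⊆
        {(⟨.seg k 0, hv k (by omega)⟩ : S.NetEdge), ⟨.seg (k + 1) 0, hv (k + 1) (by omega)⟩} := by
      rintro e ⟨he, -⟩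
      obtain ⟨l, hl, hl', h⟩ := hout e he
      rw [Fin.val_last] at hl'
      rcases (show l = k ∨ l = k + 1 by omega) with rfl | rfl
      · exact Or.inl (Subtype.ext h)
      · exact Or.inr (Subtype.ext h)
    refine (Set.encard_le_encard hsub).trans ((Set.encard_insert_le _ _).trans ?_)
    rw [Set.encard_singleton]
    simp only [demand, Fin.snoc_last]
    norm_num
  | cast i =>
    have hsub : {e | S.graph.src e ∈ ({S.source i.castSucc} : Set S.NetVert) ∧
        S.graph.tgt e ∉ ({S.source i.castSucc} : Set S.NetVert)} ⊆
        {(⟨.seg i 0, hv i (by omega)⟩ : S.NetEdge)} := by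
      rintro e ⟨he, -⟩
      obtain ⟨l, hl, hl', h⟩ := hout e he
      rw [Fin.val_castSucc] at hl'
      obtain rfl : l = i := by omega
      exact Subtype.ext h
    refine (Set.encard_le_encard hsub).trans ?_
    rw [Set.encard_singleton]
    simp [demand]

/-- The network of a timetable. -/
noncomputable def network : Network (demand k) where
  V := S.NetVert
  E := S.NetEdge
  finite_V := S.finite_netVert
  finite_E := S.finite_netEdge
  graph := S.graph
  acyclic := S.graph_acyclic
  S := S.source
  R := S.target
  S_injective i j h := by
    have := congrArg Subtype.val h
    simp only [source, Vert.source.injEq] at this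
    exact Fin.ext this
  R_injective i j h := by
    have := congrArg Subtype.val h
    simp only [target, Vert.sink.injEq] at this
    exact Fin.ext this
  minCut_eq i := by
    refine le_antisymm (S.minCut_source_le i) ?_
    obtain ⟨P, hP, hcard⟩ := S.exists_disjoint_lines i
    rw [← hcard]
    exact hP.card_le_minCut

/-- A path of a commodity starts with one of its lines. -/
lemma path_start {i : Fin (k + 1)} {p : List S.NetEdge}
    (h : S.graph.IsPath (S.source i) (S.target i) p) : ∃ l q, l < k + 2 ∧ min l k = i ∧
      p.map Subtype.val = .seg l 0 :: q ∧ (Edge.seg l 0 :: q).IsChain S.Next ∧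
      (Edge.seg l 0 :: q).getLast?.map S.tgt = some (.sink i) ∧ ∀ e ∈ q, S.Valid e := by
  obtain ⟨h1, h2, h3⟩ := S.graph_isPath_iff.1 h
  have hv : ∀ e ∈ p.map Subtype.val, S.Valid e := by
    intro e he
    obtain ⟨a, -, rfl⟩ := List.mem_map.1 he
    exact a.2
  generalize p.map Subtype.val = p' at h1 h2 h3 hv
  rcases p' with _ | ⟨e, q⟩
  · simp at h2
  simp only [List.head?_cons, Option.map_some, source, Option.some.injEq] at h2
  have he := hv e (by simp)
  rcases e with ⟨l, _ | t⟩ | ⟨r, t⟩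
  · simp only [src, Vert.source.injEq] at h2
    exact ⟨l, q, he.1, h2, rfl, h1, h3, fun e he => hv e (by simp [he])⟩
  · simp [src] at h2
  · simp [src] at h2

/-- Sets of Menger's paths in the network of a timetable consist of its lines. -/
lemma exists_line_mem {α : Fin (k + 1) → Finset (List S.NetEdge)}
    (hα : ∀ i, S.graph.IsMengerPaths (S.source i) (S.target i) (α i)) {l : ℕ} (hl : l < k + 2) :
    ∃ i : Fin (k + 1), (i : ℕ) = min l k ∧ ∃ p ∈ α i, p.map Subtype.val = S.line l 0 S.T := by
  have hcard : ∀ i, demand k i ≤ (α i).card := by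
    intro i
    obtain ⟨P, hP, hcard⟩ := S.exists_disjoint_lines i
    exact hcard ▸ (hα i).2 P hP
  by_cases hlk : l < k
  · have h1 := hcard (Fin.castSucc ⟨l, hlk⟩)
    simp only [demand, Fin.snoc_castSucc] at h1
    obtain ⟨p, hp⟩ := Finset.card_pos.1 h1
    refine ⟨_, by simp [hlk.le], p, hp, ?_⟩
    obtain ⟨m, q, hm, hm', hpq, hc, hlast, hv⟩ := S.path_start ((hα _).1.1 p hp)
    simp only [Fin.val_castSucc] at hm' hlast
    obtain rfl : m = l := by omega
    rw [hpq]
    exact (eq_line hlk S.T 0 m q (by omega) hc hlast hm hv (S.know_self m 0)).2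
  · have h1 := hcard (Fin.last k)
    simp only [demand, Fin.snoc_last] at h1
    obtain ⟨p, p', hp, hp', hne⟩ := Finset.one_lt_card_iff.1 h1
    obtain ⟨m, q, hm, hm', hpq, hc, hlast, hv⟩ := S.path_start ((hα _).1.1 p hp)
    obtain ⟨m', q', hn, hn', hpq', hc', hlast', hv'⟩ := S.path_start ((hα _).1.1 p' hp')
    rw [Fin.val_last] at hm' hn' hlast hlast'
    have hd := S.map_disjoint ((hα _).1.2 p hp p' hp' hne)
    rw [hpq, hpq'] at hd
    have hmm : m ≠ m' := by
      rintro rfl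
      exact hd (a := .seg m 0) (by simp) (by simp)
    obtain ⟨s1, s2⟩ := S.col_start
    have hok : S.Ok 0 k (k + 1) := by
      refine ⟨by omega, by omega, by omega, fun c hc h1 => by omega⟩
    have hok' : S.Ok 0 m m' := by
      rcases (show (m = k ∧ m' = k + 1) ∨ (m' = k ∧ m = k + 1) by omega) with
        ⟨rfl, rfl⟩ | ⟨rfl, rfl⟩
      · exact hok
      · exact hok.symm
    have hd' : List.Disjoint q q' := fun e he he' => hd (a := e) (by simp [he]) (by simp [he'])
    have key := eq_lines S.T 0 m m' q q' (by omega) hc hc' hlast hlast' hm hn hv hv' hd' hok'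
    refine ⟨Fin.last k, by rw [Fin.val_last]; omega, ?_⟩
    rw [← hpq, ← hpq'] at key
    rcases (show l = k ∨ l = k + 1 by omega) with rfl | rfl
    · rcases key with ⟨-, -, h, -⟩ | ⟨-, -, h, -⟩
      · exact ⟨p, hp, h⟩
      · exact ⟨p', hp', h⟩
    · rcases key with ⟨-, -, -, h⟩ | ⟨-, -, -, h⟩
      · exact ⟨p', hp', h⟩
      · exact ⟨p, hp, h⟩

lemma infix_of_map {p : List S.NetEdge} {f e : Edge} (h : [f, e] <:+: p.map Subtype.val) :
    ∃ f' e' : S.NetEdge, f'.1 = f ∧ e'.1 = e ∧ [f', e'] <:+: p := by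
  obtain ⟨a, b, h⟩ := h
  obtain ⟨p₁, p₂, rfl, h1, -⟩ := List.map_eq_append_iff.1 h.symm
  obtain ⟨p₃, p₄, rfl, -, h2⟩ := List.map_eq_append_iff.1 h1
  rcases p₄ with _ | ⟨f', _ | ⟨e', _ | ⟨g, p₄⟩⟩⟩ <;> simp at h2
  exact ⟨f', e', h2.1, h2.2, p₃, p₂, by simp⟩

/-- The events of a timetable are mergings that no choice of Menger's paths avoids. -/
theorem card_le_mergingNumber (P : Finset (ℕ × ℕ)) (hP : ∀ x ∈ P, ∃ t, S.Ev t x.1 x.2) :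
    (P.card : ℕ∞) ≤ mergingNumber (demand k) := by
  refine le_trans ?_ (le_iSup _ S.network)
  refine le_iInf fun α => le_iInf fun hα => ?_
  choose! t ht using hP
  unfold numMergings
  rw [← Set.encard_coe_eq_coe_finsetCard]
  have hval : ∀ x ∈ P, S.Valid (.run x.1 (t x)) := fun x hx => by
    have := S.ev_lt _ _ _ (ht x hx)
    exact ⟨by omega, by omega⟩
  classical
  rcases P.eq_empty_or_nonempty with rfl | ⟨x₀, hx₀⟩
  · simp
  let F : ℕ × ℕ → S.NetEdge := fun x =>
    if h : x ∈ P then ⟨.run x.1 (t x), hval x h⟩ else ⟨_, hval x₀ hx₀⟩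
  have hF : ∀ x ∈ P, (F x).1 = .run x.1 (t x) := fun x hx => by
    change (if h : x ∈ P then (⟨.run x.1 (t x), hval x h⟩ : S.NetEdge) else _).1 = _
    rw [dif_pos hx]
  refine Set.encard_le_encard_of_injOn (f := F) ?_ ?_
  · intro x hx
    have hx' : x ∈ P := hx
    have hev := ht x hx'
    have hlt := S.ev_lt _ _ _ hev
    obtain ⟨r1, r2⟩ := rep_of_ev hev
    obtain ⟨i, hi, p, hp, hpl⟩ := S.exists_line_mem hα (l := x.1) (by omega)
    obtain ⟨j, hj, q, hq, hql⟩ := S.exists_line_mem hα (l := x.2) (by omega)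
    have h1 := S.line_infix x.1 0 S.T (t x) (by omega) (by omega)
    have h2 := S.line_infix x.2 0 S.T (t x) (by omega) (by omega)
    rw [← hpl, r1] at h1
    rw [← hql, r2] at h2
    obtain ⟨f, e, hf, he, h1⟩ := S.infix_of_map h1
    obtain ⟨g, e', hg, he', h2⟩ := S.infix_of_map h2
    obtain rfl : e = F x := Subtype.ext (he.trans (hF x hx').symm)
    obtain rfl : e' = F x := Subtype.ext (he'.trans (hF x hx').symm)
    refine ⟨i, j, ?_, p, hp, q, hq, f, g, ?_, h1, h2⟩
    · rintro rfl
      omega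
    · rintro rfl
      rw [hf] at hg
      injection hg
      omega
  · intro x hx y hy hxy
    have h := congrArg Subtype.val hxy
    rw [hF x hx, hF y hy] at h
    injection h with h1 h2
    have e1 := ht x hx
    have e2 := ht y hy
    rw [← h2] at e2
    obtain ⟨e3, e4⟩ := S.matching _ _ _ _ _ e1 e2 (Or.inl h1)
    exact Prod.ext e3 e4

end Timetable

/-! ### The chain timetable -/

lemma SameLine.of_pair {Ev : ℕ → ℕ → ℕ → Prop} {t a b l m : ℕ} (h : Ev t a b) (hl : l = a ∨ l = b)
    (hm : m = a ∨ m = b) : SameLine Ev t l m := by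
  rcases hl with rfl | rfl <;> rcases hm with rfl | rfl
  exacts [Or.inl rfl, Or.inr (Or.inl h), Or.inr (Or.inr h), Or.inl rfl]

/-- The colours of `chainTimetable`. A player has colour `0` until a route of the last commodity may
reach it, which happens by way of the player before it or, for the first player, of the line `k`.
The value `3` stands for the absence of any
restriction. -/
def chainCol (k t l : ℕ) : ℕ :=
  if l = k then 1 else if l = k + 1 then 2 else if t < 3 * l ∨ t = 0 then 0 else
    if t = 3 * l + 1 then 1 else if t ≤ 3 * l + 4 then 2 else 3

lemma chainCol_zero {k t l : ℕ} : chainCol k t l = 0 ↔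
    l ≠ k ∧ l ≠ k + 1 ∧ (t < 3 * l ∨ t = 0) := by
  generalize h : chainCol k t l = c
  unfold chainCol at h
  split_ifs at h <;> omega

lemma chainCol_one {k t l : ℕ} : chainCol k t l = 1 ↔ l = k ∨ (l ≠ k + 1 ∧ t = 3 * l + 1) := by
  generalize h : chainCol k t l = c
  unfold chainCol at h
  split_ifs at h <;> omega

lemma chainCol_two {k t l : ℕ} : chainCol k t l = 2 ↔ l ≠ k ∧ (l = k + 1 ∨
    (0 < t ∧ 3 * l ≤ t ∧ t ≠ 3 * l + 1 ∧ t ≤ 3 * l + 4)) := by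
  generalize h : chainCol k t l = c
  unfold chainCol at h
  split_ifs at h <;> omega

/-- The timetable in which the player `i` runs together with the two lines at the times `3 * i` and
`3 * i + 1`, and then with the player `i + 1` at time `3 * i + 2`. -/
def chainTimetable (k : ℕ) : Timetable k where
  T := 3 * k
  Ev t x y := x < k ∧ ((y = k ∧ t = 3 * x) ∨ (y = k + 1 ∧ t = 3 * x + 1) ∨
    (y = x + 1 ∧ y < k ∧ t = 3 * x + 2))
  Know i t l := l = i ∨ (i < l ∧ l < k ∧ 3 * i + 2 < t) ∨ (l = k ∧ 3 * i < t) ∨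
    (l = k + 1 ∧ 3 * i + 1 < t) ∨ (l + 1 = i ∧ 3 * i ≤ t)
  col := chainCol k
  ev_lt t x y h := by omega
  matching t x y x' y' h h' hs := by omega
  know_self i t := Or.inl rfl
  know_mono i t l hi h := by omega
  know_step i t x y hi h := by
    constructor
    · intro h'
      omega
    · intro h'
      omega
  know_avoid t x y h := by
    constructor
    · omega
    · omega
  col_start := ⟨chainCol_one.2 (by omega), chainCol_two.2 (by omega)⟩
  col_ne_zero t l m ht h h' := by
    rw [Ne, chainCol_zero] at *
    rcases h with rfl | h | h <;> omega
  col_live t l m m' c ht hc h h0 hcl hm' h1 h2 := by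
    rw [Ne, chainCol_zero] at h0
    -- a line takes the colour `1` or `2` in exchange for another one different from `0` only when
    -- it meets one of the lines `k` and `k + 1`, and then no other line has the new colour
    rcases hc with rfl | rfl
    · rw [Ne, chainCol_one] at hcl
      rw [chainCol_one] at h1 h2
      have : ∃ r, r < k ∧ t = 3 * r := by
        rcases h with rfl | h | h
        · exact ⟨l, by omega⟩
        · exact ⟨l, by omega⟩
        · exact ⟨m, by omega⟩
      obtain ⟨r, hr, rfl⟩ := this
      exact SameLine.of_pair (a := r) (b := k) ⟨hr, Or.inl ⟨rfl, rfl⟩⟩ (by omega) (by omega)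
    · rw [Ne, chainCol_two] at hcl
      rw [chainCol_two] at h1 h2
      have : ∃ r, r < k ∧ t = 3 * r + 1 := by
        rcases h with rfl | h | h
        · exact ⟨l, by omega⟩
        · exact ⟨l, by omega⟩
        · exact ⟨m, by omega⟩
      obtain ⟨r, hr, rfl⟩ := this
      exact SameLine.of_pair (a := r) (b := k + 1) ⟨hr, Or.inr (Or.inl ⟨rfl, rfl⟩)⟩ (by omega) (by omega)
  col_first t x h := ⟨chainCol_two.2 (by omega), by rw [chainCol_zero, chainCol_two]; omega⟩
  col_second t x h := ⟨chainCol_one.2 (by omega), by rw [chainCol_zero, chainCol_one]; omega⟩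
  not_both t x y h h' := by omega

/-! ### The grid timetable -/

/-- The colours of `gridTimetable`; the value `3` stands for the absence of any restriction. A
player has colour `0` until a route of the last commodity may reach it. After the first two events
all routes on players go back to the common edge of the player `0` and the line `k + 1`, or to that
line itself, hence the colour `2`. This changes only when a player meets the line `k`: it has colour
`1` at the next moment. -/
def gridCol (k m t l : ℕ) : ℕ :=
  if 5 * k + 1 < t then 3 else if l = k then 1 else if l = k + 1 then 2 else
    if l = 0 then (if t ≤ 1 then t else 2) else
    if l ≤ m then (if t ≤ 1 + l then 0 else if t < 2 * k + l then 2 else if t = 2 * k + l then 1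
      else 3) else
    if l < k - 1 then (if t + m ≤ 1 + l then 0 else 2) else
    if l = k - 1 then (if t ≤ 3 * k then 0 else if t ≤ 5 * k then 2 else 1) else 0

lemma gridCol_zero {k m t l : ℕ} (hk : 2 ≤ k) (hm : m ≤ k - 2) : gridCol k m t l = 0 ↔
    t ≤ 5 * k + 1 ∧ ((l = 0 ∧ t = 0) ∨ (1 ≤ l ∧ l ≤ m ∧ t ≤ 1 + l) ∨
      (m < l ∧ l < k - 1 ∧ t + m ≤ 1 + l) ∨ (l = k - 1 ∧ t ≤ 3 * k) ∨ k + 1 < l) := by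
  generalize h : gridCol k m t l = c
  unfold gridCol at h
  split_ifs at h <;> omega

lemma gridCol_one {k m t l : ℕ} (hk : 2 ≤ k) (hm : m ≤ k - 2) : gridCol k m t l = 1 ↔
    t ≤ 5 * k + 1 ∧ (l = k ∨ (l = 0 ∧ t = 1) ∨ (1 ≤ l ∧ l ≤ m ∧ t = 2 * k + l) ∨
      (l = k - 1 ∧ 5 * k < t)) := by
  generalize h : gridCol k m t l = c
  unfold gridCol at h
  split_ifs at h <;> omega

lemma gridCol_two {k m t l : ℕ} (hk : 2 ≤ k) (hm : m ≤ k - 2) : gridCol k m t l = 2 ↔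
    t ≤ 5 * k + 1 ∧ (l = k + 1 ∨ (l = 0 ∧ 2 ≤ t) ∨ (1 ≤ l ∧ l ≤ m ∧ 1 + l < t ∧ t < 2 * k + l) ∨
      (m < l ∧ l < k - 1 ∧ 1 + l < t + m) ∨ (l = k - 1 ∧ 3 * k < t ∧ t ≤ 5 * k)) := by
  generalize h : gridCol k m t l = c
  unfold gridCol at h
  split_ifs at h <;> omega

/-- The events of `gridTimetable`. The players are `0`, the left half `1, …, m`, the right half
`m + 1, …, k - 2`, and `k - 1`. First the player `0` meets both lines. Then it meets the left half
while the right half meets the line `k + 1`. Then the two halves meet each other, and after this the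
left half meets the line `k`. At last the player `k - 1` meets the player `0`, the right half and
both lines. The indices of the players stagger the events, so that nobody has two at a time. -/
def GridEv (k m t x y : ℕ) : Prop :=
  (x = 0 ∧ y = k ∧ t = 0) ∨ (x = 0 ∧ y = k + 1 ∧ t = 1) ∨
    (x = 0 ∧ 1 ≤ y ∧ y ≤ m ∧ t = 1 + y) ∨
    (m < x ∧ x < k - 1 ∧ y = k + 1 ∧ t + m = 1 + x) ∨
    (1 ≤ x ∧ x ≤ m ∧ m < y ∧ y < k - 1 ∧ t + m + 2 = k + x + y) ∨
    (1 ≤ x ∧ x ≤ m ∧ y = k ∧ t + 1 = 2 * k + x) ∨ (x = 0 ∧ y = k - 1 ∧ t = 3 * k) ∨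
    (m < x ∧ x < k - 1 ∧ y = k - 1 ∧ t + m = 3 * k + x) ∨
    (x = k - 1 ∧ y = k ∧ t = 5 * k) ∨ (x = k - 1 ∧ y = k + 1 ∧ t = 5 * k + 1)

/-- The event at which a line takes the colour `c` in exchange for another colour. -/
lemma gridCol_change {k m t l c : ℕ} (hk : 2 ≤ k) (hm : m ≤ k - 2)
    (hc : c = 1 ∨ c = 2) {n : ℕ} (h : SameLine (GridEv k m) t l n) (h0 : gridCol k m t l ≠ 0)
    (h1 : gridCol k m t l ≠ c) (h2 : gridCol k m (t + 1) n = c) :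
    (c = 2 ∧ t = 1) ∨ (c = 1 ∧ ∃ r, 1 ≤ r ∧ r ≤ m ∧ t + 1 = 2 * k + r) ∨ (c = 1 ∧ t = 5 * k) := by
  rw [Ne, gridCol_zero hk hm] at h0
  rcases hc with rfl | rfl
  · rw [Ne, gridCol_one hk hm] at h1
    rw [gridCol_one hk hm] at h2
    suffices (2 * k ≤ t ∧ t + 1 ≤ 2 * k + m) ∨ t = 5 * k by
      rcases this with h | h
      · exact Or.inr (Or.inl ⟨rfl, t + 1 - 2 * k, by omega⟩)
      · exact Or.inr (Or.inr ⟨rfl, h⟩)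
    rcases h with rfl | h | h
    · omega
    · rcases h with h | h | h | h | h | h | h | h | h | h <;> omega
    · rcases h with h | h | h | h | h | h | h | h | h | h <;> omega
  · rw [Ne, gridCol_two hk hm] at h1
    rw [gridCol_two hk hm] at h2
    refine Or.inl ⟨rfl, ?_⟩
    rcases h with rfl | h | h
    · omega
    · rcases h with h | h | h | h | h | h | h | h | h | h <;> omega
    · rcases h with h | h | h | h | h | h | h | h | h | h <;> omega

/-- After an event both lines have colours different from `0`. -/
lemma gridCol_ne_zero {k m t x y : ℕ} (hk : 2 ≤ k) (hm : m ≤ k - 2) (h : GridEv k m t x y) :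
    gridCol k m (t + 1) x ≠ 0 ∧ gridCol k m (t + 1) y ≠ 0 := by
  rw [Ne, Ne, gridCol_zero hk hm, gridCol_zero hk hm]
  rcases h with ⟨rfl, rfl, h⟩ | ⟨rfl, rfl, h⟩ | ⟨rfl, hy, hy', h⟩ | ⟨hx, hx', rfl, h⟩ |
    ⟨hx, hx', hy, hy', h⟩ | ⟨hx, hx', rfl, h⟩ | ⟨rfl, rfl, h⟩ | ⟨hx, hx', rfl, h⟩ | ⟨rfl, rfl, h⟩ |
    ⟨rfl, rfl, h⟩ <;> (constructor <;> omega)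

/-- A lower bound for the time at which a route of the player `i` of `gridTimetable` can be on the
line `l ≠ i`. -/
def gridReach (k m i l : ℕ) : ℕ :=
  if l = 0 then (if i ≤ m then i + 2 else if i < k - 1 then 3 * k + i - m + 1 else 3 * k + 1)
  else if l ≤ m then
    (if i = 0 then l + 2 else if i ≤ m then (if i < l then i + 2 else 2 * k + i) else
      if i < k - 1 then k + l + i - m - 1 else 5 * k + 2)
  else if l < k - 1 then
    (if i = 0 then 3 else if i ≤ m then k + i + l - m - 1 else
      if i < k - 1 then (if i < l then i - m + 2 else 3 * k + i - m + 1) else 3 * k + l - m + 1)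
  else if l = k - 1 then
    (if i = 0 then 3 * k + 1 else if i ≤ m then 2 * k + i else 3 * k + i - m + 1)
  else if l = k then
    (if i = 0 then 1 else if i ≤ m then 2 * k + i else if i < k - 1 then 2 * k else 5 * k + 1)
  else
    (if i = 0 then 2 else if i ≤ m then 2 * k + i else if i < k - 1 then i - m + 2 else 5 * k + 2)

lemma gridReach_left {k m i l : ℕ} (h1 : 1 ≤ l) (h2 : l ≤ m) : gridReach k m i l =
    if i = 0 then l + 2 else if i ≤ m then (if i < l then i + 2 else 2 * k + i) else
      if i < k - 1 then k + l + i - m - 1 else 5 * k + 2 := by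
  rw [gridReach, if_neg (by omega), if_pos h2]

lemma gridReach_right {k m i l : ℕ} (h1 : m < l) (h2 : l < k - 1) : gridReach k m i l =
    if i = 0 then 3 else if i ≤ m then k + i + l - m - 1 else
      if i < k - 1 then (if i < l then i - m + 2 else 3 * k + i - m + 1) else
        3 * k + l - m + 1 := by
  rw [gridReach, if_neg (by omega), if_neg (by omega), if_pos h2]

lemma gridReach_last {k m i : ℕ} (hk : 2 ≤ k) (hm : m ≤ k - 2) : gridReach k m i (k - 1) =
    if i = 0 then 3 * k + 1 else if i ≤ m then 2 * k + i else 3 * k + i - m + 1 := by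
  rw [gridReach, if_neg (by omega), if_neg (by omega), if_neg (by omega), if_pos rfl]

lemma gridReach_k {k m i : ℕ} (hk : 2 ≤ k) (hm : m ≤ k - 2) : gridReach k m i k =
    if i = 0 then 1 else if i ≤ m then 2 * k + i else if i < k - 1 then 2 * k else 5 * k + 1 := by
  rw [gridReach, if_neg (by omega), if_neg (by omega), if_neg (by omega), if_neg (by omega),
    if_pos rfl]

lemma gridReach_k_add_one {k m i : ℕ} (hk : 2 ≤ k) (hm : m ≤ k - 2) : gridReach k m i (k + 1) =
    if i = 0 then 2 else if i ≤ m then 2 * k + i else if i < k - 1 then i - m + 2 else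
      5 * k + 2 := by
  rw [gridReach, if_neg (by omega), if_neg (by omega), if_neg (by omega), if_neg (by omega),
    if_neg (by omega)]

/-- The bound `gridReach` is compatible with the events, and no player meets a line on which it may
already be. -/
lemma gridReach_step {k m i t x y : ℕ} (hk : 2 ≤ k) (hm : m ≤ k - 2) (hi : i < k)
    (h : GridEv k m t x y) : (x = i ∨ gridReach k m i x ≤ t → y = i ∨ gridReach k m i y ≤ t + 1) ∧
      (y = i ∨ gridReach k m i y ≤ t → x = i ∨ gridReach k m i x ≤ t + 1) ∧
      (x = i → t < gridReach k m i y) ∧ (y = i → t < gridReach k m i x) := by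
  have h0 : gridReach k m i 0 =
      if i ≤ m then i + 2 else if i < k - 1 then 3 * k + i - m + 1 else 3 * k + 1 := if_pos rfl
  rcases h with ⟨rfl, rfl, h⟩ | ⟨rfl, rfl, h⟩ | ⟨rfl, hy, hy', h⟩ | ⟨hx, hx', rfl, h⟩ |
    ⟨hx, hx', hy, hy', h⟩ | ⟨hx, hx', rfl, h⟩ | ⟨rfl, rfl, h⟩ | ⟨hx, hx', rfl, h⟩ | ⟨rfl, rfl, h⟩ |
    ⟨rfl, rfl, h⟩
  · rw [h0, gridReach_k hk hm]
    split_ifs <;> omega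
  · rw [h0, gridReach_k_add_one hk hm]
    split_ifs <;> omega
  · rw [h0, gridReach_left hy hy']
    split_ifs <;> omega
  · rw [gridReach_right hx hx', gridReach_k_add_one hk hm]
    split_ifs <;> omega
  · rw [gridReach_left hx hx', gridReach_right hy hy']
    split_ifs <;> omega
  · rw [gridReach_left hx hx', gridReach_k hk hm]
    split_ifs <;> omega
  · rw [h0, gridReach_last hk hm]
    split_ifs <;> omega
  · rw [gridReach_right hx hx', gridReach_last hk hm]
    split_ifs <;> omega
  · rw [gridReach_last hk hm, gridReach_k hk hm]
    split_ifs <;> omega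
  · rw [gridReach_last hk hm, gridReach_k_add_one hk hm]
    split_ifs <;> omega

/-- The timetable with the events `GridEv`, in which each of the players `1, …, m` meets each of the
players `m + 1, …, k - 2`. -/
def gridTimetable (k m : ℕ) (hk : 2 ≤ k) (hm : m ≤ k - 2) : Timetable k where
  T := 5 * k + 2
  Ev := GridEv k m
  Know i t l := l = i ∨ gridReach k m i l ≤ t
  col := gridCol k m
  ev_lt t x y h := by
    rcases h with h | h | h | h | h | h | h | h | h | h <;> omega
  matching t x y x' y' h h' hs := by
    unfold GridEv at h'
    rcases h with h | h | h | h | h | h | h | h | h | h <;> omega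
  know_self i t := Or.inl rfl
  know_mono i t l hi h := h.imp_right fun h => h.trans (Nat.le_succ t)
  know_step i t x y hi h := ⟨(gridReach_step hk hm hi h).1, (gridReach_step hk hm hi h).2.1⟩
  know_avoid t x y h := by
    have hx : x < k ∧ x < y := by
      rcases h with h | h | h | h | h | h | h | h | h | h <;> omega
    have h1 := (gridReach_step hk hm hx.1 h).2.2.1 rfl
    refine ⟨by omega, fun hy => ?_⟩
    have h2 := (gridReach_step hk hm hy h).2.2.2 rfl
    omega
  col_start := ⟨(gridCol_one hk hm).2 (by omega), (gridCol_two hk hm).2 (by omega)⟩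
  col_ne_zero t l n ht h h' := by
    rcases h with rfl | h | h
    · rw [Ne, gridCol_zero hk hm] at *
      omega
    · exact (gridCol_ne_zero hk hm h).2
    · exact (gridCol_ne_zero hk hm h).1
  col_live t l n n' c ht hc h h0 h1 hn' h2 h3 := by
    rcases gridCol_change hk hm hc h h0 h1 h2 with ⟨rfl, rfl⟩ | ⟨rfl, r, hr⟩ | ⟨rfl, rfl⟩
    · rw [gridCol_two hk hm] at h2 h3
      exact SameLine.of_pair (a := 0) (b := k + 1) (Or.inr (Or.inl ⟨rfl, rfl, rfl⟩))
        (by omega) (by omega)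
    · rw [gridCol_one hk hm] at h2 h3
      have : GridEv k m t r k := by
        iterate 5 apply Or.inr
        exact Or.inl ⟨hr.1, hr.2.1, rfl, hr.2.2⟩
      exact SameLine.of_pair this (by omega) (by omega)
    · rw [gridCol_one hk hm] at h2 h3
      have : GridEv k m (5 * k) (k - 1) k := by
        iterate 8 apply Or.inr
        exact Or.inl ⟨rfl, rfl, rfl⟩
      exact SameLine.of_pair this (by omega) (by omega)
  col_first t x h := by
    have : (x = 0 ∧ t = 0) ∨ (1 ≤ x ∧ x ≤ m ∧ t + 1 = 2 * k + x) ∨ (x = k - 1 ∧ t = 5 * k) := by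
      rcases h with h | h | h | h | h | h | h | h | h | h <;> omega
    rw [gridCol_two hk hm, gridCol_two hk hm, gridCol_zero hk hm]
    rcases this with h | h | h <;> (constructor <;> omega)
  col_second t x h := by
    have : (x = 0 ∧ t = 1) ∨ (m < x ∧ x < k - 1 ∧ t + m = 1 + x) ∨
        (x = k - 1 ∧ t = 5 * k + 1) := by
      rcases h with h | h | h | h | h | h | h | h | h | h <;> omega
    rw [gridCol_one hk hm, gridCol_one hk hm, gridCol_zero hk hm]
    rcases this with h | h | h <;> (constructor <;> omega)
  not_both t x y h h' := by
    unfold GridEv at h'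
    rcases h with h | h | h | h | h | h | h | h | h | h <;> omega

/-! ### The value -/

lemma mergingNumber_demand_ge_chain (k : ℕ) (hk : 1 ≤ k) :
    ((3 * k - 1 : ℕ) : ℕ∞) ≤ mergingNumber (Timetable.demand k) := by
  let A : Finset (ℕ × ℕ) := (Finset.range k ×ˢ {k, k + 1})
  let B : Finset (ℕ × ℕ) := (Finset.range (k - 1)).image fun x => (x, x + 1)
  have hB : B.card = k - 1 := by
    rw [Finset.card_image_of_injective _ fun x y h => (Prod.mk.inj h).1, Finset.card_range]
  have hA : A.card = k * 2 := by
    rw [Finset.card_product, Finset.card_range, Finset.card_pair (by omega)]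
  have hd : Disjoint A B := by
    rw [Finset.disjoint_left]
    rintro ⟨x, y⟩ h h'
    simp only [A, B, Finset.mem_product, Finset.mem_image, Finset.mem_range, Finset.mem_insert,
      Finset.mem_singleton, Prod.mk.injEq] at h h'
    obtain ⟨z, hz, rfl, rfl⟩ := h'
    omega
  have := (chainTimetable k).card_le_mergingNumber (A ∪ B) (by
    rintro ⟨x, y⟩ h
    simp only [A, B, Finset.mem_union, Finset.mem_product, Finset.mem_image, Finset.mem_range,
      Finset.mem_insert, Finset.mem_singleton, Prod.mk.injEq] at h
    rcases h with ⟨h, rfl | rfl⟩ | ⟨z, hz, rfl, rfl⟩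
    · exact ⟨3 * x, h, Or.inl ⟨rfl, rfl⟩⟩
    · exact ⟨3 * x + 1, h, Or.inr (Or.inl ⟨rfl, rfl⟩)⟩
    · exact ⟨3 * z + 2, by omega, Or.inr (Or.inr ⟨rfl, by omega, rfl⟩)⟩)
  rw [Finset.card_union_of_disjoint hd, hA, hB] at this
  rwa [show 3 * k - 1 = k * 2 + (k - 1) by omega]

lemma mergingNumber_demand_ge_grid (k m : ℕ) (hk : 2 ≤ k) (hm : m ≤ k - 2) :
    ((m * (k - 2 - m) + 2 * (k - 2) + 5 : ℕ) : ℕ∞) ≤ mergingNumber (Timetable.demand k) := by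
  let A := Finset.Icc 1 m
  let B := Finset.Ico (m + 1) (k - 1)
  have hA : A.card = m := by simp [A]
  have hB : B.card = k - 2 - m := by
    rw [Nat.card_Ico]
    omega
  let P := A ×ˢ B ∪ ({0} ×ˢ A ∪ (A ×ˢ {k} ∪ (B ×ˢ {k - 1, k + 1} ∪
    ({0, k - 1} ×ˢ {k, k + 1} ∪ {(0, k - 1)}))))
  have hP : P.card = m * (k - 2 - m) + 2 * (k - 2) + 5 := by
    have h1 : ({k - 1, k + 1} : Finset ℕ).card = 2 := Finset.card_pair (by omega)
    have h2 : ({0, k - 1} : Finset ℕ).card = 2 := Finset.card_pair (by omega)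
    have h3 : ({k, k + 1} : Finset ℕ).card = 2 := Finset.card_pair (by omega)
    have hm' : k - 2 = m + (k - 2 - m) := by omega
    rw [Finset.card_union_of_disjoint, Finset.card_union_of_disjoint,
      Finset.card_union_of_disjoint, Finset.card_union_of_disjoint,
      Finset.card_union_of_disjoint]
    · simp only [Finset.card_product, Finset.card_singleton, hA, hB, h1, h2, h3]
      omega
    all_goals
      rw [Finset.disjoint_left]
      rintro ⟨x, y⟩ h h'
      simp only [A, B, Finset.mem_union, Finset.mem_product, Finset.mem_Icc, Finset.mem_Ico,
        Finset.mem_insert, Finset.mem_singleton, Prod.mk.injEq] at h h'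
      omega
  rw [← hP]
  refine (gridTimetable k m hk hm).card_le_mergingNumber P ?_
  rintro ⟨x, y⟩ h
  simp only [P, A, B, Finset.mem_union, Finset.mem_product, Finset.mem_Icc, Finset.mem_Ico,
    Finset.mem_insert, Finset.mem_singleton, Prod.mk.injEq] at h
  rcases h with h | h | h | h | ⟨rfl | rfl, rfl | rfl⟩ | h
  · refine ⟨k + x + y - m - 2, ?_⟩
    iterate 4 apply Or.inr
    exact Or.inl (by omega)
  · refine ⟨1 + y, ?_⟩
    iterate 2 apply Or.inr
    exact Or.inl (by omega)
  · refine ⟨2 * k + x - 1, ?_⟩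
    iterate 5 apply Or.inr
    exact Or.inl (by omega)
  · rcases h with ⟨h, rfl | rfl⟩
    · refine ⟨3 * k + x - m, ?_⟩
      iterate 7 apply Or.inr
      exact Or.inl (by omega)
    · refine ⟨1 + x - m, ?_⟩
      iterate 3 apply Or.inr
      exact Or.inl (by omega)
  · refine ⟨0, ?_⟩
    exact Or.inl (by omega)
  · refine ⟨1, ?_⟩
    apply Or.inr
    exact Or.inl (by omega)
  · refine ⟨5 * y, ?_⟩
    iterate 8 apply Or.inr
    exact Or.inl (by omega)
  · refine ⟨5 * k + 1, ?_⟩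
    iterate 9 apply Or.inr
    omega
  · refine ⟨3 * k, ?_⟩
    iterate 6 apply Or.inr
    exact Or.inl (by omega)

theorem mainTheorem7 (k : ℕ) (hk : 1 ≤ k) :
    mergingNumber (Fin.snoc (α := fun _ => ℕ) (fun _ : Fin k => 1) 2 : Fin (k + 1) → ℕ) =
      ((if k ≤ 6 then 3 * k - 1 else k ^ 2 / 4 + k + 2 : ℕ) : ℕ∞) := by
  refine le_antisymm (iSup_le fun G => G.minMergings_le) ?_
  split_ifs with h
  · exact mergingNumber_demand_ge_chain k hk
  · -- the product `m * (k - 2 - m)` is largest for `m = (k - 2) / 2`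
    refine le_trans (Nat.cast_le.2 (le_of_eq ?_))
      (mergingNumber_demand_ge_grid k ((k - 2) / 2) (by omega) (by omega))
    have hj : ∃ j, k = 2 * j + 2 ∨ k = 2 * j + 3 := ⟨(k - 2) / 2, by omega⟩
    obtain ⟨j, rfl | rfl⟩ := hj
    · rw [show (2 * j + 2) ^ 2 / 4 = j * j + 2 * j + 1 by
          rw [show (2 * j + 2) ^ 2 = 4 * (j * j + 2 * j + 1) by ring]
          omega, show (2 * j + 2 - 2) / 2 = j by omega, show 2 * j + 2 - 2 - j = j by omega]
      omega
    · rw [show (2 * j + 3) ^ 2 / 4 = j * j + 3 * j + 2 by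
          rw [show (2 * j + 3) ^ 2 = 4 * (j * j + 3 * j + 2) + 1 by ring]
          omega, show (2 * j + 3 - 2) / 2 = j by omega, show 2 * j + 3 - 2 - j = j + 1 by omega,
        mul_add_one]
      omega
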